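/- Throughout, $\mathbb K\in\{\mathbb R,\mathbb C\}$, all Banach spaces are over $\mathbb K$, $B_X$ is the closed unit ball of $X$, and operators are bounded and linear. **Trees.** For an ordinal $a$ and a finite sequence of ordinals put $a+(\zeta_1,\dots,\zeta_k)=(a+\zeta_1,\dots,a+\zeta_k)$. Sets of finite sequences are ordered by $s\le t$ iff $s$ is an initial segment of $t$, and $MAX(T)$ is the set of maximal elements of $T$. Let $\Gamma_{0,1}=\{(0)\}$. Given $\Gamma_{\xi,1}$, let for $1\le i\le n$ $$\Lambda_{\xi,n,i}=\{(\omega^\xi(n-1)+t_1)^\frown\cdots^\frown(\omega^\xi(n-i)+t_i): t_1,\dots,t_{i-1}\in MAX(\Gamma_{\xi,1}),\ t_i\in\Gamma_{\xi,1}\},$$ $\Gamma_{\xi,n}=\bigcup_{i=1}^n\Lambda_{\xi,n,i}$ and $\Gamma_{\xi+1,1}=\bigcup_{n\ge1}\Gamma_{\xi,n}$; for a limit ordinal $\xi$ let $\Gamma_{\xi,1}=\bigcup_{\zeta<\xi}(\omega^\zeta+\Gamma_{\zeta+1,1})$. The weights $\mathbb P_{\xi,n}:\Gamma_{\xi,n}\to[0,1]$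 are given by $\mathbb P_{0,1}((0))=1$; $\mathbb P_{\xi,n}((\omega^\xi(n-1)+t_1)^\frown\cdots^\frown(\omega^\xi(n-i)+t_i))=\mathbb P_{\xi,1}(t_i)$; $\mathbb P_{\xi+1,1}(t)=\frac1n\mathbb P_{\xi,n}(t)$ for $t\in\Gamma_{\xi,n}$; and $\mathbb P_{\xi,1}(\omega^\zeta+t)=\mathbb P_{\zeta+1,1}(t)$ for $\xi$ a limit ordinal, $\zeta<\xi$ and $t\in\Gamma_{\zeta+1,1}$. For a (nonempty) directed set $D$ and $T$ one of the sets $\Gamma_{\xi,n}$, $\Lambda_{\xi,n,i}$, let $T.D=\{(\zeta_j,u_j)_{j=1}^k:(\zeta_j)_{j=1}^k\in T,\ u_j\in D\}$, with weights $\mathbb P_{\xi,n}((\zeta_j,u_j)_{j=1}^k)=\mathbb P_{\xi,n}((\zeta_j)_{j=1}^k)$. A collection $(x_t)_{t\in\Gamma_{\xi,n}.D}$ in $X$ is *weakly null* if for every (possibly empty) sequence $t$ and every ordinal $\zeta$ with $\{t^\frown(\zeta,u):u\in D\}\subset\Gamma_{\xi,n}.D$ the net $(x_{t^\frown(\zeta,u)})_{u\in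 D}$ is weakly null. For $t\in MAX(\Gamma_{\xi,n}.D)$ put $z^t_i=\sum\{\mathbb P_{\xi,n}(s)x_s: s\le t,\ s\in\Lambda_{\xi,n,i}.D\}$. **The quantity $\alpha_{\xi,p}$.** Let $1\le p\le\infty$ and let $K\subset X^*$ be weak$^*$-compact; let $r_K(x)=\max_{x^*\in K}\operatorname{Re}x^*(x)$ ($=0$ if $K=\varnothing$). Let $\alpha_{\xi,p,n}(K)$ be the infimum of all $\alpha>0$ such that $$\inf_{t\in MAX(\Gamma_{\xi,n}.D)}r_K\Bigl(\sum_{i=1}^na_iz^t_i\Bigr)\le\alpha\|(a_i)_{i=1}^n\|_{\ell_p^n}$$ for all directed sets $D$, all $(a_i)_{i=1}^n\in\mathbb K^n$ and all weakly null $(x_t)_{t\in\Gamma_{\xi,n}.D}\subset B_X$, and let $\alpha_{\xi,p}(K)=\sup_{n\ge1}\alpha_{\xi,p,n}(K)\in[0,\infty]$. For an operator $A:X\to Y$ let $\alpha_{\xi,p}(A)=\alpha_{\xi,p}(A^*B_{Y^*})$. **Summable Szlenk index.** For $K\subset X^*$ weak$^*$-compact and $\varepsilon>0$ let $s_\varepsilon(K)$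 be the set of all $x^*\in K$ such that $\operatorname{diam}(V\cap K)>\varepsilon$ (norm diameter) for every weak$^*$-neighborhood $V$ of $x^*$. Let $s^0_\varepsilon(K)=K$, $s^{\zeta+1}_\varepsilon(K)=s_\varepsilon(s^\zeta_\varepsilon(K))$, $s^\zeta_\varepsilon(K)=\bigcap_{\eta<\zeta}s^\eta_\varepsilon(K)$ for $\zeta$ a limit ordinal, and $s^\zeta_0(K)=K$. For $1\le q<\infty$, $K$ has *$\xi$-$q$-summable Szlenk index* if there is $M\ge0$ such that $\sum_{i=1}^n\varepsilon_i^q\le M^q$ whenever $\varepsilon_1,\dots,\varepsilon_n\ge0$ and $s^{\omega^\xi}_{\varepsilon_1}\cdots s^{\omega^\xi}_{\varepsilon_n}(K)\neq\varnothing$. An operator $A:X\to Y$ has $\xi$-$q$-summable Szlenk index if $A^*B_{Y^*}$ does. **Banach ideals.** A class $\mathfrak I$ of operators between Banach spaces, with $\mathfrak I(X,Y)$ the set of its members from $X$ to $Y$, is an *ideal* if $ABC\in\mathfrak I$ whenever $B\in\mathfrak I$ and $A,C$ are operators for which $ABC$ is defined, $I_{\mathbb K}\in\mathfrak I$, and each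 $\mathfrak I(X,Y)$ is a vector subspace of the space of all operators from $X$ to $Y$. A map $\iota:\mathfrak I\to[0,\infty)$ is an *ideal norm* if it is a norm on each $\mathfrak I(X,Y)$, $\iota(ABC)\le\|A\|\,\iota(B)\,\|C\|$ for all $B\in\mathfrak I$ and all such operators $A,C$, and $\iota(x^*\otimes y)=\|x^*\|\|y\|$ for all $x^*\in X^*$, $y\in Y$, where $(x^*\otimes y)(x)=x^*(x)y$. Then $(\mathfrak I,\iota)$ is a *Banach ideal* if each $(\mathfrak I(X,Y),\iota)$ is complete. **Theorem.** Let $\xi$ be an ordinal, $1<p\le\infty$ and $1/p+1/q=1$. Let $\mathfrak A_{\xi,p}$ be the class of all operators between Banach spaces with $\xi$-$q$-summable Szlenk index, and $\mathfrak a_{\xi,p}(A)=\|A\|+\alpha_{\xi,p}(A)$. Then $(\mathfrak A_{\xi,p},\mathfrak a_{\xi,p})$ is a Banach ideal. (In particular $\alpha_{\xi,p}(A)<\infty$ for $A\in\mathfrak A_{\xi,p}$.) -/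

import Mathlib

open Filter Topology
open scoped ENNReal Ordinal

universe u v

noncomputable section

namespace Szlenk

/-! ### Trees of ordinals -/

/-- The nodes of `T` without proper extension in `T`, for the initial segment order. -/
def maxNodes {α : Type*} (T : Set (List α)) : Set (List α) :=
  {t | t ∈ T ∧ ∀ s ∈ T, t <+: s → s = t}

/-- `a + (ζ₁, …, ζₖ) = (a + ζ₁, …, a + ζₖ)`. -/
def shift (a : Ordinal.{u}) (t : List Ordinal.{u}) : List Ordinal.{u} :=
  t.map (a + ·)

/-- For `b = ω ^ ξ` and `G = Γ_{ξ,1}`, `level b G n i` is the level `Λ_{ξ,n,i+1}` (levels are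
counted from `0` here). It consists of the sequences
`(b (n - 1) + t₁) ⌢ ⋯ ⌢ (b (n - i - 1) + tᵢ₊₁)` with `t₁, …, tᵢ` maximal in `G` and `tᵢ₊₁` in `G`;
it is empty unless `i < n`. -/
def level (b : Ordinal.{u}) (G : Set (List Ordinal.{u})) : ℕ → ℕ → Set (List Ordinal.{u})
  | 0, _ => ∅
  | n + 1, 0 => shift (b * n) '' G
  | n + 1, i + 1 => {t | ∃ s ∈ maxNodes G, ∃ r ∈ level b G n i, t = shift (b * n) s ++ r}

/-- The tree `Γ_{ξ,1}`: it is `{(0)}` for `ξ = 0`, the union of all `Γ_{η,n}` for `ξ = η + 1`, and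
the union of all `ω ^ ζ + Γ_{ζ+1,1}` with `ζ < ξ` for a limit ordinal `ξ`. -/
def Gamma₁ (ξ : Ordinal.{u}) : Set (List Ordinal.{u}) :=
  Ordinal.limitRecOn (motive := fun _ => Set (List Ordinal.{u})) ξ {[0]}
    (fun η G => {t | ∃ n i : ℕ, t ∈ level (ω ^ η) G n i})
    (fun _ hξ G => {t | ∃ ζ, ∃ h : ζ < _, t ∈ shift (ω ^ ζ) '' G (ζ + 1) (hξ.add_one_lt h)})

/-- The level `Λ_{ξ,n,i+1}` of `Γ_{ξ,n}`. -/
def Lambda (ξ : Ordinal.{u}) (n i : ℕ) : Set (List Ordinal.{u}) :=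
  level (ω ^ ξ) (Gamma₁ ξ) n i

/-- The tree `Γ_{ξ,n}`, the union of its levels. -/
def Gamma (ξ : Ordinal.{u}) (n : ℕ) : Set (List Ordinal.{u}) :=
  {t | ∃ i, t ∈ Lambda ξ n i}

open Classical in
/-- If `t = (ω ^ ξ (n - 1) + t₁) ⌢ ⋯ ⌢ (ω ^ ξ (n - i) + tᵢ)` with nonempty sequences `tⱼ` of
ordinals below `ω ^ ξ`, then `lastBlock ξ t = tᵢ`: one keeps the entries with the same quotient by
`ω ^ ξ` as the last entry, and replaces them by their remainders. -/
def lastBlock (ξ : Ordinal.{u}) (t : List Ordinal.{u}) : List Ordinal.{u} :=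
  (t.filter (fun a => a / ω ^ ξ = t.getLastD 0 / ω ^ ξ)).map (· % ω ^ ξ)

/-- For `t ∈ Γ_{ξ,n}` this is `n`, as the first entry of `t` is in `[ω ^ ξ (n - 1), ω ^ ξ n)`. -/
def treeIndex (ξ : Ordinal.{u}) (t : List Ordinal.{u}) : ℕ :=
  sInf {n : ℕ | t.headD 0 < ω ^ ξ * n}

/-- The weights `ℙ_{ξ,1}` on `Γ_{ξ,1}`: `ℙ_{0,1}(t) = 1`; `ℙ_{ξ+1,1}(t) = ℙ_{ξ,n}(t) / n` for
`t ∈ Γ_{ξ,n}`, where `ℙ_{ξ,n}(t) = ℙ_{ξ,1}(lastBlock ξ t)`; and, for a limit ordinal `ξ`,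
`ℙ_{ξ,1}(ω ^ ζ + t) = ℙ_{ζ+1,1}(t)` for `ζ < ξ` and `t ∈ Γ_{ζ+1,1}` (here `ζ` is recovered as the
logarithm to the base `ω` of the first entry). -/
def weight₁ (ξ : Ordinal.{u}) : List Ordinal.{u} → ℝ :=
  Ordinal.limitRecOn (motive := fun _ => List Ordinal.{u} → ℝ) ξ (fun _ => 1)
    (fun η P t => P (lastBlock η t) / treeIndex η t)
    (fun lam hξ P t =>
      let ζ := Ordinal.log ω (t.headD 0)
      open Classical in
      if h : ζ < lam then P (ζ + 1) (hξ.add_one_lt h) (t.map (· - ω ^ ζ)) else 0)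

/-- The weights `ℙ_{ξ,n}` on `Γ_{ξ,n}` (the formula is the same for all `n`):
`ℙ_{ξ,n}((ω ^ ξ (n - 1) + t₁) ⌢ ⋯ ⌢ (ω ^ ξ (n - i) + tᵢ)) = ℙ_{ξ,1}(tᵢ)`. -/
def weight (ξ : Ordinal.{u}) (t : List Ordinal.{u}) : ℝ :=
  weight₁ ξ (lastBlock ξ t)

/-! The recursions that characterize the trees and the weights. -/

theorem Gamma₁_zero : Gamma₁ (0 : Ordinal.{u}) = {[0]} := by
  simp [Gamma₁]

theorem Gamma_one (ξ : Ordinal.{u}) : Gamma ξ 1 = Gamma₁ ξ := by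
  ext t
  constructor
  · rintro ⟨_ | i, h⟩
    · simpa [Lambda, level, shift] using h
    · simp [Lambda, level] at h
  · intro h
    exact ⟨0, by simpa [Lambda, level, shift] using h⟩

theorem Gamma₁_add_one (ξ : Ordinal.{u}) : Gamma₁ (ξ + 1) = {t | ∃ n, t ∈ Gamma ξ n} := by
  simp [Gamma₁, Gamma, Lambda]

theorem Gamma₁_limit {ξ : Ordinal.{u}} (hξ : Order.IsSuccLimit ξ) :
    Gamma₁ ξ = {t | ∃ ζ < ξ, t ∈ shift (ω ^ ζ) '' Gamma₁ (ζ + 1)} := by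
  unfold Gamma₁
  rw [Ordinal.limitRecOn_limit _ _ _ _ hξ]
  simp only [exists_prop]

theorem ne_nil_lt_of_level {b : Ordinal.{u}} {G : Set (List Ordinal.{u})}
    (hG : ∀ t ∈ G, t ≠ [] ∧ ∀ a ∈ t, a < b) :
    ∀ n i, ∀ t ∈ level b G n i, t ≠ [] ∧ (∀ a ∈ t, a < b * n) ∧ b * (n - 1 : ℕ) ≤ t.headD 0
  | 0, _, t, h => by simp [level] at h
  | n + 1, 0, t, h => by
      obtain ⟨s, hs, rfl⟩ := h
      obtain ⟨h1, h2⟩ := hG s hs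
      refine ⟨by simpa [shift] using h1, fun a ha => ?_, ?_⟩
      · simp only [shift, List.mem_map] at ha
        obtain ⟨c, hc, rfl⟩ := ha
        push_cast
        rw [mul_add, mul_one]
        exact (add_lt_add_iff_left _).2 (h2 c hc)
      · cases s with
        | nil => exact absurd rfl h1
        | cons c s => simp [shift]
  | n + 1, i + 1, t, h => by
      obtain ⟨s, hs, r, hr, rfl⟩ := h
      obtain ⟨h1, h2⟩ := hG s hs.1
      obtain ⟨h3, h4, -⟩ := ne_nil_lt_of_level hG n i r hr
      refine ⟨by simp [h3], fun a ha => ?_, ?_⟩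
      · have key : b * (n + 1 : ℕ) = b * n + b := by push_cast; rw [mul_add, mul_one]
        rw [key]
        rcases List.mem_append.1 ha with ha | ha
        · simp only [shift, List.mem_map] at ha
          obtain ⟨c, hc, rfl⟩ := ha
          exact (add_lt_add_iff_left _).2 (h2 c hc)
        · exact (h4 a ha).trans_le le_self_add
      · cases s with
        | nil => exact absurd rfl h1
        | cons c s => simp [shift]

theorem ne_nil_lt_of_Gamma₁ (ξ : Ordinal.{u}) :
    ∀ t ∈ Gamma₁ ξ, t ≠ [] ∧ ∀ a ∈ t, a < ω ^ ξ := by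
  induction ξ using Ordinal.limitRecOn with
  | zero => simp [Gamma₁_zero]
  | add_one ξ ih =>
      intro t ht
      rw [Gamma₁_add_one] at ht
      obtain ⟨n, i, h⟩ := ht
      obtain ⟨h1, h2, -⟩ := ne_nil_lt_of_level ih n i t h
      refine ⟨h1, fun a ha => (h2 a ha).trans ?_⟩
      rw [Ordinal.opow_add, Ordinal.opow_one]
      exact (mul_lt_mul_iff_right₀ (Ordinal.opow_pos _ Ordinal.omega0_pos)).2 (Ordinal.natCast_lt_omega0 n)
  | limit ξ hξ ih =>
      intro t ht
      rw [Gamma₁_limit hξ] at ht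
      obtain ⟨ζ, hζ, s, hs, rfl⟩ := ht
      have hζ1 := hξ.add_one_lt hζ
      obtain ⟨h1, h2⟩ := ih _ hζ1 s hs
      refine ⟨by simpa [shift] using h1, fun a ha => ?_⟩
      simp only [shift, List.mem_map] at ha
      obtain ⟨c, hc, rfl⟩ := ha
      have hlt : ω ^ (ζ + 1) < ω ^ ξ := (Ordinal.opow_lt_opow_iff_right Ordinal.one_lt_omega0).2 hζ1
      exact (Ordinal.isPrincipal_add_omega0_opow ξ) ((Ordinal.opow_lt_opow_iff_right Ordinal.one_lt_omega0).2 hζ) ((h2 c hc).trans hlt)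

theorem lastBlock_shift {ξ : Ordinal.{u}} (n : ℕ) {t : List Ordinal.{u}}
    (ht : ∀ a ∈ t, a < ω ^ ξ) : lastBlock ξ (shift (ω ^ ξ * n) t) = t := by
  have hpos : (ω ^ ξ : Ordinal.{u}) ≠ 0 := (Ordinal.opow_pos _ Ordinal.omega0_pos).ne'
  rcases List.eq_nil_or_concat' t with rfl | ⟨l, c, rfl⟩
  · simp [lastBlock, shift]
  have hq : ∀ a ∈ l ++ [c], (ω ^ ξ * n + a) / ω ^ ξ = n := fun a ha => by
    rw [Ordinal.mul_add_div _ hpos, Ordinal.div_eq_zero_of_lt (ht a ha), add_zero]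
  have hm : ∀ a ∈ l ++ [c], (ω ^ ξ * n + a) % ω ^ ξ = a := fun a ha => by
    rw [Ordinal.mul_add_mod_self, Ordinal.mod_eq_of_lt (ht a ha)]
  have hlast : (shift (ω ^ ξ * n) (l ++ [c])).getLastD 0 = ω ^ ξ * n + c := by
    simp [shift]
  unfold lastBlock
  rw [hlast, hq c (by simp), List.filter_eq_self.2]
  · rw [shift, List.map_map]
    conv_rhs => rw [← List.map_id (l ++ [c])]
    exact List.map_congr_left fun a ha => by simp only [Function.comp, id]; exact hm a ha
  · intro a ha
    simp only [shift, List.mem_map] at ha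
    obtain ⟨d, hd, rfl⟩ := ha
    simpa using hq d hd

theorem lastBlock_append {ξ : Ordinal.{u}} (n : ℕ) {s r : List Ordinal.{u}}
    (hr : r ≠ []) (hr' : ∀ a ∈ r, a < ω ^ ξ * n) :
    lastBlock ξ (shift (ω ^ ξ * n) s ++ r) = lastBlock ξ r := by
  have hpos : (ω ^ ξ : Ordinal.{u}) ≠ 0 := (Ordinal.opow_pos _ Ordinal.omega0_pos).ne'
  rcases List.eq_nil_or_concat' r with rfl | ⟨l, c, rfl⟩
  · exact absurd rfl hr
  have hc : c / ω ^ ξ < n := (Ordinal.lt_mul_iff_div_lt hpos).1 (hr' c (by simp))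
  have h1 : (shift (ω ^ ξ * n) s ++ (l ++ [c])).getLastD 0 = c := by
    rw [← List.append_assoc]; simp
  unfold lastBlock
  rw [h1, List.filter_append, List.filter_eq_nil_iff.2]
  · simp
  · intro a ha
    simp only [shift, List.mem_map] at ha
    obtain ⟨d, hd, rfl⟩ := ha
    simp only [decide_eq_true_eq]
    rw [Ordinal.mul_add_div _ hpos]
    exact (hc.trans_le le_self_add).ne'

theorem weight_zero (t : List Ordinal.{u}) : weight₁ 0 t = 1 := by simp [weight₁]

theorem weight_level_zero (ξ : Ordinal.{u}) (n : ℕ) {t : List Ordinal.{u}} (ht : t ∈ Gamma₁ ξ) :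
    weight ξ (shift (ω ^ ξ * n) t) = weight₁ ξ t := by
  rw [weight, lastBlock_shift n (ne_nil_lt_of_Gamma₁ ξ t ht).2]

theorem weight_level_succ (ξ : Ordinal.{u}) (n : ℕ) (s : List Ordinal.{u}) {r : List Ordinal.{u}}
    (hr : r ∈ Gamma ξ n) : weight ξ (shift (ω ^ ξ * n) s ++ r) = weight ξ r := by
  obtain ⟨i, hi⟩ := hr
  obtain ⟨h1, h2, -⟩ := ne_nil_lt_of_level (ne_nil_lt_of_Gamma₁ ξ) n i r hi
  rw [weight, lastBlock_append n h1 h2, weight]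

theorem weight_add_one (ξ : Ordinal.{u}) (n : ℕ) {t : List Ordinal.{u}} (ht : t ∈ Gamma ξ n) :
    weight₁ (ξ + 1) t = weight ξ t / n := by
  have hpos : 0 < (ω ^ ξ : Ordinal.{u}) := Ordinal.opow_pos _ Ordinal.omega0_pos
  obtain ⟨i, hi⟩ := ht
  obtain ⟨h1, h2, h3⟩ := ne_nil_lt_of_level (ne_nil_lt_of_Gamma₁ ξ) n i t hi
  have hn : treeIndex ξ t = n := by
    have hmem : t.headD 0 < ω ^ ξ * n := by
      cases t with
      | nil => exact absurd rfl h1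
      | cons c s => exact h2 c (by simp)
    refine le_antisymm (Nat.sInf_le hmem) (le_csInf ⟨n, hmem⟩ fun m hm => ?_)
    have := (mul_lt_mul_iff_right₀ hpos).1 (h3.trans_lt hm)
    have : n - 1 < m := by exact_mod_cast this
    omega
  rw [weight₁, Ordinal.limitRecOn_add_one, hn]
  rfl

theorem weight_limit {ξ ζ : Ordinal.{u}} (hξ : Order.IsSuccLimit ξ) (hζ : ζ < ξ)
    {t : List Ordinal.{u}} (ht : t ∈ Gamma₁ (ζ + 1)) :
    weight₁ ξ (shift (ω ^ ζ) t) = weight₁ (ζ + 1) t := by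
  obtain ⟨h1, h2⟩ := ne_nil_lt_of_Gamma₁ _ t ht
  have hlog : Ordinal.log ω ((shift (ω ^ ζ) t).headD 0) = ζ := by
    cases t with
    | nil => exact absurd rfl h1
    | cons c s =>
      have hc : c < ω ^ (ζ + 1) := h2 c (by simp)
      simp only [shift, List.map_cons, List.headD_cons]
      refine (Ordinal.log_eq_iff Ordinal.one_lt_omega0 ?_ _).2 ⟨le_self_add, ?_⟩
      · exact (lt_of_lt_of_le (Ordinal.opow_pos _ Ordinal.omega0_pos) le_self_add).ne'
      · exact (Ordinal.isPrincipal_add_omega0_opow (ζ+1)) ((Ordinal.opow_lt_opow_iff_right Ordinal.one_lt_omega0).2 (by simp)) hc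
  have hmap : (shift (ω ^ ζ) t).map (· - ω ^ ζ) = t := by
    rw [shift, List.map_map]
    conv_rhs => rw [← List.map_id t]
    exact List.map_congr_left fun a _ => by simp
  rw [weight₁, Ordinal.limitRecOn_limit _ _ _ _ hξ]
  simp only [hlog, hζ, dif_pos, hmap]
  rfl

/-- The tree `T.D` of all `(ζ₁, u₁), …, (ζₖ, uₖ)` with `(ζ₁, …, ζₖ) ∈ T` and `u₁, …, uₖ ∈ D`. -/
def decorate (T : Set (List Ordinal.{u})) (D : Type v) : Set (List (Ordinal.{u} × D)) :=
  {t | t.map Prod.fst ∈ T}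

section Banach

variable (𝕜 : Type) [RCLike 𝕜]

/-- The collection `(x_t)_{t ∈ T}` is weakly null: for every sequence `t` (possibly empty) and every
ordinal `ζ` such that the `t ⌢ (ζ, u)` lie in `T`, the net `(x_{t ⌢ (ζ, u)})_{u ∈ D}` is weakly
null. -/
def WeaklyNull {X : Type v} [NormedAddCommGroup X] [NormedSpace 𝕜 X] {D : Type v} [Preorder D]
    (T : Set (List (Ordinal.{u} × D))) (x : List (Ordinal.{u} × D) → X) : Prop :=
  ∀ (t : List (Ordinal.{u} × D)) (ζ : Ordinal.{u}), (∀ u : D, t ++ [(ζ, u)] ∈ T) →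
    ∀ f : StrongDual 𝕜 X, Tendsto (fun u : D => f (x (t ++ [(ζ, u)]))) atTop (𝓝 0)

open Classical in
/-- `z^t_{i+1}`, the sum of `ℙ_{ξ,n}(s) x_s` over the initial segments `s` of `t` in the level
`Λ_{ξ,n,i+1}.D`. -/
def blockSum {X : Type v} [NormedAddCommGroup X] [NormedSpace 𝕜 X] {D : Type v}
    (ξ : Ordinal.{u}) (n i : ℕ) (x : List (Ordinal.{u} × D) → X)
    (t : List (Ordinal.{u} × D)) : X :=
  ∑ k ∈ (Finset.range (t.length + 1)).filter (fun k => t.take k ∈ decorate (Lambda ξ n i) D),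
    ((weight ξ ((t.take k).map Prod.fst) : ℝ) : 𝕜) • x (t.take k)

variable {𝕜}

/-- `r_K(x)`, the maximum of `Re f(x)` over `f ∈ K` (and `0` if `K` is empty). -/
def support {X : Type v} [NormedAddCommGroup X] [NormedSpace 𝕜 X] (K : Set (StrongDual 𝕜 X))
    (x : X) : ℝ :=
  sSup ((fun f : StrongDual 𝕜 X => RCLike.re (f x)) '' K)

/-- `α` satisfies the upper estimate that defines `α_{ξ,p,n}(K)`. -/
def UpperEstimate {X : Type v} [NormedAddCommGroup X] [NormedSpace 𝕜 X]
    (ξ : Ordinal.{u}) (p : ℝ≥0∞) (n : ℕ) (K : Set (StrongDual 𝕜 X)) (α : ℝ) : Prop :=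
  ∀ (D : Type v) [Preorder D] [IsDirectedOrder D] [Nonempty D]
    (a : Fin n → 𝕜) (x : List (Ordinal.{u} × D) → X),
    (∀ t ∈ decorate (Gamma ξ n) D, ‖x t‖ ≤ 1) →
    WeaklyNull 𝕜 (decorate (Gamma ξ n) D) x →
    ⨅ t : maxNodes (decorate (Gamma ξ n) D),
        support K (∑ i : Fin n, a i • blockSum 𝕜 ξ n i x t)
      ≤ α * ‖(WithLp.toLp p a : PiLp p fun _ : Fin n => 𝕜)‖

/-- The quantity `α_{ξ,p,n}(K)`. -/
def alphaN {X : Type v} [NormedAddCommGroup X] [NormedSpace 𝕜 X]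
    (ξ : Ordinal.{u}) (p : ℝ≥0∞) (n : ℕ) (K : Set (StrongDual 𝕜 X)) : ℝ≥0∞ :=
  ⨅ (α : ℝ) (_ : 0 < α ∧ UpperEstimate ξ p n K α), ENNReal.ofReal α

/-- The quantity `α_{ξ,p}(K) = sup_{n ≥ 1} α_{ξ,p,n}(K)`. -/
def alpha {X : Type v} [NormedAddCommGroup X] [NormedSpace 𝕜 X]
    (ξ : Ordinal.{u}) (p : ℝ≥0∞) (K : Set (StrongDual 𝕜 X)) : ℝ≥0∞ :=
  ⨆ (n : ℕ) (_ : 1 ≤ n), alphaN ξ p n K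

/-! ### Szlenk derivations -/

/-- `s_ε(K)`: for `ε > 0`, the `f ∈ K` such that `V ∩ K` has norm diameter `> ε` for every
weak-star neighbourhood `V` of `f`; and `K` itself for `ε ≤ 0`. -/
def derive {X : Type v} [NormedAddCommGroup X] [NormedSpace 𝕜 X] (ε : ℝ)
    (K : Set (StrongDual 𝕜 X)) : Set (StrongDual 𝕜 X) :=
  {f | f ∈ K ∧ (0 < ε → ∀ V ∈ 𝓝 (StrongDual.toWeakDual f),
    ENNReal.ofReal ε < Metric.ediam (StrongDual.toWeakDual ⁻¹' V ∩ K))}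

/-- The transfinite iterate `s_ε^ξ(K)`. -/
def deriveIter {X : Type v} [NormedAddCommGroup X] [NormedSpace 𝕜 X] (ε : ℝ) (ξ : Ordinal.{u})
    (K : Set (StrongDual 𝕜 X)) : Set (StrongDual 𝕜 X) :=
  Ordinal.limitRecOn (motive := fun _ => Set (StrongDual 𝕜 X)) ξ K
    (fun _ L => derive ε L)
    (fun _ _ L => {f | ∀ ζ, ∀ h : ζ < _, f ∈ L ζ h})

/-- `K` has `ξ`-`q`-summable Szlenk index: there is `M ≥ 0` with `∑ εᵢ ^ q ≤ M ^ q` whenever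
`ε₁, …, εₙ ≥ 0` and `s_{ε₁}^{ω ^ ξ} ⋯ s_{εₙ}^{ω ^ ξ}(K)` is nonempty. -/
def HasSummableSzlenkIndex {X : Type v} [NormedAddCommGroup X] [NormedSpace 𝕜 X]
    (ξ : Ordinal.{u}) (q : ℝ) (K : Set (StrongDual 𝕜 X)) : Prop :=
  ∃ M : ℝ, 0 ≤ M ∧ ∀ l : List ℝ, (∀ ε ∈ l, 0 ≤ ε) →
    (l.foldr (fun ε L => deriveIter ε (ω ^ ξ) L) K).Nonempty →
    (l.map (fun ε => ε ^ q)).sum ≤ M ^ q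

/-! ### Operators and ideals -/

/-- `A^* B_{Y^*}`, the image of the closed dual unit ball under the adjoint of `A`. -/
def adjointBall {X Y : Type v} [NormedAddCommGroup X] [NormedSpace 𝕜 X]
    [NormedAddCommGroup Y] [NormedSpace 𝕜 Y] (A : X →L[𝕜] Y) : Set (StrongDual 𝕜 X) :=
  (fun g : StrongDual 𝕜 Y => g.comp A) '' Metric.closedBall 0 1

variable (𝕜)

/-- A class of operators between Banach spaces over `𝕜`. -/
abbrev OperatorClass : Type (v + 1) :=
  ∀ (X Y : Type v) [NormedAddCommGroup X] [NormedSpace 𝕜 X] [CompleteSpace X]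
    [NormedAddCommGroup Y] [NormedSpace 𝕜 Y] [CompleteSpace Y], Set (X →L[𝕜] Y)

/-- An assignment of extended nonnegative numbers to the operators between Banach spaces. -/
abbrev OperatorGauge : Type (v + 1) :=
  ∀ (X Y : Type v) [NormedAddCommGroup X] [NormedSpace 𝕜 X] [CompleteSpace X]
    [NormedAddCommGroup Y] [NormedSpace 𝕜 Y] [CompleteSpace Y], (X →L[𝕜] Y) → ℝ≥0∞

/-- Operator ideals. -/
structure IsOperatorIdeal (I : OperatorClass.{v} 𝕜) : Prop where
  comp_mem : ∀ (W X Y Z : Type v)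
    [NormedAddCommGroup W] [NormedSpace 𝕜 W] [CompleteSpace W]
    [NormedAddCommGroup X] [NormedSpace 𝕜 X] [CompleteSpace X]
    [NormedAddCommGroup Y] [NormedSpace 𝕜 Y] [CompleteSpace Y]
    [NormedAddCommGroup Z] [NormedSpace 𝕜 Z] [CompleteSpace Z]
    (C : W →L[𝕜] X) (B : X →L[𝕜] Y) (A : Y →L[𝕜] Z), B ∈ I X Y → A.comp (B.comp C) ∈ I W Z
  /-- The identity of the scalar field (lifted to the universe at hand) is in the ideal. -/
  id_mem : ContinuousLinearMap.id 𝕜 (ULift.{v} 𝕜) ∈ I (ULift.{v} 𝕜) (ULift.{v} 𝕜)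
  isSubspace : ∀ (X Y : Type v)
    [NormedAddCommGroup X] [NormedSpace 𝕜 X] [CompleteSpace X]
    [NormedAddCommGroup Y] [NormedSpace 𝕜 Y] [CompleteSpace Y],
    ∃ S : Submodule 𝕜 (X →L[𝕜] Y), (S : Set (X →L[𝕜] Y)) = I X Y

/-- `ι` is an ideal norm on `I`: it is finite on `I`, a norm on each `I(X, Y)`, compatible with
composition, and `ι(f ⊗ y) = ‖f‖ ‖y‖` for the rank one operators `f ⊗ y = f(·) y`. -/
structure IsIdealNorm (I : OperatorClass.{v} 𝕜) (ι : OperatorGauge.{v} 𝕜) : Prop where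
  lt_top : ∀ (X Y : Type v)
    [NormedAddCommGroup X] [NormedSpace 𝕜 X] [CompleteSpace X]
    [NormedAddCommGroup Y] [NormedSpace 𝕜 Y] [CompleteSpace Y],
    ∀ A ∈ I X Y, ι X Y A < ∞
  eq_zero_iff : ∀ (X Y : Type v)
    [NormedAddCommGroup X] [NormedSpace 𝕜 X] [CompleteSpace X]
    [NormedAddCommGroup Y] [NormedSpace 𝕜 Y] [CompleteSpace Y],
    ∀ A ∈ I X Y, ι X Y A = 0 ↔ A = 0
  smul : ∀ (X Y : Type v)
    [NormedAddCommGroup X] [NormedSpace 𝕜 X] [CompleteSpace X]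
    [NormedAddCommGroup Y] [NormedSpace 𝕜 Y] [CompleteSpace Y],
    ∀ (c : 𝕜), ∀ A ∈ I X Y, ι X Y (c • A) = ‖c‖ₑ * ι X Y A
  add_le : ∀ (X Y : Type v)
    [NormedAddCommGroup X] [NormedSpace 𝕜 X] [CompleteSpace X]
    [NormedAddCommGroup Y] [NormedSpace 𝕜 Y] [CompleteSpace Y],
    ∀ A ∈ I X Y, ∀ B ∈ I X Y, ι X Y (A + B) ≤ ι X Y A + ι X Y B
  comp_le : ∀ (W X Y Z : Type v)
    [NormedAddCommGroup W] [NormedSpace 𝕜 W] [CompleteSpace W]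
    [NormedAddCommGroup X] [NormedSpace 𝕜 X] [CompleteSpace X]
    [NormedAddCommGroup Y] [NormedSpace 𝕜 Y] [CompleteSpace Y]
    [NormedAddCommGroup Z] [NormedSpace 𝕜 Z] [CompleteSpace Z]
    (C : W →L[𝕜] X) (B : X →L[𝕜] Y) (A : Y →L[𝕜] Z), B ∈ I X Y →
    ι W Z (A.comp (B.comp C)) ≤ ‖A‖ₑ * ι X Y B * ‖C‖ₑ
  rank_one : ∀ (X Y : Type v)
    [NormedAddCommGroup X] [NormedSpace 𝕜 X] [CompleteSpace X]
    [NormedAddCommGroup Y] [NormedSpace 𝕜 Y] [CompleteSpace Y]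
    (f : StrongDual 𝕜 X) (y : Y),
    ι X Y (ContinuousLinearMap.smulRight f y) = ‖f‖ₑ * ‖y‖ₑ

/-- `(I, ι)` is a Banach operator ideal: `I` is an ideal, `ι` is an ideal norm on it, and each
`(I(X, Y), ι)` is complete (every `ι`-Cauchy sequence in it `ι`-converges in it). -/
structure IsBanachIdeal (I : OperatorClass.{v} 𝕜) (ι : OperatorGauge.{v} 𝕜) : Prop where
  isOperatorIdeal : IsOperatorIdeal 𝕜 I
  isIdealNorm : IsIdealNorm 𝕜 I ι
  complete : ∀ (X Y : Type v)
    [NormedAddCommGroup X] [NormedSpace 𝕜 X] [CompleteSpace X]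
    [NormedAddCommGroup Y] [NormedSpace 𝕜 Y] [CompleteSpace Y] (A : ℕ → X →L[𝕜] Y),
    (∀ k, A k ∈ I X Y) →
    (∀ ε : ℝ≥0∞, 0 < ε → ∃ N, ∀ k ≥ N, ∀ l ≥ N, ι X Y (A k - A l) < ε) →
    ∃ B ∈ I X Y, Tendsto (fun k => ι X Y (A k - B)) atTop (𝓝 0)

/-- The class of operators `A` with `ξ`-`q`-summable Szlenk index, that is, such that
`A^* B_{Y^*}` has `ξ`-`q`-summable Szlenk index. -/
def summableSzlenkClass (ξ : Ordinal.{u}) (q : ℝ) : OperatorClass.{v} 𝕜 :=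
  fun _ _ _ _ _ _ _ _ => {A | HasSummableSzlenkIndex ξ q (adjointBall A)}

/-- `𝔞_{ξ,p}(A) = ‖A‖ + α_{ξ,p}(A)`, where `α_{ξ,p}(A) = α_{ξ,p}(A^* B_{Y^*})`. -/
def szlenkNorm (ξ : Ordinal.{u}) (p : ℝ≥0∞) : OperatorGauge.{v} 𝕜 :=
  fun _ _ _ _ _ _ _ _ A => ‖A‖ₑ + alpha ξ p (adjointBall A)

end Banach

end Szlenk

end

/-! Defined as an infimum over branches of trees, `α_{ξ,p}(A)` shows neither a triangle inequality
nor a link to Szlenk derivations. The proof replaces trees by filters. From the weak neighbourhoods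
of `0` in the unit ball (`nullFilter`) one builds `blockFilter ξ`, by averaging at successors and by
directed infima at limits; `iter F n` is the iterated product, where `z₁` is generic, then `z₂` is
generic given `z₁`, and so on.

The bridge is `eventually_iter_blockFilter_iff`: a property holds for the block sums on some branch
of every weakly null collection over `Γ_{ξ,n}` iff it holds eventually along `iter (blockFilter ξ)
n`. Both sides say that the first player wins a game (`Large`) of choosing ordinals and weak
neighbourhoods against vectors. The trees and the filters satisfy the same recursion, and a second
player who cannot be beaten produces a weakly null collection that violates the property on all
branches.

Since `r_K(x) = ‖A x‖` for `K = A^* B_{Y^*}`, the inequality `α_{ξ,p}(A) ≤ c` becomes an eventual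
bound on `‖A (∑ aᵢ wᵢ)‖` (`alpha_adjointBall_le_iff`). Two eventual statements hold simultaneously,
which gives subadditivity; filters are transported by contractions, which gives the ideal
inequality; rank one operators have `α = 0` because blocks are weakly null.

Finiteness of `α` is equivalent to the summable Szlenk index (`hasSummableSzlenkIndex_iff`). A point
of an iterated derivation yields, frequently along the filter, one functional of `K` exceeding `εᵢ /
5` on the `i`-th block; converse Hölder then bounds the `ℓ_q` norm of `ε`. Conversely, if the upper
estimate fails, norming functionals are frequently large on blocks, weak-star compactness turns this
into a nonempty iterated derivation, and Hölder gives a contradiction. Completeness follows from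
lower semicontinuity of `α` in the operator norm (`alpha_le_of_forall_near`). -/

noncomputable section

namespace Szlenk

open scoped NNReal

/-! ### Iterated filters -/

section Iterate

variable {X : Type v}

/-- The filter of the sets that contain `(z₁, …, zₙ)` for almost all `z₁`, almost all `z₂`
(depending on `z₁`), and so on. -/
def iter (F : Filter X) : (n : ℕ) → Filter (Fin n → X)
  | 0 => pure Fin.elim0
  | n + 1 => F.bind fun z => (iter F n).map (Fin.cons (α := fun _ => X) z)

theorem eventually_iter_zero {F : Filter X} {p : (Fin 0 → X) → Prop} :
    (∀ᶠ w in iter F 0, p w) ↔ p Fin.elim0 := by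
  simp [iter]

theorem eventually_iter_succ {F : Filter X} {n : ℕ} {p : (Fin (n + 1) → X) → Prop} :
    (∀ᶠ w in iter F (n + 1), p w) ↔
      ∀ᶠ z in F, ∀ᶠ w in iter F n, p (Fin.cons (α := fun _ => X) z w) := by
  simp [iter, eventually_bind]

theorem frequently_iter_zero {F : Filter X} {p : (Fin 0 → X) → Prop} :
    (∃ᶠ w in iter F 0, p w) ↔ p Fin.elim0 := by
  simp only [Filter.Frequently, eventually_iter_zero, not_not]

theorem frequently_iter_succ {F : Filter X} {n : ℕ} {p : (Fin (n + 1) → X) → Prop} :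
    (∃ᶠ w in iter F (n + 1), p w) ↔
      ∃ᶠ z in F, ∃ᶠ w in iter F n, p (Fin.cons (α := fun _ => X) z w) := by
  simp only [Filter.Frequently, eventually_iter_succ, not_not]

theorem eventually_iter_forall {F : Filter X} {p : X → Prop} (h : ∀ᶠ z in F, p z) :
    ∀ n, ∀ᶠ w in iter F n, ∀ i, p (w i)
  | 0 => eventually_iter_zero.2 fun i => i.elim0
  | n + 1 => eventually_iter_succ.2 <| h.mono fun z hz =>
      (eventually_iter_forall h n).mono fun w hw => Fin.cases (by simpa using hz) (by simpa using hw)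

theorem tendsto_iter {Y : Type v} {F : Filter X} {G : Filter Y} {T : X → Y} (h : Tendsto T F G) :
    ∀ n, Tendsto (fun w : Fin n → X => fun i => T (w i)) (iter F n) (iter G n)
  | 0 => by
      intro S hS
      have := (eventually_iter_zero (p := (· ∈ S))).1 hS
      refine (eventually_iter_zero (F := F) (p := fun w => (fun i => T (w i)) ∈ S)).2 ?_
      convert this using 1
  | n + 1 => by
      intro S hS
      have := (eventually_iter_succ (p := (· ∈ S))).1 hS
      refine (eventually_iter_succ (F := F) (p := fun w => (fun i => T (w i)) ∈ S)).2
        ((h.eventually this).mono fun z hz => ?_)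
      refine ((tendsto_iter h n).eventually hz).mono fun w hw => ?_
      convert hw using 1
      funext i
      refine Fin.cases ?_ (fun i => ?_) i <;> simp

/-- Pigeonhole principle for filters. It freezes discrete data, such as a set of large coordinates
or a vector of rounded values, that a priori depend on the point. -/
theorem frequently_exists_of_finite {α ι : Type*} [Finite ι] {F : Filter α} {p : ι → α → Prop}
    (h : ∃ᶠ x in F, ∃ i, p i x) : ∃ i, ∃ᶠ x in F, p i x := by
  by_contra H
  simp only [not_exists, Filter.not_frequently] at H
  exact h ((eventually_all.2 H).mono fun x hx ⟨i, hi⟩ => hx i hi)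

end Iterate

/-! ### Filters of iterated sums. -/

section Sum

variable {X : Type v} [AddCommGroup X]

/-- The filter of the sets that contain `z₁ + z₂` for almost all `z₁` in `F` and almost all `z₂`
in `G`. -/
def conv (F G : Filter X) : Filter X :=
  F.bind fun z => G.map (z + ·)

theorem eventually_conv {F G : Filter X} {p : X → Prop} :
    (∀ᶠ z in conv F G, p z) ↔ ∀ᶠ x in F, ∀ᶠ y in G, p (x + y) := by
  simp [conv, eventually_bind]

theorem conv_assoc (F G H : Filter X) : conv (conv F G) H = conv F (conv G H) := by
  ext S
  change (∀ᶠ z in _, z ∈ S) ↔ (∀ᶠ z in _, z ∈ S)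
  simp only [eventually_conv, add_assoc]

theorem conv_mono {F F' G G' : Filter X} (h : F ≤ F') (h' : G ≤ G') : conv F G ≤ conv F' G' := by
  intro S hS
  exact eventually_conv.2 (((eventually_conv.1 hS).filter_mono h).mono fun x hx => hx.filter_mono h')

theorem map_conv {Y : Type v} [AddCommGroup Y] (T : X →+ Y) (F G : Filter X) :
    (conv F G).map T = conv (F.map T) (G.map T) := by
  ext S
  change (∀ᶠ z in _, z ∈ S) ↔ (∀ᶠ z in _, z ∈ S)
  simp only [eventually_conv, eventually_map, map_add]

/-- The filter of the `z₁ + ⋯ + zₙ` with `(z₁, …, zₙ)` along `iter F n`. -/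
def sumFilter (F : Filter X) : ℕ → Filter X
  | 0 => pure 0
  | n + 1 => conv F (sumFilter F n)

theorem eventually_sumFilter {F : Filter X} :
    ∀ {n : ℕ} {p : X → Prop}, (∀ᶠ z in sumFilter F n, p z) ↔ ∀ᶠ w in iter F n, p (∑ i, w i)
  | 0, p => by simp [sumFilter, eventually_iter_zero]
  | n + 1, p => by
      simp only [sumFilter, eventually_conv, eventually_iter_succ, eventually_sumFilter,
        Fin.sum_univ_succ, Fin.cons_zero, Fin.cons_succ]

theorem sumFilter_mono {F G : Filter X} (h : F ≤ G) : ∀ n, sumFilter F n ≤ sumFilter G n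
  | 0 => le_rfl
  | n + 1 => conv_mono h (sumFilter_mono h n)

theorem map_sumFilter {Y : Type v} [AddCommGroup Y] (T : X →+ Y) (F : Filter X) :
    ∀ n, (sumFilter F n).map T = sumFilter (F.map T) n
  | 0 => by simp [sumFilter]
  | n + 1 => by rw [sumFilter, map_conv, map_sumFilter T F n, sumFilter]

theorem sumFilter_add (F : Filter X) (m n : ℕ) :
    sumFilter F (m + n) = conv (sumFilter F m) (sumFilter F n) := by
  induction m with
  | zero =>
      ext S
      change (∀ᶠ z in _, z ∈ S) ↔ (∀ᶠ z in _, z ∈ S)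
      simp [eventually_conv, sumFilter]
  | succ m ih => rw [Nat.succ_add, sumFilter, ih, ← conv_assoc, sumFilter]

theorem sumFilter_sumFilter (F : Filter X) (n : ℕ) :
    ∀ k, sumFilter (sumFilter F n) k = sumFilter F (n * k)
  | 0 => rfl
  | k + 1 => by
      rw [sumFilter, sumFilter_sumFilter F n k, Nat.mul_succ, Nat.add_comm, sumFilter_add]

end Sum

/-! ### Averages, weak neighbourhoods of `0` and block filters. -/

section Average

variable (𝕜 : Type) [RCLike 𝕜] {X Y : Type v} [NormedAddCommGroup X] [NormedSpace 𝕜 X]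
  [NormedAddCommGroup Y] [NormedSpace 𝕜 Y]

/-- The filter of the averages `(z₁ + ⋯ + zₙ) / n` with `(z₁, …, zₙ)` along `iter F n`. -/
def avgFilter (F : Filter X) (n : ℕ) : Filter X :=
  (sumFilter F n).map fun z => (n : 𝕜)⁻¹ • z

theorem eventually_avgFilter {F : Filter X} {n : ℕ} {p : X → Prop} :
    (∀ᶠ z in avgFilter 𝕜 F n, p z) ↔ ∀ᶠ w in iter F n, p ((n : 𝕜)⁻¹ • ∑ i, w i) := by
  rw [avgFilter, eventually_map, eventually_sumFilter]

theorem frequently_avgFilter {F : Filter X} {n : ℕ} {p : X → Prop} :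
    (∃ᶠ z in avgFilter 𝕜 F n, p z) ↔ ∃ᶠ w in iter F n, p ((n : 𝕜)⁻¹ • ∑ i, w i) := by
  simp only [Filter.Frequently, eventually_avgFilter]

theorem avgFilter_mono {F G : Filter X} (h : F ≤ G) (n : ℕ) : avgFilter 𝕜 F n ≤ avgFilter 𝕜 G n :=
  map_mono (sumFilter_mono h n)

theorem avgFilter_one (F : Filter X) : avgFilter 𝕜 F 1 = F := by
  ext S
  change (∀ᶠ z in _, z ∈ S) ↔ (∀ᶠ z in _, z ∈ S)
  simp [avgFilter, sumFilter, eventually_conv]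

/-- Grouping `n * k` successive terms into `k` groups of `n` turns an average of averages into one
long average. Directedness of the successor filters rests on this. -/
theorem avgFilter_avgFilter (F : Filter X) (n k : ℕ) :
    avgFilter 𝕜 (avgFilter 𝕜 F n) k = avgFilter 𝕜 F (n * k) := by
  have := map_sumFilter (DistribSMul.toAddMonoidHom X (n : 𝕜)⁻¹) (sumFilter F n) k
  simp only [sumFilter_sumFilter] at this
  unfold avgFilter
  change map _ (sumFilter (map (DistribSMul.toAddMonoidHom X (n : 𝕜)⁻¹) (sumFilter F n)) k) = _
  rw [← this, map_map]
  congr 1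
  funext z
  simp [smul_smul]

theorem map_avgFilter (T : X →L[𝕜] Y) (F : Filter X) (n : ℕ) :
    (avgFilter 𝕜 F n).map T = avgFilter 𝕜 (F.map T) n := by
  unfold avgFilter
  have := map_sumFilter (T : X →+ Y) F n
  change map T (sumFilter F n) = sumFilter (map T F) n at this
  rw [← this, map_map, map_map]
  congr 1
  funext z
  simp

variable (X)

/-- The filter of the weak neighbourhoods of `0` in the closed unit ball. -/
def nullFilter : Filter X :=
  (⨅ f : StrongDual 𝕜 X, comap f (𝓝 0)) ⊓ 𝓟 (Metric.closedBall 0 1)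

variable {X}

theorem tendsto_nullFilter {α : Type*} {l : Filter α} {x : α → X} :
    Tendsto x l (nullFilter 𝕜 X) ↔
      (∀ f : StrongDual 𝕜 X, Tendsto (fun u => f (x u)) l (𝓝 0)) ∧ ∀ᶠ u in l, ‖x u‖ ≤ 1 := by
  simp [nullFilter, tendsto_inf, tendsto_iInf, tendsto_comap_iff, Function.comp_def]

theorem eventually_norm_le_nullFilter : ∀ᶠ z in nullFilter 𝕜 X, ‖z‖ ≤ 1 :=
  ((tendsto_nullFilter 𝕜).1 tendsto_id).2

theorem tendsto_apply_nullFilter (f : StrongDual 𝕜 X) : Tendsto f (nullFilter 𝕜 X) (𝓝 0) :=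
  ((tendsto_nullFilter 𝕜).1 tendsto_id).1 f

theorem norm_inv_smul_sum_lt {n : ℕ} (hn : n ≠ 0) {E : Type*} [NormedAddCommGroup E]
    [NormedSpace 𝕜 E] {w : Fin n → E} {r : ℝ} (h : ∀ i, ‖w i‖ < r) : ‖(n : 𝕜)⁻¹ • ∑ i, w i‖ < r := by
  have hn' : (0 : ℝ) < n := by exact_mod_cast Nat.pos_of_ne_zero hn
  rw [norm_smul, norm_inv, RCLike.norm_natCast, inv_mul_lt_iff₀ hn']
  calc ‖∑ i, w i‖ ≤ ∑ i, ‖w i‖ := norm_sum_le _ _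
    _ < ∑ _i : Fin n, r := Finset.sum_lt_sum_of_nonempty
        ⟨⟨0, Nat.pos_of_ne_zero hn⟩, Finset.mem_univ _⟩ fun i _ => h i
    _ = n * r := by simp

theorem norm_inv_smul_sum_le {n : ℕ} (hn : n ≠ 0) {E : Type*} [NormedAddCommGroup E]
    [NormedSpace 𝕜 E] {w : Fin n → E} {r : ℝ} (h : ∀ i, ‖w i‖ ≤ r) : ‖(n : 𝕜)⁻¹ • ∑ i, w i‖ ≤ r :=
  le_of_forall_gt fun _ hs => norm_inv_smul_sum_lt 𝕜 hn fun i => (h i).trans_lt hs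

theorem avgFilter_nullFilter_le {n : ℕ} (hn : n ≠ 0) :
    avgFilter 𝕜 (nullFilter 𝕜 X) n ≤ nullFilter 𝕜 X := by
  rw [← tendsto_id', tendsto_nullFilter]
  refine ⟨fun f => ?_, ?_⟩
  · rw [Metric.tendsto_nhds]
    intro ε hε
    refine (eventually_avgFilter 𝕜).2 ?_
    have h1 : ∀ᶠ z in nullFilter 𝕜 X, ‖f z‖ < ε := by
      simpa using (Metric.tendsto_nhds.1 (tendsto_apply_nullFilter 𝕜 f)) ε hε
    refine (eventually_iter_forall h1 n).mono fun w hw => ?_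
    simpa using norm_inv_smul_sum_lt 𝕜 hn hw
  · refine (eventually_avgFilter 𝕜).2 ?_
    exact (eventually_iter_forall (eventually_norm_le_nullFilter 𝕜) n).mono fun w hw =>
      norm_inv_smul_sum_le 𝕜 hn hw

variable (X)

/-- The filter that describes the convex blocks of weakly null trees of order `ω ^ ξ`: for `ξ = 0` it
is `nullFilter`, at `ξ + 1` it is generated by the averages along the filter for `ξ`, and at limit
ordinals it is the infimum of the previous filters. -/
def blockFilter (ξ : Ordinal.{u}) : Filter X :=
  Ordinal.limitRecOn (motive := fun _ => Filter X) ξ (nullFilter 𝕜 X)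
    (fun _ F => ⨅ n : ℕ, avgFilter 𝕜 F (n + 1))
    (fun ξ _ G => ⨅ ζ : Set.Iio ξ, G ζ ζ.2)

theorem blockFilter_zero : blockFilter 𝕜 X (0 : Ordinal.{u}) = nullFilter 𝕜 X := by
  simp [blockFilter]

theorem blockFilter_add_one (ξ : Ordinal.{u}) :
    blockFilter 𝕜 X (ξ + 1) = ⨅ n : ℕ, avgFilter 𝕜 (blockFilter 𝕜 X ξ) (n + 1) := by
  simp [blockFilter]

theorem blockFilter_limit {ξ : Ordinal.{u}} (hξ : Order.IsSuccLimit ξ) :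
    blockFilter 𝕜 X ξ = ⨅ ζ : Set.Iio ξ, blockFilter 𝕜 X ζ.1 := by
  unfold blockFilter
  rw [Ordinal.limitRecOn_limit _ _ _ _ hξ]

theorem blockFilter_anti : Antitone (blockFilter.{u} 𝕜 X) := by
  intro η ξ
  induction ξ using Ordinal.limitRecOn with
  | zero => intro h; rw [nonpos_iff_eq_zero.1 h]
  | add_one ξ ih =>
      intro h
      rcases h.eq_or_lt with rfl | h
      · exact le_rfl
      · refine le_trans ?_ (ih (Order.lt_add_one_iff.1 h))
        rw [blockFilter_add_one]
        exact (iInf_le _ 0).trans (by rw [zero_add, avgFilter_one])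
  | limit ξ hξ ih =>
      intro h
      rcases h.eq_or_lt with rfl | h
      · exact le_rfl
      · rw [blockFilter_limit 𝕜 X hξ]
        exact iInf_le (fun ζ : Set.Iio ξ => blockFilter 𝕜 X ζ.1) ⟨η, h⟩

/-- Averages of blocks are again blocks. At a successor the two averagings commute, both orders
being one average of length `(n + 1) * k`, and this reduces the claim to the previous ordinal. -/
theorem avgFilter_blockFilter_le (ξ : Ordinal.{u}) {k : ℕ} (hk : k ≠ 0) :
    avgFilter 𝕜 (blockFilter 𝕜 X ξ) k ≤ blockFilter 𝕜 X ξ := by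
  induction ξ using Ordinal.limitRecOn with
  | zero => rw [blockFilter_zero]; exact avgFilter_nullFilter_le 𝕜 hk
  | add_one ξ ih =>
      conv_rhs => rw [blockFilter_add_one]
      refine le_iInf fun n => ?_
      have h1 : blockFilter 𝕜 X (ξ + 1) ≤ avgFilter 𝕜 (blockFilter 𝕜 X ξ) (n + 1) := by
        rw [blockFilter_add_one]; exact iInf_le _ n
      refine (avgFilter_mono 𝕜 h1 k).trans ?_
      rw [avgFilter_avgFilter, mul_comm, ← avgFilter_avgFilter]
      exact avgFilter_mono 𝕜 ih _
  | limit ξ hξ ih =>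
      conv_rhs => rw [blockFilter_limit 𝕜 X hξ]
      exact le_iInf fun ζ =>
        (avgFilter_mono 𝕜 (blockFilter_anti 𝕜 X (le_of_lt ζ.2)) k).trans (ih ζ.1 ζ.2)

variable {X}

/-- The family of averages is directed, so a set in the infimum lies in a single term. That term
corresponds to the first player's choice of one `Γ_{ξ,n}` inside `Γ_{ξ+1,1}`. -/
theorem mem_blockFilter_add_one {ξ : Ordinal.{u}} {S : Set X} :
    S ∈ blockFilter 𝕜 X (ξ + 1) ↔ ∃ n : ℕ, S ∈ avgFilter 𝕜 (blockFilter 𝕜 X ξ) (n + 1) := by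
  rw [blockFilter_add_one]
  -- Indices are one less than lengths; the common refinement is the average of length `(m + 1) * (n
  -- + 1)`.
  refine mem_iInf_of_directed (fun m n => ⟨(m + 1) * (n + 1) - 1, ?_, ?_⟩) S
  all_goals
    have : (m + 1) * (n + 1) - 1 + 1 = (m + 1) * (n + 1) :=
      Nat.sub_add_cancel (Nat.mul_pos m.succ_pos n.succ_pos)
    simp only [this, ge_iff_le]
  · rw [mul_comm, ← avgFilter_avgFilter]
    exact avgFilter_mono 𝕜 (avgFilter_blockFilter_le 𝕜 X ξ n.succ_ne_zero) _
  · rw [← avgFilter_avgFilter]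
    exact avgFilter_mono 𝕜 (avgFilter_blockFilter_le 𝕜 X ξ m.succ_ne_zero) _

theorem mem_blockFilter_limit {ξ : Ordinal.{u}} (hξ : Order.IsSuccLimit ξ) {S : Set X} :
    S ∈ blockFilter 𝕜 X ξ ↔ ∃ ζ < ξ, S ∈ blockFilter 𝕜 X ζ := by
  rw [blockFilter_limit 𝕜 X hξ]
  have : Nonempty (Set.Iio ξ) := ⟨⟨0, hξ.bot_lt⟩⟩
  rw [mem_iInf_of_directed]
  · simp
  · intro a b
    refine ⟨max a b, ?_, ?_⟩
    · exact blockFilter_anti 𝕜 X (le_max_left a.1 b.1)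
    · exact blockFilter_anti 𝕜 X (le_max_right a.1 b.1)

theorem blockFilter_le_nullFilter (ξ : Ordinal.{u}) : blockFilter 𝕜 X ξ ≤ nullFilter 𝕜 X := by
  rw [← blockFilter_zero.{u}]
  exact blockFilter_anti 𝕜 X bot_le

/-- Contractions preserve the unit ball and weak convergence to `0`, and by linearity they commute
with averages. -/
theorem tendsto_blockFilter {T : X →L[𝕜] Y} (hT : ‖T‖ ≤ 1) (ξ : Ordinal.{u}) :
    Tendsto T (blockFilter 𝕜 X ξ) (blockFilter 𝕜 Y ξ) := by
  induction ξ using Ordinal.limitRecOn with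
  | zero =>
      simp only [blockFilter_zero]
      refine (tendsto_nullFilter 𝕜).2 ⟨fun f => tendsto_apply_nullFilter 𝕜 (f.comp T), ?_⟩
      exact (eventually_norm_le_nullFilter 𝕜).mono fun z hz =>
        (T.le_of_opNorm_le hT z).trans (by simpa using hz)
  | add_one ξ ih =>
      simp only [blockFilter_add_one]
      refine tendsto_iInf.2 fun n => tendsto_iInf' n ?_
      rw [Tendsto, map_avgFilter]
      exact avgFilter_mono 𝕜 ih _
  | limit ξ hξ ih =>
      rw [blockFilter_limit 𝕜 X hξ, blockFilter_limit 𝕜 Y hξ]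
      exact tendsto_iInf.2 fun ζ => tendsto_iInf' ζ (ih ζ.1 ζ.2)

end Average

/-! ### Games on trees -/

section Game

variable {α β : Type*} {X : Type v}

/-- The nonempty continuations of the one term sequence `ζ` in `T`. -/
def subtree (T : Set (List α)) (ζ : α) : Set (List α) :=
  {s | s ≠ [] ∧ ζ :: s ∈ T}

/-- Every nonempty initial segment of a member of `T` is in `T`. -/
def PrefixClosed (T : Set (List α)) : Prop :=
  ∀ t ∈ T, ∀ s, s ≠ [] → s <+: t → s ∈ T

/-- The first player chooses a root `ζ` of the tree, the second player a vector `z` in a set of the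
filter chosen by the first player, and the play goes on in the subtree above `ζ`. The first player
can ensure that the record of a play along a maximal branch satisfies `P`. -/
inductive Large (F : Filter X) : Set (List α) → (List (α × X) → Prop) → Prop
  | leaf {T : Set (List α)} {P : List (α × X) → Prop} (ζ : α) (U : Set X) (h : [ζ] ∈ T)
      (hT : subtree T ζ = ∅) (hU : U ∈ F) (hP : ∀ z ∈ U, P [(ζ, z)]) : Large F T P
  | node {T : Set (List α)} {P : List (α × X) → Prop} (ζ : α) (U : Set X) (h : [ζ] ∈ T)
      (hT : (subtree T ζ).Nonempty) (hU : U ∈ F)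
      (hP : ∀ z ∈ U, Large F (subtree T ζ) fun l => P ((ζ, z) :: l)) : Large F T P

theorem mem_maxNodes_subtree {T : Set (List α)} {ζ : α} {s : List α} :
    s ∈ maxNodes (subtree T ζ) ↔ s ≠ [] ∧ ζ :: s ∈ maxNodes T := by
  constructor
  · rintro ⟨⟨h1, h2⟩, h3⟩
    refine ⟨h1, h2, fun t ht hst => ?_⟩
    obtain ⟨r, rfl⟩ := hst
    rw [List.cons_append, h3 (s ++ r) ⟨by simp [h1], ht⟩ (List.prefix_append _ _)]
  · rintro ⟨h1, h2, h3⟩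
    refine ⟨⟨h1, h2⟩, fun t ht hst => ?_⟩
    simpa using h3 _ ht.2 (by simpa using hst)

theorem singleton_mem_maxNodes {T : Set (List α)} {ζ : α} :
    [ζ] ∈ maxNodes T ↔ [ζ] ∈ T ∧ subtree T ζ = ∅ := by
  constructor
  · rintro ⟨h1, h2⟩
    refine ⟨h1, Set.eq_empty_of_forall_notMem fun s hs => ?_⟩
    have := h2 _ hs.2 (by simp)
    simp only [List.cons.injEq, true_and] at this
    exact hs.1 this
  · rintro ⟨h1, h2⟩
    refine ⟨h1, ?_⟩
    rintro s hs ⟨r, rfl⟩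
    by_contra h
    have : r ∈ subtree T ζ := ⟨by rintro rfl; simp at h, by simpa using hs⟩
    simp [h2] at this

theorem Large.mono {F : Filter X} {T : Set (List α)} {P Q : List (α × X) → Prop}
    (h : Large F T P) (hPQ : ∀ l, l.map Prod.fst ∈ maxNodes T → P l → Q l) : Large F T Q := by
  induction h generalizing Q with
  | leaf ζ U h hT hU hP =>
      exact .leaf ζ U h hT hU fun z hz =>
        hPQ _ (by simpa using singleton_mem_maxNodes.2 ⟨h, hT⟩) (hP z hz)
  | node ζ U h hT hU hP ih =>
      exact .node ζ U h hT hU fun z hz => ih z hz fun l hl => hPQ _ (by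
        simpa using (mem_maxNodes_subtree.1 hl).2)

theorem large_congr {F : Filter X} {T : Set (List α)} {P Q : List (α × X) → Prop}
    (hPQ : ∀ l, l.map Prod.fst ∈ maxNodes T → (P l ↔ Q l)) : Large F T P ↔ Large F T Q :=
  ⟨fun h => h.mono fun l hl => (hPQ l hl).1, fun h => h.mono fun l hl => (hPQ l hl).2⟩

theorem not_large_empty {F : Filter X} {P : List (α × X) → Prop} :
    ¬ Large F (∅ : Set (List α)) P := by
  rintro (⟨ζ, U, h, _⟩ | ⟨ζ, U, h, _⟩) <;> exact h

theorem large_singleton {F : Filter X} {ζ : α} {P : List (α × X) → Prop} :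
    Large F {[ζ]} P ↔ ∀ᶠ z in F, P [(ζ, z)] := by
  have hs : ∀ η, subtree {[ζ]} η = ∅ := fun η =>
    Set.eq_empty_of_forall_notMem fun s hs => hs.1 (by
      have := hs.2
      simp only [Set.mem_singleton_iff, List.cons.injEq] at this
      exact this.2)
  constructor
  · rintro (⟨η, U, h, hT, hU, hP⟩ | ⟨η, U, h, hT, hU, hP⟩)
    · obtain rfl : η = ζ := by simpa using h
      exact mem_of_superset hU hP
    · simp [hs] at hT
  · exact fun h => .leaf ζ _ rfl (hs ζ) h fun z hz => hz

/-- The sequences in `T` together with the maximal sequences of `T` continued by those in `G`. -/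
def concat (T G : Set (List α)) : Set (List α) :=
  T ∪ {t | ∃ s ∈ maxNodes T, ∃ r ∈ G, t = s ++ r}

theorem singleton_mem_concat {T G : Set (List α)} (hT : [] ∉ T) (hG : [] ∉ G) {ζ : α} :
    [ζ] ∈ concat T G ↔ [ζ] ∈ T := by
  refine ⟨?_, Or.inl⟩
  rintro (h | ⟨s, hs, r, hr, h⟩)
  · exact h
  · rcases s with _ | ⟨a, s⟩
    · exact absurd hs.1 hT
    · simp only [List.cons_append, List.cons.injEq, List.nil_eq, List.append_eq_nil_iff] at h
      exact absurd (h.2.2 ▸ hr) hG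

theorem subtree_concat_of_empty {T G : Set (List α)} (hT : [] ∉ T) (hG : [] ∉ G) {ζ : α}
    (h : [ζ] ∈ T) (h0 : subtree T ζ = ∅) : subtree (concat T G) ζ = G := by
  have hmax := singleton_mem_maxNodes.2 ⟨h, h0⟩
  ext t
  constructor
  · rintro ⟨h1, h2 | ⟨s, hs, r, hr, h2⟩⟩
    · exact absurd ⟨h1, h2⟩ (Set.eq_empty_iff_forall_notMem.1 h0 t)
    · rcases s with _ | ⟨a, s⟩
      · exact absurd hs.1 hT
      · simp only [List.cons_append, List.cons.injEq] at h2
        obtain ⟨rfl, rfl⟩ := h2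
        have := hmax.2 _ hs.1 (by simp)
        obtain rfl : s = [] := by simpa using this.symm
        exact hr
  · intro ht
    exact ⟨fun h => hG (h ▸ ht), Or.inr ⟨[ζ], hmax, t, ht, rfl⟩⟩

theorem subtree_concat_of_nonempty {T G : Set (List α)} (hT : [] ∉ T) {ζ : α}
    (h0 : (subtree T ζ).Nonempty) :
    subtree (concat T G) ζ = concat (subtree T ζ) G := by
  ext t
  constructor
  · rintro ⟨h1, h2 | ⟨s, hs, r, hr, h2⟩⟩
    · exact Or.inl ⟨h1, h2⟩
    · rcases s with _ | ⟨a, s⟩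
      · exact absurd hs.1 hT
      · simp only [List.cons_append, List.cons.injEq] at h2
        obtain ⟨rfl, rfl⟩ := h2
        refine Or.inr ⟨s, mem_maxNodes_subtree.2 ⟨?_, hs⟩, r, hr, rfl⟩
        rintro rfl
        exact h0.ne_empty (singleton_mem_maxNodes.1 hs).2
  · rintro (⟨h1, h2⟩ | ⟨s, hs, r, hr, rfl⟩)
    · exact ⟨h1, Or.inl h2⟩
    · obtain ⟨h1, h2⟩ := mem_maxNodes_subtree.1 hs
      exact ⟨by simp [h1], Or.inr ⟨ζ :: s, h2, r, hr, rfl⟩⟩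

theorem nil_notMem_subtree {T : Set (List α)} {ζ : α} : [] ∉ subtree T ζ := fun h => h.1 rfl

/-- Above a leaf of `T` the remaining tree is `G`; above any other root it is again a concatenation.
Since `G` is nonempty, a leaf of `T` is an inner node of the concatenation. -/
theorem large_concat {F : Filter X} {T G : Set (List α)} (hT : [] ∉ T) (hG : [] ∉ G)
    (hG' : G.Nonempty) {P : List (α × X) → Prop} :
    Large F (concat T G) P ↔ Large F T fun l => Large F G fun m => P (l ++ m) := by
  constructor
  · intro h
    generalize hS : concat T G = S at h
    induction h generalizing T with
    | leaf ζ U h h0 hU hP =>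
        subst hS
        rw [singleton_mem_concat hT hG] at h
        rcases (subtree T ζ).eq_empty_or_nonempty with h1 | h1
        · rw [subtree_concat_of_empty hT hG h h1] at h0
          exact absurd h0 hG'.ne_empty
        · rw [subtree_concat_of_nonempty hT h1] at h0
          exact absurd h0 (h1.mono Set.subset_union_left).ne_empty
    | node ζ U h h0 hU hP ih =>
        subst hS
        rw [singleton_mem_concat hT hG] at h
        rcases (subtree T ζ).eq_empty_or_nonempty with h1 | h1
        · rw [subtree_concat_of_empty hT hG h h1] at hP
          exact .leaf ζ U h h1 hU hP
        · exact .node ζ U h h1 hU fun z hz =>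
            ih z hz nil_notMem_subtree (subtree_concat_of_nonempty hT h1).symm
  · intro h
    generalize hQ : (fun l => Large F G fun m => P (l ++ m)) = Q at h
    induction h generalizing P with
    | leaf ζ U h h0 hU hP =>
        subst hQ
        refine .node ζ U ((singleton_mem_concat hT hG).2 h) ?_ hU ?_
        · rwa [subtree_concat_of_empty hT hG h h0]
        · rw [subtree_concat_of_empty hT hG h h0]
          exact hP
    | node ζ U h h0 hU hP ih =>
        subst hQ
        refine .node ζ U ((singleton_mem_concat hT hG).2 h) ?_ hU ?_
        · rw [subtree_concat_of_nonempty hT h0]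
          exact h0.mono Set.subset_union_left
        · rw [subtree_concat_of_nonempty hT h0]
          exact fun z hz => ih z hz nil_notMem_subtree rfl

theorem subtree_image {f : α → β} (hf : f.Injective) (T : Set (List α)) (ζ : α) :
    subtree (List.map f '' T) (f ζ) = List.map f '' subtree T ζ := by
  ext t
  constructor
  · rintro ⟨h1, s, hs, h2⟩
    rcases s with _ | ⟨a, s⟩
    · simp at h2
    · simp only [List.map_cons, List.cons.injEq] at h2
      obtain ⟨h2, rfl⟩ := h2
      obtain rfl := hf h2
      exact ⟨s, ⟨by rintro rfl; exact h1 rfl, hs⟩, rfl⟩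
  · rintro ⟨s, hs, rfl⟩
    exact ⟨by simpa using hs.1, ζ :: s, hs.2, rfl⟩

theorem exists_of_singleton_mem_image {f : α → β} {T : Set (List α)} {η : β}
    (h : [η] ∈ List.map f '' T) : ∃ ζ, [ζ] ∈ T ∧ f ζ = η := by
  obtain ⟨s, hs, h⟩ := h
  obtain ⟨ζ, rfl, h⟩ := List.map_eq_singleton_iff.1 h
  exact ⟨ζ, hs, by simpa using h⟩

theorem large_image {F : Filter X} {f : α → β} (hf : f.Injective) {T : Set (List α)}
    {P : List (β × X) → Prop} :
    Large F (List.map f '' T) P ↔ Large F T fun l => P (l.map (Prod.map f id)) := by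
  constructor
  · intro h
    generalize hS : List.map f '' T = S at h
    induction h generalizing T with
    | leaf η U h h0 hU hP =>
        subst hS
        obtain ⟨ζ, hζ, rfl⟩ := exists_of_singleton_mem_image h
        rw [subtree_image hf, Set.image_eq_empty] at h0
        exact .leaf ζ U hζ h0 hU fun z hz => by simpa using hP z hz
    | node η U h h0 hU hP ih =>
        subst hS
        obtain ⟨ζ, hζ, rfl⟩ := exists_of_singleton_mem_image h
        have e := subtree_image hf T ζ
        rw [e, Set.image_nonempty] at h0
        exact .node ζ U hζ h0 hU fun z hz => by simpa using ih z hz e.symm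
  · intro h
    generalize hQ : (fun l : List (α × X) => P (l.map (Prod.map f id))) = Q at h
    induction h generalizing P with
    | leaf ζ U h h0 hU hP =>
        subst hQ
        exact .leaf (f ζ) U ⟨_, h, rfl⟩ (by rw [subtree_image hf, h0, Set.image_empty]) hU
          fun z hz => by simpa using hP z hz
    | node ζ U h h0 hU hP ih =>
        subst hQ
        refine .node (f ζ) U ⟨_, h, rfl⟩ (by rw [subtree_image hf]; exact h0.image _) hU ?_
        rw [subtree_image hf]
        exact fun z hz => ih z hz (by funext l; simp)

/-- The trees share no roots, so the first move selects one index and the play never leaves that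
tree. -/
theorem large_union {F : Filter X} {ι : Type*} {T : ι → Set (List α)}
    (hT : ∀ i j ζ s r, ζ :: s ∈ T i → ζ :: r ∈ T j → i = j) {P : List (α × X) → Prop} :
    Large F {t | ∃ i, t ∈ T i} P ↔ ∃ i, Large F (T i) P := by
  have e : ∀ i ζ, [ζ] ∈ T i → subtree {t | ∃ i, t ∈ T i} ζ = subtree (T i) ζ := by
    intro i ζ h
    ext s
    constructor
    · rintro ⟨h1, j, h2⟩
      obtain rfl := hT i j ζ _ _ h h2
      exact ⟨h1, h2⟩
    · exact fun h => ⟨h.1, i, h.2⟩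
  constructor
  · rintro (⟨ζ, U, ⟨i, h⟩, h0, hU, hP⟩ | ⟨ζ, U, ⟨i, h⟩, h0, hU, hP⟩)
    · exact ⟨i, .leaf ζ U h (by rwa [e i ζ h] at h0) hU hP⟩
    · rw [e i ζ h] at h0 hP
      exact ⟨i, .node ζ U h h0 hU hP⟩
  · rintro ⟨i, ⟨ζ, U, h, h0, hU, hP⟩ | ⟨ζ, U, h, h0, hU, hP⟩⟩
    · exact .leaf ζ U ⟨i, h⟩ (by rwa [e i ζ h]) hU hP
    · rw [← e i ζ h] at h0 hP
      exact .node ζ U ⟨i, h⟩ h0 hU hP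

theorem PrefixClosed.subtree {T : Set (List α)} (hT : PrefixClosed T) (ζ : α) :
    PrefixClosed (subtree T ζ) := fun t ht s hs hst =>
  ⟨hs, hT _ ht.2 _ (by simp) (by simpa using hst)⟩

theorem PrefixClosed.image {T : Set (List α)} (hT : PrefixClosed T) (f : α → β) :
    PrefixClosed (List.map f '' T) := by
  rintro _ ⟨t, ht, rfl⟩ s hs hst
  refine ⟨t.take s.length, hT t ht _ ?_ (List.take_prefix _ _), ?_⟩
  · rintro h
    rw [List.prefix_iff_eq_take] at hst
    rw [← List.map_take, h] at hst
    exact hs hst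
  · rw [List.map_take]
    exact (List.prefix_iff_eq_take.1 hst).symm

theorem prefix_append_cases {s t r : List α} (h : s <+: t ++ r) :
    s <+: t ∨ ∃ r', s = t ++ r' ∧ r' <+: r := by
  rcases List.prefix_or_prefix_of_prefix h (List.prefix_append t r) with h' | ⟨r', rfl⟩
  · exact Or.inl h'
  · exact Or.inr ⟨r', rfl, (List.prefix_append_right_inj t).1 h⟩

theorem PrefixClosed.concat {T G : Set (List α)} (hT : PrefixClosed T) (hG : PrefixClosed G) :
    PrefixClosed (concat T G) := by
  rintro t (ht | ⟨t, ht, r, hr, rfl⟩) s hs hst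
  · exact Or.inl (hT t ht s hs hst)
  · rcases prefix_append_cases hst with h | ⟨r', rfl, h⟩
    · exact Or.inl (hT t ht.1 s hs h)
    · rcases eq_or_ne r' [] with rfl | h'
      · exact Or.inl (by simpa using ht.1)
      · exact Or.inr ⟨t, ht, r', hG r hr r' h' h, rfl⟩

theorem maxNodes_image {f : α → β} (hf : f.Injective) (T : Set (List α)) :
    maxNodes (List.map f '' T) = List.map f '' maxNodes T := by
  ext t
  constructor
  · rintro ⟨⟨s, hs, rfl⟩, h⟩
    refine ⟨s, ⟨hs, fun r hr hsr => ?_⟩, rfl⟩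
    exact (List.map_injective_iff.2 hf) (h _ ⟨r, hr, rfl⟩ (hsr.map f))
  · rintro ⟨s, hs, rfl⟩
    refine ⟨⟨s, hs.1, rfl⟩, ?_⟩
    rintro _ ⟨r, hr, rfl⟩ hsr
    rw [hs.2 r hr ((List.prefix_map_iff_of_injective hf).1 hsr)]

end Game

/-! ### Weakly null trees and games -/

section Record

variable {α β : Type*} {X : Type v}

/-- The list of the pairs `(ζⱼ, x_{t|j})` for a sequence `t = (ζⱼ, uⱼ)ⱼ`. -/
def record {D : Type v} : (List (α × D) → X) → List (α × D) → List (α × X)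
  | _, [] => []
  | x, (ζ, u) :: s => (ζ, x [(ζ, u)]) :: record (fun r => x ((ζ, u) :: r)) s

theorem record_congr {D : Type v} {x y : List (α × D) → X} (h : ∀ s, s ≠ [] → x s = y s)
    (t : List (α × D)) : record x t = record y t := by
  induction t generalizing x y with
  | nil => rfl
  | cons a s ih =>
      obtain ⟨ζ, u⟩ := a
      rw [record, record, h _ (by simp), ih fun r _ => h _ (by simp)]

theorem mem_maxNodes_of_decorate {D : Type v} [Nonempty D] {T : Set (List Ordinal.{u})}
    {t : List (Ordinal.{u} × D)} (h : t ∈ maxNodes (decorate T D)) :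
    t.map Prod.fst ∈ maxNodes T := by
  refine ⟨h.1, ?_⟩
  rintro s hs ⟨r, rfl⟩
  obtain ⟨d⟩ := ‹Nonempty D›
  have h1 : t ++ r.map (fun ζ => (ζ, d)) ∈ decorate T D := by
    simpa [decorate, Function.comp_def] using hs
  have := h.2 _ h1 (List.prefix_append _ _)
  have : r = [] := by simpa using this
  simp [this]

theorem mem_maxNodes_decorate {D : Type v} {T : Set (List Ordinal.{u})}
    {t : List (Ordinal.{u} × D)} (h : t.map Prod.fst ∈ maxNodes T) :
    t ∈ maxNodes (decorate T D) :=
  ⟨h.1, fun s hs hts => (hts.eq_of_length (by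
    simpa using (congrArg List.length (h.2 _ hs (hts.map Prod.fst))).symm)).symm⟩

end Record

/-! ### Winning strategies against weakly null collections. -/

section Strategy

variable (𝕜 : Type) [RCLike 𝕜] {X : Type v} [NormedAddCommGroup X] [NormedSpace 𝕜 X]

/-- The collection itself plays for the second player. Each net of successors enters every set of
`nullFilter`, so some `u` always complies with the winning strategy of the first player. -/
theorem Large.exists_maxNodes {T : Set (List Ordinal.{u})} {P : List (Ordinal.{u} × X) → Prop}
    (h : Large (nullFilter 𝕜 X) T P) {D : Type v} [Preorder D] [IsDirectedOrder D] [Nonempty D]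
    (x : List (Ordinal.{u} × D) → X) (hx : ∀ t ∈ decorate T D, ‖x t‖ ≤ 1)
    (hw : WeaklyNull 𝕜 (decorate T D) x) :
    ∃ t : List (Ordinal.{u} × D), t.map Prod.fst ∈ maxNodes T ∧ P (record x t) := by
  have key : ∀ (T : Set (List Ordinal.{u})) (ζ : Ordinal.{u}) (U : Set X)
      (x : List (Ordinal.{u} × D) → X), (∀ t ∈ decorate T D, ‖x t‖ ≤ 1) →
      WeaklyNull 𝕜 (decorate T D) x → [ζ] ∈ T → U ∈ nullFilter 𝕜 X → ∃ u, x [(ζ, u)] ∈ U := by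
    intro T ζ U x hx hw h hU
    have hD : ∀ u : D, [(ζ, u)] ∈ decorate T D := fun u => h
    have : Tendsto (fun u : D => x [(ζ, u)]) atTop (nullFilter 𝕜 X) :=
      (tendsto_nullFilter 𝕜).2 ⟨fun f => by simpa using hw [] ζ hD f, .of_forall fun u => hx _ (hD u)⟩
    exact (this.eventually hU).exists
  induction h generalizing x with
  | leaf ζ U h h0 hU hP =>
      obtain ⟨u, hu⟩ := key _ ζ U x hx hw h hU
      exact ⟨[(ζ, u)], singleton_mem_maxNodes.2 ⟨h, h0⟩, hP _ hu⟩
  | @node T P ζ U h h0 hU hP ih =>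
      obtain ⟨u, hu⟩ := key _ ζ U x hx hw h hU
      obtain ⟨t, ht, hPt⟩ := ih _ hu (fun r => x ((ζ, u) :: r)) (fun t ht => hx _ ht.2)
        (fun t η ht f => by simpa using hw ((ζ, u) :: t) η (fun v => (ht v).2) f)
      exact ⟨(ζ, u) :: t, (mem_maxNodes_subtree.1 ht).2, hPt⟩

variable (X) in
/-- The sets in `nullFilter 𝕜 X`, directed by reverse inclusion. -/
abbrev NullSets : Type v := ({U : Set X // U ∈ nullFilter 𝕜 X})ᵒᵈ

instance : IsDirectedOrder (NullSets 𝕜 X) :=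
  ⟨fun U V => ⟨OrderDual.toDual ⟨_, inter_mem (OrderDual.ofDual U).2 (OrderDual.ofDual V).2⟩,
    Set.inter_subset_left, Set.inter_subset_right⟩⟩

instance : Nonempty (NullSets 𝕜 X) := ⟨OrderDual.toDual ⟨Set.univ, univ_mem⟩⟩

variable {𝕜}

open Classical in
/-- An answer in `U` to the move `ζ` of the first player after which the first player cannot win
any more, if there is one. -/
def answer {α : Type*} (T : Set (List α)) (P : List (α × X) → Prop) (ζ : α) (U : NullSets 𝕜 X) : X :=
  if h : ∃ z ∈ (OrderDual.ofDual U).1, ‖z‖ ≤ 1 ∧ (subtree T ζ = ∅ → ¬ P [(ζ, z)]) ∧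
    ((subtree T ζ).Nonempty →
      ¬ Large (nullFilter 𝕜 X) (subtree T ζ) fun l => P ((ζ, z) :: l)) then h.choose else 0

/-- The tree of the answers of the second player. -/
def strategy {α : Type*} : Set (List α) → (List (α × X) → Prop) → List (α × NullSets 𝕜 X) → X
  | _, _, [] => 0
  | T, P, [(ζ, U)] => answer T P ζ U
  | T, P, (ζ, U) :: a :: s =>
      strategy (subtree T ζ) (fun l => P ((ζ, answer T P ζ U) :: l)) (a :: s)

theorem norm_answer_le {α : Type*} (T : Set (List α)) (P : List (α × X) → Prop) (ζ : α)
    (U : NullSets 𝕜 X) : ‖answer T P ζ U‖ ≤ 1 := by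
  unfold answer
  split_ifs with h
  · exact h.choose_spec.2.1
  · simp

/-- If every vector of `U` in the unit ball led to a position won by the first player, the move `ζ`
together with `U` cut down to the ball would already win. -/
theorem answer_spec {α : Type*} {T : Set (List α)} {P : List (α × X) → Prop}
    (h : ¬ Large (nullFilter 𝕜 X) T P) {ζ : α} (hζ : [ζ] ∈ T) (U : NullSets 𝕜 X) :
    (subtree T ζ = ∅ → ¬ P [(ζ, answer T P ζ U)]) ∧
    ((subtree T ζ).Nonempty →
      ¬ Large (nullFilter 𝕜 X) (subtree T ζ) fun l => P ((ζ, answer T P ζ U) :: l)) := by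
  have : ∃ z ∈ (OrderDual.ofDual U).1, ‖z‖ ≤ 1 ∧ (subtree T ζ = ∅ → ¬ P [(ζ, z)]) ∧
      ((subtree T ζ).Nonempty →
        ¬ Large (nullFilter 𝕜 X) (subtree T ζ) fun l => P ((ζ, z) :: l)) := by
    by_contra! H
    have hU := inter_mem (OrderDual.ofDual U).2 (eventually_norm_le_nullFilter 𝕜 (X := X))
    refine h ?_
    rcases (subtree T ζ).eq_empty_or_nonempty with h0 | h0
    · refine .leaf ζ _ hζ h0 hU fun z hz => ?_
      by_contra hP
      exact (H z hz.1 hz.2 fun _ => hP).1.ne_empty h0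
    · exact .node ζ _ hζ h0 hU fun z hz => (H z hz.1 hz.2 fun h => absurd h h0.ne_empty).2
  unfold answer
  rw [dif_pos this]
  exact this.choose_spec.2.2

/-- The net is indexed by the sets of `nullFilter` under reverse inclusion and its value at `U` lies
in `U`, which forces weak convergence to `0`. -/
theorem tendsto_answer {α : Type*} (T : Set (List α)) (P : List (α × X) → Prop) (ζ : α)
    (f : StrongDual 𝕜 X) :
    Tendsto (fun U : NullSets 𝕜 X => f (answer T P ζ U)) atTop (𝓝 0) := by
  intro S hS
  refine mem_map.2 ((mem_atTop_sets).2
    ⟨OrderDual.toDual ⟨f ⁻¹' S, tendsto_apply_nullFilter 𝕜 f hS⟩, fun U hU => ?_⟩)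
  change f (answer T P ζ U) ∈ S
  unfold answer
  split_ifs with h
  · exact hU h.choose_spec.1
  -- The default value `0` does not spoil the convergence.
  · simpa using mem_of_mem_nhds hS

theorem norm_strategy_le {α : Type*} (T : Set (List α)) (P : List (α × X) → Prop)
    (t : List (α × NullSets 𝕜 X)) : ‖strategy T P t‖ ≤ 1 := by
  fun_induction strategy T P t with
  | case1 => simp
  | case2 T P ζ U => exact norm_answer_le T P ζ U
  | case3 T P ζ U a s ih => exact ih

theorem tendsto_strategy {α : Type*} (T : Set (List α)) (P : List (α × X) → Prop)
    (t : List (α × NullSets 𝕜 X)) (ζ : α) (f : StrongDual 𝕜 X) :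
    Tendsto (fun U : NullSets 𝕜 X => f (strategy T P (t ++ [(ζ, U)]))) atTop (𝓝 0) := by
  induction t generalizing T P with
  | nil => simpa [strategy] using tendsto_answer T P ζ f
  | cons a t ih =>
      obtain ⟨η, V⟩ := a
      refine (ih (subtree T η) fun l => P ((η, answer T P η V) :: l)).congr fun U => ?_
      cases t <;> simp [strategy]

/-- The answers preserve the property that the first player has not won. Branches are finite lists,
so induction on the branch suffices and no well-foundedness of `T` is needed. -/
theorem strategy_spec {α : Type*} {T : Set (List α)} (hT : PrefixClosed T) (hT' : [] ∉ T)
    {P : List (α × X) → Prop}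
    (h : ¬ Large (nullFilter 𝕜 X) T P) {t : List (α × NullSets 𝕜 X)}
    (ht : t.map Prod.fst ∈ maxNodes T) : ¬ P (record (strategy T P) t) := by
  induction t generalizing T P with
  | nil => exact absurd ht.1 hT'
  | cons a t ih =>
      obtain ⟨ζ, U⟩ := a
      have hζ : [ζ] ∈ T := hT _ ht.1 [ζ] (by simp) (by simp)
      obtain ⟨h1, h2⟩ := answer_spec h hζ U
      rcases eq_or_ne t [] with rfl | hne
      · exact h1 (singleton_mem_maxNodes.1 ht).2
      · have hmax : t.map Prod.fst ∈ maxNodes (subtree T ζ) :=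
          mem_maxNodes_subtree.2 ⟨by simpa using hne, ht⟩
        have := ih (hT.subtree ζ) nil_notMem_subtree (h2 ⟨_, hmax.1⟩) hmax
        rw [record]
        change ¬ P ((ζ, answer T P ζ U) :: _)
        convert this using 3
        -- The two collections can differ only at the empty sequence, which a record never reads.
        refine record_congr (fun s hs => ?_) t
        cases s with
        | nil => exact absurd rfl hs
        | cons b s => rfl

theorem exists_weaklyNull_of_not_large {T : Set (List Ordinal.{u})} (hT : PrefixClosed T)
    (hT' : [] ∉ T) {P : List (Ordinal.{u} × X) → Prop} (h : ¬ Large (nullFilter 𝕜 X) T P) :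
    ∃ x : List (Ordinal.{u} × NullSets 𝕜 X) → X, (∀ t, ‖x t‖ ≤ 1) ∧
      WeaklyNull 𝕜 (decorate T (NullSets 𝕜 X)) x ∧
      ∀ t, t.map Prod.fst ∈ maxNodes T → ¬ P (record x t) :=
  ⟨strategy T P, norm_strategy_le T P, fun t ζ _ f => tendsto_strategy T P t ζ f,
    fun _ ht => strategy_spec hT hT' h ht⟩

end Strategy

/-! ### Weighted sums along branches -/

section WeightedSum

variable (𝕜 : Type) [RCLike 𝕜] {α β : Type*} {X : Type v} [NormedAddCommGroup X] [NormedSpace 𝕜 X]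

/-- The sum of the `w(ζ₁, …, ζⱼ) zⱼ` for a list of pairs `(ζⱼ, zⱼ)`. -/
def weightedSum : (List α → ℝ) → List (α × X) → X
  | _, [] => 0
  | w, (ζ, z) :: l => ((w [ζ] : ℝ) : 𝕜) • z + weightedSum (fun s => w (ζ :: s)) l

variable {𝕜}

theorem weightedSum_append (w : List α → ℝ) (l m : List (α × X)) :
    weightedSum 𝕜 w (l ++ m) =
      weightedSum 𝕜 w l + weightedSum 𝕜 (fun s => w (l.map Prod.fst ++ s)) m := by
  induction l generalizing w with
  | nil => simp [weightedSum]
  | cons a l ih => obtain ⟨ζ, z⟩ := a; simp [weightedSum, ih, add_assoc]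

theorem weightedSum_congr {w w' : List α → ℝ} {l : List (α × X)}
    (h : ∀ s, s ≠ [] → s <+: l.map Prod.fst → w s = w' s) :
    weightedSum 𝕜 w l = weightedSum 𝕜 w' l := by
  induction l generalizing w w' with
  | nil => rfl
  | cons a l ih =>
      obtain ⟨ζ, z⟩ := a
      rw [weightedSum, weightedSum, h [ζ] (by simp) (by simp)]
      rw [ih fun s hs hsl => h (ζ :: s) (by simp) (by simpa using hsl)]

theorem weightedSum_zero (l : List (α × X)) : weightedSum 𝕜 (fun _ => 0) l = 0 := by
  induction l with
  | nil => rfl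
  | cons a l ih => obtain ⟨ζ, z⟩ := a; simp [weightedSum, ih]

theorem weightedSum_map (f : α → β) (w : List β → ℝ) (l : List (α × X)) :
    weightedSum 𝕜 w (l.map (Prod.map f id)) = weightedSum 𝕜 (fun s => w (s.map f)) l := by
  induction l generalizing w with
  | nil => rfl
  | cons a l ih => obtain ⟨ζ, z⟩ := a; simp [weightedSum, ih]

theorem weightedSum_mul (c : ℝ) (w : List α → ℝ) (l : List (α × X)) :
    weightedSum 𝕜 (fun s => c * w s) l = (c : 𝕜) • weightedSum 𝕜 w l := by
  induction l generalizing w with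
  | nil => simp [weightedSum]
  | cons a l ih => obtain ⟨ζ, z⟩ := a; simp [weightedSum, ih, mul_smul]

theorem weightedSum_sum {ι : Type*} [Fintype ι] (w : ι → List α → ℝ) (l : List (α × X)) :
    weightedSum 𝕜 (fun s => ∑ i, w i s) l = ∑ i, weightedSum 𝕜 (w i) l := by
  induction l generalizing w with
  | nil => simp [weightedSum]
  | cons a l ih =>
      obtain ⟨ζ, z⟩ := a
      simp [weightedSum, ih, Finset.sum_add_distrib, Finset.sum_smul]

theorem weightedSum_record {D : Type v} (w : List α → ℝ) (x : List (α × D) → X)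
    (t : List (α × D)) :
    weightedSum 𝕜 w (record x t) = ∑ k ∈ Finset.range t.length,
      ((w ((t.take (k + 1)).map Prod.fst) : ℝ) : 𝕜) • x (t.take (k + 1)) := by
  induction t generalizing w x with
  | nil => simp [weightedSum, record]
  | cons a t ih =>
      obtain ⟨ζ, u⟩ := a
      rw [record, weightedSum, ih, List.length_cons, Finset.sum_range_succ', add_comm]
      simp

end WeightedSum

/-! ### The trees `Γ_{ξ,n}` as games -/

section Tree

theorem shift_injective (a : Ordinal.{u}) : Function.Injective (a + · : Ordinal.{u} → Ordinal.{u}) :=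
  fun _ _ h => by simpa using h

theorem Gamma_zero (ξ : Ordinal.{u}) : Gamma ξ 0 = ∅ := by
  simp [Gamma, Lambda, level]

theorem Gamma_add_one (ξ : Ordinal.{u}) (n : ℕ) :
    Gamma ξ (n + 1) = concat (shift (ω ^ ξ * n) '' Gamma₁ ξ) (Gamma ξ n) := by
  have e : maxNodes (shift (ω ^ ξ * n) '' Gamma₁ ξ) = shift (ω ^ ξ * n) '' maxNodes (Gamma₁ ξ) :=
    maxNodes_image (shift_injective _) _
  ext t
  constructor
  · rintro ⟨_ | i, h⟩
    · exact Or.inl h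
    · obtain ⟨s, hs, r, hr, rfl⟩ := h
      exact Or.inr ⟨_, e ▸ ⟨s, hs, rfl⟩, r, ⟨i, hr⟩, rfl⟩
  · rintro (h | ⟨s, hs, r, ⟨i, hr⟩, rfl⟩)
    · exact ⟨0, h⟩
    · rw [e] at hs
      obtain ⟨s, hs, rfl⟩ := hs
      exact ⟨i + 1, s, hs, r, hr, rfl⟩

theorem ne_nil_lt_of_Gamma {ξ : Ordinal.{u}} {n : ℕ} {t : List Ordinal.{u}} (ht : t ∈ Gamma ξ n) :
    t ≠ [] ∧ (∀ a ∈ t, a < ω ^ ξ * n) ∧ ω ^ ξ * (n - 1 : ℕ) ≤ t.headD 0 :=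
  ht.elim fun i hi => ne_nil_lt_of_level (ne_nil_lt_of_Gamma₁ ξ) n i t hi

theorem prefixClosed_Gamma_of {ξ : Ordinal.{u}} (h : PrefixClosed (Gamma₁ ξ)) :
    ∀ n, PrefixClosed (Gamma ξ n)
  | 0 => by rw [Gamma_zero]; exact fun t ht => ht.elim
  | n + 1 => by
      rw [Gamma_add_one]
      exact (h.image _).concat (prefixClosed_Gamma_of h n)

theorem prefixClosed_Gamma₁ (ξ : Ordinal.{u}) : PrefixClosed (Gamma₁ ξ) := by
  induction ξ using Ordinal.limitRecOn with
  | zero =>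
      rw [Gamma₁_zero]
      rintro t rfl s hs hst
      simpa [List.prefix_cons_iff, hs] using hst
  | add_one ξ ih =>
      rw [Gamma₁_add_one]
      rintro t ⟨n, hn⟩ s hs hst
      exact ⟨n, prefixClosed_Gamma_of ih n t hn s hs hst⟩
  | limit ξ hξ ih =>
      rw [Gamma₁_limit hξ]
      rintro t ⟨ζ, hζ, ht⟩ s hs hst
      exact ⟨ζ, hζ, (ih _ (hξ.add_one_lt hζ)).image _ t ht s hs hst⟩

theorem prefixClosed_Gamma (ξ : Ordinal.{u}) (n : ℕ) : PrefixClosed (Gamma ξ n) :=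
  prefixClosed_Gamma_of (prefixClosed_Gamma₁ ξ) n

theorem shift_append_mem_Lambda_succ {ξ : Ordinal.{u}} {n i : ℕ} {s r : List Ordinal.{u}}
    (hs : s ∈ maxNodes (Gamma₁ ξ)) (hr : ∀ a ∈ r, a < ω ^ ξ * n) :
    shift (ω ^ ξ * n) s ++ r ∈ Lambda ξ (n + 1) (i + 1) ↔ r ∈ Lambda ξ n i := by
  classical
  refine ⟨?_, fun h => ⟨s, hs, r, h, rfl⟩⟩
  rintro ⟨s', -, r', hr', h⟩
  have hr'' := (ne_nil_lt_of_level (ne_nil_lt_of_Gamma₁ ξ) n i r' hr').2.1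
  -- Entries of the first block are at least `ω ^ ξ * n` and the others are below it, so filtering
  -- recovers `r` from the concatenation.
  have key : ∀ s r : List Ordinal.{u}, (∀ a ∈ r, a < ω ^ ξ * n) →
      (shift (ω ^ ξ * n) s ++ r).filter (fun a => a < ω ^ ξ * n) = r := by
    intro s r hr
    rw [List.filter_append, List.filter_eq_nil_iff.2, List.filter_eq_self.2]
    · simp
    · simpa using hr
    · simp [shift]
  have := congrArg (List.filter (fun a => a < ω ^ ξ * n)) h
  rw [key s r hr, key s' r' hr''] at this
  rwa [this]

theorem shift_append_notMem_Lambda_zero {ξ : Ordinal.{u}} {n : ℕ} {s r : List Ordinal.{u}}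
    (hr0 : r ≠ []) (hr : ∀ a ∈ r, a < ω ^ ξ * n) :
    shift (ω ^ ξ * n) s ++ r ∉ Lambda ξ (n + 1) 0 := by
  rintro ⟨t, ht, h⟩
  obtain ⟨a, ha⟩ := List.exists_mem_of_ne_nil r hr0
  have : a ∈ shift (ω ^ ξ * n) t := by rw [h]; simp [ha]
  simp only [shift, List.mem_map] at this
  obtain ⟨c, -, rfl⟩ := this
  exact (hr _ ha).not_ge le_self_add

theorem shift_notMem_Lambda_succ {ξ : Ordinal.{u}} {n i : ℕ} {s : List Ordinal.{u}} :
    shift (ω ^ ξ * n) s ∉ Lambda ξ (n + 1) (i + 1) := by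
  rintro ⟨t, -, r, hr, h⟩
  obtain ⟨h1, h2, -⟩ := ne_nil_lt_of_level (ne_nil_lt_of_Gamma₁ ξ) n i r hr
  obtain ⟨a, ha⟩ := List.exists_mem_of_ne_nil r h1
  have : a ∈ shift (ω ^ ξ * n) s := by rw [h]; simp [ha]
  simp only [shift, List.mem_map] at this
  obtain ⟨c, -, rfl⟩ := this
  exact (h2 _ ha).not_ge le_self_add

theorem existsUnique_mem_Lambda {ξ : Ordinal.{u}} :
    ∀ {n : ℕ} {t : List Ordinal.{u}}, t ∈ Gamma ξ n → ∃! i : Fin n, t ∈ Lambda ξ n i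
  | 0, t, h => by simp [Gamma_zero] at h
  | n + 1, t, ⟨0, h⟩ => by
      refine ⟨0, h, fun j hj => ?_⟩
      refine Fin.cases (fun _ => rfl) (fun j hj => ?_) j hj
      obtain ⟨s, hs, rfl⟩ := h
      exact absurd hj shift_notMem_Lambda_succ
  | n + 1, t, ⟨i + 1, h⟩ => by
      obtain ⟨s, hs, r, hr, rfl⟩ := h
      obtain ⟨h1, h2, -⟩ := ne_nil_lt_of_level (ne_nil_lt_of_Gamma₁ ξ) n i r hr
      obtain ⟨j, hj, hj'⟩ := existsUnique_mem_Lambda ⟨i, hr⟩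
      refine ⟨j.succ, ⟨s, hs, r, hj, rfl⟩, fun k hk => ?_⟩
      refine Fin.cases (fun hk => ?_) (fun k hk => ?_) k hk
      · exact absurd hk (shift_append_notMem_Lambda_zero h1 h2)
      · rw [hj' k ((shift_append_mem_Lambda_succ hs h2).1 hk)]

open Classical in
/-- The weight on the level `Λ_{ξ,n,i+1}`, extended by `0`. -/
def levelWeight (ξ : Ordinal.{u}) (n i : ℕ) (s : List Ordinal.{u}) : ℝ :=
  if s ∈ Lambda ξ n i then weight ξ s else 0

theorem sum_levelWeight {ξ : Ordinal.{u}} {n : ℕ} {s : List Ordinal.{u}} (hs : s ∈ Gamma ξ n) :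
    ∑ i : Fin n, levelWeight ξ n i s = weight ξ s := by
  classical
  obtain ⟨i, hi, hi'⟩ := existsUnique_mem_Lambda hs
  rw [Finset.sum_eq_single i]
  · exact if_pos hi
  · exact fun j _ hj => if_neg fun h => hj (hi' j h)
  · simp

theorem levelWeight_zero_shift {ξ : Ordinal.{u}} {n : ℕ} {s : List Ordinal.{u}}
    (hs : s ∈ Gamma₁ ξ) : levelWeight ξ (n + 1) 0 (shift (ω ^ ξ * n) s) = weight₁ ξ s := by
  rw [levelWeight, if_pos ⟨s, hs, rfl⟩, weight_level_zero ξ n hs]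

theorem levelWeight_succ_shift_append {ξ : Ordinal.{u}} {n i : ℕ} {s r : List Ordinal.{u}}
    (hs : s ∈ maxNodes (Gamma₁ ξ)) (hr : r ∈ Gamma ξ n) :
    levelWeight ξ (n + 1) (i + 1) (shift (ω ^ ξ * n) s ++ r) = levelWeight ξ n i r := by
  classical
  simp only [levelWeight, shift_append_mem_Lambda_succ hs (ne_nil_lt_of_Gamma hr).2.1,
    weight_level_succ ξ n s hr]

variable {𝕜 : Type} [RCLike 𝕜] {X : Type v} [NormedAddCommGroup X] [NormedSpace 𝕜 X]

theorem blockSum_eq_weightedSum {D : Type v} (ξ : Ordinal.{u}) (n i : ℕ)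
    (x : List (Ordinal.{u} × D) → X) (t : List (Ordinal.{u} × D)) :
    blockSum 𝕜 ξ n i x t = weightedSum 𝕜 (levelWeight ξ n i) (record x t) := by
  classical
  -- `blockSum` also runs over the prefix of length `0`, which no record contains; it contributes
  -- nothing.
  have h0 : [] ∉ decorate (Lambda ξ n i) D := fun h => (ne_nil_lt_of_Gamma ⟨i, h⟩).1 rfl
  rw [weightedSum_record, blockSum, Finset.sum_filter, Finset.sum_range_succ']
  simp only [List.take_zero, h0, if_false, add_zero]
  refine Finset.sum_congr rfl fun k _ => ?_
  unfold levelWeight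
  by_cases hk : t.take (k + 1) ∈ decorate (Lambda ξ n i) D
  · rw [if_pos hk, if_pos (show (t.take (k + 1)).map Prod.fst ∈ Lambda ξ n i from hk)]
  · rw [if_neg hk, if_neg (show (t.take (k + 1)).map Prod.fst ∉ Lambda ξ n i from hk), RCLike.ofReal_zero, zero_smul]

/-- The first level ignores the continuation and the later levels ignore the first block, so cutting
a branch after its first block matches the `Fin.cons` in `iter`. -/
theorem weightedSum_levelWeight_append {ξ : Ordinal.{u}} {n : ℕ} {l m : List (Ordinal.{u} × X)}
    (hl : l.map Prod.fst ∈ maxNodes (Gamma₁ ξ)) (hm : m.map Prod.fst ∈ Gamma ξ n) :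
    (fun i : Fin (n + 1) => weightedSum 𝕜 (levelWeight ξ (n + 1) i)
      (l.map (Prod.map (ω ^ ξ * n + ·) id) ++ m)) =
    Fin.cons (α := fun _ => X) (weightedSum 𝕜 (weight₁ ξ) l)
      (fun i => weightedSum 𝕜 (levelWeight ξ n i) m) := by
  have e : (l.map (Prod.map (ω ^ ξ * (n : Ordinal.{u}) + ·) id)).map Prod.fst =
      shift (ω ^ ξ * n) (l.map Prod.fst) := by simp [shift, Function.comp_def]
  funext i
  rw [weightedSum_append, weightedSum_map, e]
  refine Fin.cases ?_ (fun i => ?_) i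
  · rw [Fin.cons_zero]
    refine (congrArg₂ (· + ·) (weightedSum_congr fun s hs hsl => ?_)
      ((weightedSum_congr fun s hs hsm => if_neg ?_).trans (weightedSum_zero m))).trans (add_zero _)
    · exact levelWeight_zero_shift (prefixClosed_Gamma₁ ξ _ hl.1 s hs hsl)
    · exact shift_append_notMem_Lambda_zero hs fun a ha =>
        (ne_nil_lt_of_Gamma hm).2.1 a (hsm.subset ha)
  · rw [Fin.cons_succ]
    refine (congrArg₂ (· + ·) ((weightedSum_congr fun s hs hsl => if_neg
      shift_notMem_Lambda_succ).trans (weightedSum_zero l))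
      (weightedSum_congr fun s hs hsm => ?_)).trans (zero_add _)
    exact levelWeight_succ_shift_append hl (prefixClosed_Gamma ξ n _ hm s hs hsm)

theorem Gamma_nonempty_of {ξ : Ordinal.{u}} (h : (Gamma₁ ξ).Nonempty) (n : ℕ) :
    (Gamma ξ (n + 1)).Nonempty := by
  rw [Gamma_add_one]
  exact (h.image _).mono Set.subset_union_left

theorem Gamma₁_nonempty (ξ : Ordinal.{u}) : (Gamma₁ ξ).Nonempty := by
  induction ξ using Ordinal.limitRecOn with
  | zero => rw [Gamma₁_zero]; exact Set.singleton_nonempty _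
  | add_one ξ ih =>
      rw [Gamma₁_add_one]
      exact (Gamma_nonempty_of ih 0).mono fun t ht => ⟨1, ht⟩
  | limit ξ hξ ih =>
      rw [Gamma₁_limit hξ]
      have h0 : 0 < ξ := hξ.bot_lt
      obtain ⟨s, hs⟩ := ih _ (hξ.add_one_lt h0)
      exact ⟨_, 0, h0, s, hs, rfl⟩

/-- A play on `Γ_{ξ,n+1}` is a play on a shifted copy of `Γ_{ξ,1}` followed by one on `Γ_{ξ,n}`,
which is the recursion of `iter`. The case of one block is a hypothesis so that the lemma is
available inside the induction on `ξ`. -/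
theorem large_Gamma_of {ξ : Ordinal.{u}}
    (h : ∀ P : X → Prop, Large (nullFilter 𝕜 X) (Gamma₁ ξ)
      (fun l => P (weightedSum 𝕜 (weight₁ ξ) l)) ↔ ∀ᶠ z in blockFilter 𝕜 X ξ, P z) :
    ∀ (n : ℕ) (P : (Fin (n + 1) → X) → Prop), Large (nullFilter 𝕜 X) (Gamma ξ (n + 1))
      (fun l => P fun i => weightedSum 𝕜 (levelWeight ξ (n + 1) i) l) ↔
        ∀ᶠ w in iter (blockFilter 𝕜 X ξ) (n + 1), P w
  | 0, P => by
      rw [Gamma_one, eventually_iter_succ]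
      simp only [eventually_iter_zero]
      rw [← h]
      refine large_congr fun l hl => ?_
      refine iff_of_eq (congrArg P ?_)
      funext i
      refine Fin.cases ?_ (fun j => j.elim0) i
      rw [Fin.cons_zero]
      refine weightedSum_congr fun s hs hsl => ?_
      simpa [shift] using
        levelWeight_zero_shift (n := 0) (prefixClosed_Gamma₁ ξ _ hl.1 s hs hsl)
  | n + 1, P => by
      have hnil : [] ∉ shift (ω ^ ξ * (n + 1 : ℕ)) '' Gamma₁ ξ := by
        rintro ⟨s, hs, h⟩
        exact (ne_nil_lt_of_Gamma₁ ξ s hs).1 (by simpa [shift] using h)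
      rw [Gamma_add_one ξ (n + 1), large_concat hnil
        (fun h => (ne_nil_lt_of_Gamma h).1 rfl) (Gamma_nonempty_of (Gamma₁_nonempty ξ) n)]
      refine (large_image (shift_injective (ω ^ ξ * (n + 1 : ℕ)))).trans ?_
      rw [eventually_iter_succ, ← h]
      refine large_congr fun l hl => ?_
      rw [← large_Gamma_of h n]
      refine large_congr fun m hm => iff_of_eq (congrArg P ?_)
      exact weightedSum_levelWeight_append hl hm.1

/-- Trees and filters obey the same recursion. At a successor the first player picks `n`, and the
factor `1 / n` in the weights turns the block sums into an average; at a limit the first player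
picks `ζ < ξ`. -/
theorem large_Gamma₁ (ξ : Ordinal.{u}) (P : X → Prop) :
    Large (nullFilter 𝕜 X) (Gamma₁ ξ) (fun l => P (weightedSum 𝕜 (weight₁ ξ) l)) ↔
      ∀ᶠ z in blockFilter 𝕜 X ξ, P z := by
  induction ξ using Ordinal.limitRecOn generalizing P with
  | zero =>
      rw [Gamma₁_zero, large_singleton, blockFilter_zero]
      simp [weightedSum, weight_zero]
  | add_one ξ ih =>
      rw [Gamma₁_add_one, large_union]
      · refine Iff.trans ?_ (mem_blockFilter_add_one 𝕜).symm
        have key : ∀ n : ℕ, Large (nullFilter 𝕜 X) (Gamma ξ (n + 1))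
            (fun l => P (weightedSum 𝕜 (weight₁ (ξ + 1)) l)) ↔
            ∀ᶠ z in avgFilter 𝕜 (blockFilter 𝕜 X ξ) (n + 1), P z := by
          intro n
          rw [eventually_avgFilter, ← large_Gamma_of ih n]
          refine large_congr fun l hl => iff_of_eq (congrArg P ?_)
          rw [← weightedSum_sum (fun i : Fin (n + 1) => levelWeight ξ (n + 1) i)]
          have := weightedSum_mul (𝕜 := 𝕜) (((n + 1 : ℕ) : ℝ)⁻¹)
            (fun s => ∑ i : Fin (n + 1), levelWeight ξ (n + 1) i s) l
          rw [RCLike.ofReal_inv, RCLike.ofReal_natCast] at this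
          rw [← this]
          refine weightedSum_congr fun s hs hsl => ?_
          have hs' := prefixClosed_Gamma ξ _ _ hl.1 s hs hsl
          rw [sum_levelWeight hs', weight_add_one ξ _ hs', div_eq_inv_mul]
        constructor
        · rintro ⟨_ | n, hn⟩
          · rw [Gamma_zero] at hn
            exact absurd hn not_large_empty
          · exact ⟨n, (key n).1 hn⟩
        · rintro ⟨n, hn⟩
          exact ⟨n + 1, (key n).2 hn⟩
      · have hpos : (0 : Ordinal.{u}) < ω ^ ξ := Ordinal.opow_pos _ Ordinal.omega0_pos
        -- The first entry lies in `[ω ^ ξ * (n - 1), ω ^ ξ * n)`, which determines `n`.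
        have key : ∀ m n ζ s r, ζ :: s ∈ Gamma ξ m → ζ :: r ∈ Gamma ξ n → m ≤ n := by
          intro m n ζ s r hm hn
          have h1 : ω ^ ξ * (m - 1 : ℕ) ≤ ζ := by simpa using (ne_nil_lt_of_Gamma hm).2.2
          have h2 := (ne_nil_lt_of_Gamma hn).2.1 ζ (by simp)
          have : m - 1 < n := by exact_mod_cast (mul_lt_mul_iff_right₀ hpos).1 (h1.trans_lt h2)
          omega
        exact fun m n ζ s r hm hn => le_antisymm (key m n ζ s r hm hn) (key n m ζ r s hn hm)
  | limit ξ hξ ih =>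
      have e : Gamma₁ ξ = {t | ∃ ζ : Set.Iio ξ, t ∈ shift (ω ^ ζ.1) '' Gamma₁ (ζ.1 + 1)} := by
        rw [Gamma₁_limit hξ]
        ext t
        simp
      rw [e, large_union]
      · refine Iff.trans ?_ (mem_blockFilter_limit 𝕜 hξ).symm
        have key : ∀ ζ : Set.Iio ξ, Large (nullFilter 𝕜 X) (shift (ω ^ ζ.1) '' Gamma₁ (ζ.1 + 1))
            (fun l => P (weightedSum 𝕜 (weight₁ ξ) l)) ↔
            ∀ᶠ z in blockFilter 𝕜 X (ζ.1 + 1), P z := by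
          intro ζ
          rw [← ih _ (hξ.add_one_lt ζ.2)]
          refine (large_image (shift_injective (ω ^ ζ.1))).trans (large_congr fun l hl => ?_)
          refine iff_of_eq (congrArg P ?_)
          rw [weightedSum_map]
          exact weightedSum_congr fun s hs hsl =>
            weight_limit hξ ζ.2 (prefixClosed_Gamma₁ _ _ hl.1 s hs hsl)
        constructor
        · rintro ⟨ζ, h⟩
          exact ⟨ζ.1 + 1, hξ.add_one_lt ζ.2, (key ζ).1 h⟩
        · rintro ⟨ζ, hζ, h⟩
          -- The part of the tree chosen through `ζ` carries the filter for `ζ + 1`, which is finer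
          -- than the one for `ζ`.
          exact ⟨⟨ζ, hζ⟩, (key ⟨ζ, hζ⟩).2 (blockFilter_anti 𝕜 X le_self_add h)⟩
      · have key : ∀ (ζ : Ordinal.{u}) η s, η :: s ∈ shift (ω ^ ζ) '' Gamma₁ (ζ + 1) →
            Ordinal.log ω η = ζ := by
          rintro ζ η s ⟨t, ht, h⟩
          rcases t with _ | ⟨c, t⟩
          · simp [shift] at h
          · have hc := (ne_nil_lt_of_Gamma₁ _ _ ht).2 c (by simp)
            obtain ⟨rfl, -⟩ : ω ^ ζ + c = η ∧ _ := by simpa [shift] using h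
            refine (Ordinal.log_eq_iff Ordinal.one_lt_omega0 ?_ _).2 ⟨le_self_add, ?_⟩
            · exact (lt_of_lt_of_le (Ordinal.opow_pos _ Ordinal.omega0_pos) le_self_add).ne'
            · exact (Ordinal.isPrincipal_add_omega0_opow (ζ + 1))
                ((Ordinal.opow_lt_opow_iff_right Ordinal.one_lt_omega0).2 (by simp)) hc
        exact fun ζ η a s r hs hr => Subtype.ext ((key _ _ _ hs).symm.trans (key _ _ _ hr))

theorem large_Gamma (ξ : Ordinal.{u}) {n : ℕ} (hn : n ≠ 0) (P : (Fin n → X) → Prop) :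
    Large (nullFilter 𝕜 X) (Gamma ξ n)
      (fun l => P fun i => weightedSum 𝕜 (levelWeight ξ n i) l) ↔
        ∀ᶠ w in iter (blockFilter 𝕜 X ξ) n, P w := by
  obtain ⟨n, rfl⟩ := Nat.exists_eq_succ_of_ne_zero hn
  exact large_Gamma_of (large_Gamma₁ ξ) n P

/-- A winning strategy of the first player finds a good branch in every weakly null collection.
Without one, the answers of the second player form a single collection, over the directed set
`NullSets`, all of whose branches are bad. -/
theorem eventually_iter_blockFilter_iff (ξ : Ordinal.{u}) {n : ℕ} (hn : n ≠ 0)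
    (P : (Fin n → X) → Prop) :
    (∀ᶠ w in iter (blockFilter 𝕜 X ξ) n, P w) ↔
      ∀ (D : Type v) [Preorder D] [IsDirectedOrder D] [Nonempty D]
        (x : List (Ordinal.{u} × D) → X), (∀ t ∈ decorate (Gamma ξ n) D, ‖x t‖ ≤ 1) →
        WeaklyNull 𝕜 (decorate (Gamma ξ n) D) x →
        ∃ t ∈ maxNodes (decorate (Gamma ξ n) D), P fun i => blockSum 𝕜 ξ n i x t := by
  simp only [blockSum_eq_weightedSum]
  rw [← large_Gamma ξ hn]
  constructor
  · intro h D _ _ _ x hx hw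
    obtain ⟨t, ht, hP⟩ := h.exists_maxNodes 𝕜 x hx hw
    exact ⟨t, mem_maxNodes_decorate ht, hP⟩
  · intro h
    by_contra H
    obtain ⟨x, hx, hw, hP⟩ := exists_weaklyNull_of_not_large (prefixClosed_Gamma ξ n)
      (fun h => (ne_nil_lt_of_Gamma h).1 rfl) H
    obtain ⟨t, ht, hPt⟩ := h (NullSets 𝕜 X) x (fun t _ => hx t) hw
    exact hP t (mem_maxNodes_of_decorate ht) hPt

end Tree

/-! ### Szlenk derivations -/

section Derivation

variable {𝕜 : Type} [RCLike 𝕜] {X : Type v} [NormedAddCommGroup X] [NormedSpace 𝕜 X]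

theorem derive_subset (ε : ℝ) (K : Set (StrongDual 𝕜 X)) : derive ε K ⊆ K := fun _ h => h.1

theorem derive_mono (ε : ℝ) {K L : Set (StrongDual 𝕜 X)} (h : K ⊆ L) : derive ε K ⊆ derive ε L :=
  fun _ hf => ⟨h hf.1, fun hε V hV => (hf.2 hε V hV).trans_le
    (Metric.ediam_mono (Set.inter_subset_inter_right _ h))⟩

theorem derive_zero (K : Set (StrongDual 𝕜 X)) : derive 0 K = K :=
  (derive_subset 0 K).antisymm fun _ hf => ⟨hf, fun h => absurd h (lt_irrefl _)⟩

theorem deriveIter_zero (ε : ℝ) (K : Set (StrongDual 𝕜 X)) :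
    deriveIter ε (0 : Ordinal.{u}) K = K := by
  simp [deriveIter]

theorem deriveIter_add_one (ε : ℝ) (ξ : Ordinal.{u}) (K : Set (StrongDual 𝕜 X)) :
    deriveIter ε (ξ + 1) K = derive ε (deriveIter ε ξ K) := by
  simp [deriveIter]

theorem deriveIter_limit (ε : ℝ) {ξ : Ordinal.{u}} (hξ : Order.IsSuccLimit ξ)
    (K : Set (StrongDual 𝕜 X)) :
    deriveIter ε ξ K = ⋂ ζ : Set.Iio ξ, deriveIter ε ζ.1 K := by
  unfold deriveIter
  rw [Ordinal.limitRecOn_limit _ _ _ _ hξ]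
  ext f
  simp

theorem deriveIter_anti (ε : ℝ) (K : Set (StrongDual 𝕜 X)) :
    Antitone fun ξ : Ordinal.{u} => deriveIter ε ξ K := by
  intro η ξ
  induction ξ using Ordinal.limitRecOn with
  | zero => intro h; rw [nonpos_iff_eq_zero.1 h]
  | add_one ξ ih =>
      intro h
      rcases h.eq_or_lt with rfl | h
      · exact le_rfl
      · refine le_trans ?_ (ih (Order.lt_add_one_iff.1 h))
        simp only [deriveIter_add_one]
        exact derive_subset _ _
  | limit ξ hξ ih =>
      intro h
      rcases h.eq_or_lt with rfl | h
      · exact le_rfl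
      · simp only [deriveIter_limit ε hξ K]
        exact Set.iInter_subset (fun ζ : Set.Iio ξ => deriveIter ε ζ.1 K) ⟨η, h⟩

theorem deriveIter_subset (ε : ℝ) (ξ : Ordinal.{u}) (K : Set (StrongDual 𝕜 X)) :
    deriveIter ε ξ K ⊆ K := by
  conv_rhs => rw [← deriveIter_zero.{u} ε K]
  exact deriveIter_anti ε K bot_le

theorem deriveIter_mono (ε : ℝ) (ξ : Ordinal.{u}) {K L : Set (StrongDual 𝕜 X)} (h : K ⊆ L) :
    deriveIter ε ξ K ⊆ deriveIter ε ξ L := by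
  induction ξ using Ordinal.limitRecOn with
  | zero => simpa only [deriveIter_zero]
  | add_one ξ ih => simpa only [deriveIter_add_one] using derive_mono ε ih
  | limit ξ hξ ih =>
      simp only [deriveIter_limit ε hξ]
      exact Set.iInter_mono fun ζ => ih ζ.1 ζ.2

theorem deriveIter_zero_left (ξ : Ordinal.{u}) (K : Set (StrongDual 𝕜 X)) :
    deriveIter 0 ξ K = K := by
  refine (deriveIter_subset 0 ξ K).antisymm ?_
  induction ξ using Ordinal.limitRecOn with
  | zero => rw [deriveIter_zero]
  | add_one ξ ih =>
      rw [deriveIter_add_one, derive_zero]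
      exact ih
  | limit ξ hξ ih =>
      rw [deriveIter_limit 0 hξ]
      exact Set.subset_iInter fun ζ => ih ζ.1 ζ.2

theorem deriveIter_add (ε : ℝ) (a b : Ordinal.{u}) (K : Set (StrongDual 𝕜 X)) :
    deriveIter ε (a + b) K = deriveIter ε b (deriveIter ε a K) := by
  induction b using Ordinal.limitRecOn with
  | zero => rw [add_zero, deriveIter_zero]
  | add_one b ih => rw [← add_assoc, deriveIter_add_one, ih, deriveIter_add_one]
  | limit b hb ih =>
      rw [deriveIter_limit ε (Ordinal.isSuccLimit_add a hb), deriveIter_limit ε hb]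
      refine Set.Subset.antisymm (Set.subset_iInter fun ζ => ?_) (Set.subset_iInter fun ζ => ?_)
      · rw [← ih ζ.1 ζ.2]
        exact Set.iInter_subset (fun η : Set.Iio (a + b) => deriveIter ε η.1 K)
          ⟨a + ζ.1, (add_lt_add_iff_left a).2 ζ.2⟩
      · obtain ⟨ζ, hζ⟩ := ζ
        -- The ordinals `a + c` with `c < b` are cofinal in `a + b`.
        obtain ⟨c, hc, hζc⟩ : ∃ c < b, ζ ≤ a + c := by
          rcases le_or_gt ζ a with h | h
          · exact ⟨0, hb.bot_lt, by simpa using h⟩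
          · refine ⟨ζ - a, ?_, (Ordinal.add_sub_cancel_of_le h.le).ge⟩
            have : a + (ζ - a) < a + b := by
              rw [Ordinal.add_sub_cancel_of_le h.le]; exact hζ
            simpa using this
        refine (Set.iInter_subset _ (⟨c, hc⟩ : Set.Iio b)).trans ?_
        rw [← ih c hc]
        exact deriveIter_anti ε K hζc

/-- `K` is closed in the weak-star topology. -/
def IsWeakStarClosed (K : Set (StrongDual 𝕜 X)) : Prop :=
  IsClosed (WeakDual.toStrongDual ⁻¹' K : Set (WeakDual 𝕜 X))

theorem IsWeakStarClosed.inter {K L : Set (StrongDual 𝕜 X)} (hK : IsWeakStarClosed K)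
    (hL : IsWeakStarClosed L) : IsWeakStarClosed (K ∩ L) :=
  IsClosed.inter hK hL

theorem continuous_weakDual_apply (z : X) : Continuous fun y : WeakDual 𝕜 X => y z :=
  WeakDual.eval_continuous z

theorem isWeakStarClosed_le_norm (b : ℝ) (z : X) :
    IsWeakStarClosed {y : StrongDual 𝕜 X | b ≤ ‖y z‖} :=
  isClosed_le continuous_const (continuous_weakDual_apply z).norm

theorem IsWeakStarClosed.derive {K : Set (StrongDual 𝕜 X)} (hK : IsWeakStarClosed K) (ε : ℝ) :
    IsWeakStarClosed (derive ε K) := by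
  refine isClosed_of_closure_subset fun f hf => ⟨?_, fun hε V hV => ?_⟩
  · exact closure_minimal (fun g hg => hg.1) hK hf
  · obtain ⟨W, hWV, hW, hfW⟩ := mem_nhds_iff.1 hV
    obtain ⟨g, hgW, hg⟩ := mem_closure_iff.1 hf W hW hfW
    exact (hg.2 hε W (hW.mem_nhds hgW)).trans_le
      (Metric.ediam_mono (Set.inter_subset_inter_left _ (Set.preimage_mono hWV)))

theorem IsWeakStarClosed.deriveIter {K : Set (StrongDual 𝕜 X)} (hK : IsWeakStarClosed K) (ε : ℝ)
    (ξ : Ordinal.{u}) : IsWeakStarClosed (deriveIter ε ξ K) := by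
  induction ξ using Ordinal.limitRecOn with
  | zero => rwa [deriveIter_zero]
  | add_one ξ ih => rw [deriveIter_add_one]; exact ih.derive ε
  | limit ξ hξ ih =>
      rw [deriveIter_limit ε hξ, IsWeakStarClosed, Set.preimage_iInter]
      exact isClosed_iInter fun ζ => ih ζ.1 ζ.2

theorem IsWeakStarClosed.isCompact {K : Set (StrongDual 𝕜 X)} (hK : IsWeakStarClosed K) {R : ℝ}
    (hR : ∀ y ∈ K, ‖y‖ ≤ R) : IsCompact (WeakDual.toStrongDual ⁻¹' K : Set (WeakDual 𝕜 X)) :=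
  (WeakDual.isCompact_closedBall (0 : StrongDual 𝕜 X) R).of_isClosed_subset hK
    fun _ hy => mem_closedBall_zero_iff.2 (hR _ hy)

theorem deriveIter_limit_nonempty {K : Set (StrongDual 𝕜 X)} (hK : IsWeakStarClosed K) {R : ℝ}
    (hR : ∀ y ∈ K, ‖y‖ ≤ R) {ε : ℝ} {ξ : Ordinal.{u}} (hξ : Order.IsSuccLimit ξ)
    (h : ∀ ζ < ξ, (deriveIter ε ζ K).Nonempty) : (deriveIter ε ξ K).Nonempty := by
  have : Nonempty (Set.Iio ξ) := ⟨⟨0, hξ.bot_lt⟩⟩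
  have hc := IsCompact.nonempty_iInter_of_directed_nonempty_isCompact_isClosed
    (fun ζ : Set.Iio ξ =>
      (WeakDual.toStrongDual ⁻¹' Szlenk.deriveIter ε ζ.1 K : Set (WeakDual 𝕜 X)))
    (fun a b => ⟨max a b, Set.preimage_mono (deriveIter_anti ε K (le_max_left a.1 b.1)),
      Set.preimage_mono (deriveIter_anti ε K (le_max_right a.1 b.1))⟩)
    (fun ζ => h ζ.1 ζ.2)
    (fun ζ => (hK.deriveIter ε ζ.1).isCompact fun y hy => hR y (deriveIter_subset _ _ _ hy))
    (fun ζ => hK.deriveIter ε ζ.1)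
  rw [deriveIter_limit ε hξ]
  rw [← Set.preimage_iInter] at hc
  exact hc

/-- `s_{ε₁}^{ω ^ ξ} ⋯ s_{εₙ}^{ω ^ ξ}(K)`. -/
def deriveFold (ξ : Ordinal.{u}) {n : ℕ} (ε : Fin n → ℝ) (K : Set (StrongDual 𝕜 X)) :
    Set (StrongDual 𝕜 X) :=
  (List.ofFn ε).foldr (fun ε L => deriveIter ε (ω ^ ξ) L) K

theorem deriveFold_zero (ξ : Ordinal.{u}) (ε : Fin 0 → ℝ) (K : Set (StrongDual 𝕜 X)) :
    deriveFold ξ ε K = K := by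
  simp [deriveFold]

theorem deriveFold_succ (ξ : Ordinal.{u}) {n : ℕ} (ε : Fin (n + 1) → ℝ)
    (K : Set (StrongDual 𝕜 X)) :
    deriveFold ξ ε K = deriveIter (ε 0) (ω ^ ξ) (deriveFold ξ (fun i => ε i.succ) K) := by
  simp [deriveFold, List.ofFn_succ]

theorem deriveFold_subset (ξ : Ordinal.{u}) :
    ∀ {n : ℕ} (ε : Fin n → ℝ) (K : Set (StrongDual 𝕜 X)), deriveFold ξ ε K ⊆ K
  | 0, ε, K => (deriveFold_zero ξ ε K).le
  | n + 1, ε, K => by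
      rw [deriveFold_succ]
      exact (deriveIter_subset _ _ _).trans (deriveFold_subset ξ _ K)

theorem deriveFold_mono (ξ : Ordinal.{u}) :
    ∀ {n : ℕ} (ε : Fin n → ℝ) {K L : Set (StrongDual 𝕜 X)}, K ⊆ L →
      deriveFold ξ ε K ⊆ deriveFold ξ ε L
  | 0, ε, K, L, h => by simpa only [deriveFold_zero]
  | n + 1, ε, K, L, h => by
      rw [deriveFold_succ, deriveFold_succ]
      exact deriveIter_mono _ _ (deriveFold_mono ξ _ h)

theorem IsWeakStarClosed.deriveFold {K : Set (StrongDual 𝕜 X)} (hK : IsWeakStarClosed K)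
    (ξ : Ordinal.{u}) : ∀ {n : ℕ} (ε : Fin n → ℝ), IsWeakStarClosed (deriveFold ξ ε K)
  | 0, ε => by rwa [deriveFold_zero]
  | n + 1, ε => by
      rw [deriveFold_succ]
      exact (hK.deriveFold ξ _).deriveIter _ _

/-- Derivations with parameter `0` do nothing, so only the number of active indices counts. -/
theorem deriveFold_ite (ξ : Ordinal.{u}) (ε : ℝ) (K : Set (StrongDual 𝕜 X)) :
    ∀ {n : ℕ} (p : Fin n → Prop) [DecidablePred p],
      deriveFold ξ (fun i => if p i then ε else 0) K =
        deriveIter ε (ω ^ ξ * (Finset.univ.filter p).card) K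
  | 0, p, _ => by simp [deriveFold_zero, deriveIter_zero]
  | n + 1, p, _ => by
      rw [deriveFold_succ, deriveFold_ite ξ ε K (fun i => p i.succ), Fin.card_filter_univ_succ]
      by_cases h : p 0
      · simp only [h, if_true]
        rw [← deriveIter_add, Nat.cast_add, Nat.cast_one, mul_add_one]
      · simp only [h, if_false]
        rw [deriveIter_zero_left]

end Derivation

/-! ### From derivations to blocks and back -/

section Duality

variable {𝕜 : Type} [RCLike 𝕜] {X : Type v} [NormedAddCommGroup X] [NormedSpace 𝕜 X]

theorem exists_re_apply_gt {f : StrongDual 𝕜 X} {r : ℝ} (h : r < ‖f‖) :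
    ∃ z : X, ‖z‖ ≤ 1 ∧ r < RCLike.re (f z) := by
  obtain ⟨z, hz, hz'⟩ := f.exists_lt_apply_of_lt_opNorm h
  obtain ⟨c, hc, hc'⟩ := RCLike.exists_norm_eq_mul_self (f z)
  refine ⟨c • z, by rw [norm_smul, hc, one_mul]; exact hz.le, ?_⟩
  rw [map_smul, smul_eq_mul, ← hc', RCLike.ofReal_re]
  exact hz'

/-- Otherwise `V ∩ L` would lie in the ball of radius `ε / 2` about `x` and have diameter at most
`ε`. -/
theorem exists_norm_sub_gt_of_mem_derive {ε : ℝ} (hε : 0 < ε) {L : Set (StrongDual 𝕜 X)}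
    {x : StrongDual 𝕜 X} (hx : x ∈ derive ε L) {V : Set (WeakDual 𝕜 X)}
    (hV : V ∈ 𝓝 (StrongDual.toWeakDual x)) :
    ∃ y ∈ L, StrongDual.toWeakDual y ∈ V ∧ ε / 2 < ‖y - x‖ := by
  by_contra! H
  refine (hx.2 hε V hV).not_ge (Metric.ediam_le fun y hy y' hy' => ?_)
  rw [edist_dist]
  refine ENNReal.ofReal_le_ofReal ((dist_triangle_right y y' x).trans ?_)
  rw [dist_eq_norm, dist_eq_norm]
  linarith [H y hy.2 hy.1, H y' hy'.2 hy'.1]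

/-- Along an ultrafilter the bounded scalars `f (z a)` converge, so differences of two copies are
weakly null although `z` itself need not be. The factor `1 / 2` returns them to the unit ball. -/
theorem tendsto_half_sub_nullFilter {α : Type*} (G : Ultrafilter α) {z : α → X}
    (hz : ∀ᶠ a in (G : Filter α), ‖z a‖ ≤ 1) :
    Tendsto (fun p : α × α => (2 : 𝕜)⁻¹ • (z p.2 - z p.1)) ((G : Filter α) ×ˢ (G : Filter α))
      (nullFilter 𝕜 X) := by
  refine (tendsto_nullFilter 𝕜).2 ⟨fun f => ?_, ?_⟩
  · obtain ⟨c, -, hc⟩ := (isCompact_closedBall (0 : 𝕜) ‖f‖).ultrafilter_le_nhds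
      (G.map fun a => f (z a)) (by
        refine le_principal_iff.2 (hz.mono fun a ha => ?_)
        simpa using f.le_of_opNorm_le_of_le le_rfl ha)
    have h1 : Tendsto (fun a => f (z a)) G (𝓝 c) := hc
    have := ((h1.comp tendsto_snd).sub (h1.comp tendsto_fst)).const_smul (2 : 𝕜)⁻¹
    simpa using this
  · filter_upwards [hz.prod_mk hz] with p hp
    rw [norm_smul, norm_inv, RCLike.norm_ofNat]
    linarith [norm_sub_le (z p.2) (z p.1), hp.1, hp.2]

/-- Functionals `y` of `L` tending weak-star to `x` stay at distance above `ε / 2`, as witnessed by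
unit vectors. Half differences of the witnesses are weakly null, and `y` is still large on them
because its value at the earlier witness is close to that of `x`. -/
theorem frequently_nullFilter_of_mem_derive {ε : ℝ} (hε : 0 < ε) {L : Set (StrongDual 𝕜 X)}
    {x : StrongDual 𝕜 X} (hx : x ∈ derive ε L) {V : Set (WeakDual 𝕜 X)}
    (hV : V ∈ 𝓝 (StrongDual.toWeakDual x)) :
    ∃ᶠ z in nullFilter 𝕜 X, ∃ y ∈ L, StrongDual.toWeakDual y ∈ V ∧ ε / 5 < RCLike.re (y z) := by
  intro H
  have hxz : ∀ᶠ z in nullFilter 𝕜 X, ‖x z‖ < ε / 40 := by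
    simpa using Metric.tendsto_nhds.1 (tendsto_apply_nullFilter 𝕜 x) (ε / 40) (by positivity)
  let S : Set (WeakDual 𝕜 X × X) :=
    {p | WeakDual.toStrongDual p.1 ∈ L ∧ ‖p.2‖ ≤ 1 ∧
      ε / 2 < RCLike.re ((WeakDual.toStrongDual p.1 - x) p.2)}
  have hne : (comap Prod.fst (𝓝 (StrongDual.toWeakDual x)) ⊓ 𝓟 S).NeBot := by
    rw [← frequently_mem_iff_neBot, frequently_comap]
    refine frequently_iff.2 fun {W} hW => ?_
    obtain ⟨y, hyL, hyW, hy⟩ := exists_norm_sub_gt_of_mem_derive hε hx hW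
    obtain ⟨z, hz, hz'⟩ := exists_re_apply_gt hy
    exact ⟨_, hyW, (_, z), rfl, hyL, hz, hz'⟩
  let G := Ultrafilter.of (comap Prod.fst (𝓝 (StrongDual.toWeakDual x)) ⊓ 𝓟 S)
  have hG := Ultrafilter.of_le (comap Prod.fst (𝓝 (StrongDual.toWeakDual x)) ⊓ 𝓟 S)
  have hGS : ∀ᶠ p in (G : Filter (WeakDual 𝕜 X × X)), p ∈ S := hG (mem_inf_of_right (mem_principal_self S))
  have hGx : Tendsto Prod.fst (G : Filter (WeakDual 𝕜 X × X)) (𝓝 (StrongDual.toWeakDual x)) :=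
    tendsto_iff_comap.2 (hG.trans inf_le_left)
  have hnull := tendsto_half_sub_nullFilter (𝕜 := 𝕜) G (z := Prod.snd) (hGS.mono fun p hp => hp.2.1)
  -- `q` is fixed before `p`, so that the functional `p.1` can be taken close to `x` at the vector
  -- `q.2`.
  obtain ⟨q, hq⟩ := (hnull.eventually (H.and hxz)).curry.exists
  have hq' : ∀ᶠ p in (G : Filter (WeakDual 𝕜 X × X)), ‖p.1 q.2 - x q.2‖ < ε / 40 := by
    have := ((continuous_weakDual_apply q.2).tendsto (StrongDual.toWeakDual x)).comp hGx
    simpa [dist_eq_norm] using Metric.tendsto_nhds.1 this (ε / 40) (by positivity)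
  obtain ⟨p, ⟨hp1, hp2⟩, hp3, hp4, hp5⟩ := (hq.and (hq'.and (hGS.and (hGx.eventually hV)))).exists
  refine hp1 ⟨WeakDual.toStrongDual p.1, hp4.1, hp5, ?_⟩
  have h1 := hp4.2.2
  have h2 := (abs_le.1 (RCLike.abs_re_le_norm (p.1 q.2 - x q.2))).2
  have h3 := (abs_le.1 (RCLike.abs_re_le_norm (x ((2 : 𝕜)⁻¹ • (p.2 - q.2))))).1
  have h4 : ∀ (y : StrongDual 𝕜 X), RCLike.re (y ((2 : 𝕜)⁻¹ • (p.2 - q.2))) =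
      2⁻¹ * (RCLike.re (y p.2) - RCLike.re (y q.2)) := by
    intro y
    rw [map_smul, map_sub, smul_eq_mul, show (2 : 𝕜)⁻¹ = ((2⁻¹ : ℝ) : 𝕜) by
      rw [RCLike.ofReal_inv, RCLike.ofReal_ofNat], RCLike.re_ofReal_mul, map_sub]
  rw [h4] at h3
  rw [h4]
  simp only [sub_apply, map_sub] at h1 h2
  change RCLike.re (WeakDual.toStrongDual p.1 q.2) - _ ≤ _ at h2
  -- The estimate yields more than `ε / 4 - ε / 40 - ε / 80`, which exceeds `ε / 5`.
  linarith


/-- The outermost derivation supplies the first block. The lower bound on it is a weak-star open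
condition and is put into the next neighbourhood, so the functionals found later keep it. -/
theorem frequently_iter_of_mem_deriveFold {ξ : Ordinal.{u}}
    (h : ∀ ε > 0, ∀ (L : Set (StrongDual 𝕜 X)) (x : StrongDual 𝕜 X), x ∈ deriveIter ε (ω ^ ξ) L →
      ∀ V ∈ 𝓝 (StrongDual.toWeakDual x), ∃ᶠ z in blockFilter 𝕜 X ξ,
        ∃ y ∈ L, StrongDual.toWeakDual y ∈ V ∧ ε / 5 < RCLike.re (y z))
    (K : Set (StrongDual 𝕜 X)) :
    ∀ {n : ℕ} (ε : Fin n → ℝ), (∀ i, 0 < ε i) → ∀ x ∈ deriveFold ξ ε K,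
      ∀ V ∈ 𝓝 (StrongDual.toWeakDual x), ∃ᶠ w in iter (blockFilter 𝕜 X ξ) n,
        ∃ y ∈ K, StrongDual.toWeakDual y ∈ V ∧ ∀ i, ε i / 5 < RCLike.re (y (w i))
  | 0, ε, _, x, hx, V, hV => by
      rw [deriveFold_zero] at hx
      exact frequently_iter_zero.2 ⟨x, hx, mem_of_mem_nhds hV, fun i => i.elim0⟩
  | n + 1, ε, hε, x, hx, V, hV => by
      rw [deriveFold_succ] at hx
      refine frequently_iter_succ.2 ((h _ (hε 0) _ x hx _ (interior_mem_nhds.2 hV)).mono ?_)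
      rintro z ⟨y, hy, hyV, hyz⟩
      have hW : V ∩ {g : WeakDual 𝕜 X | ε 0 / 5 < RCLike.re (g z)} ∈
          𝓝 (StrongDual.toWeakDual y) := by
        refine inter_mem (mem_interior_iff_mem_nhds.1 hyV) (IsOpen.mem_nhds ?_ hyz)
        exact isOpen_lt continuous_const (RCLike.continuous_re.comp (continuous_weakDual_apply z))
      refine (frequently_iter_of_mem_deriveFold h K _ (fun i => hε i.succ) y hy _ hW).mono ?_
      rintro w ⟨g, hg, hgV, hgw⟩
      exact ⟨g, hg, hgV.1, Fin.cases hgV.2 hgw⟩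

theorem deriveFold_const (ξ : Ordinal.{u}) (ε : ℝ) (K : Set (StrongDual 𝕜 X)) (n : ℕ) :
    deriveFold ξ (fun _ : Fin n => ε) K = deriveIter ε (ω ^ ξ * n) K := by
  simpa using deriveFold_ite ξ ε K fun _ : Fin n => True

/-- At a successor, `x` survives `ω ^ ξ * (n + 1)` derivations for every `n`; one functional is then
large on `n + 1` successive blocks, hence on their average. -/
theorem frequently_blockFilter_of_mem_deriveIter (ξ : Ordinal.{u}) :
    ∀ ε > 0, ∀ (L : Set (StrongDual 𝕜 X)) (x : StrongDual 𝕜 X), x ∈ deriveIter ε (ω ^ ξ) L →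
      ∀ V ∈ 𝓝 (StrongDual.toWeakDual x), ∃ᶠ z in blockFilter 𝕜 X ξ,
        ∃ y ∈ L, StrongDual.toWeakDual y ∈ V ∧ ε / 5 < RCLike.re (y z) := by
  induction ξ using Ordinal.limitRecOn with
  | zero =>
      intro ε hε L x hx V hV
      rw [Ordinal.opow_zero, ← zero_add (1 : Ordinal.{u}), deriveIter_add_one, deriveIter_zero] at hx
      rw [blockFilter_zero]
      exact frequently_nullFilter_of_mem_derive hε hx hV
  | add_one ξ ih =>
      intro ε hε L x hx V hV H
      obtain ⟨n, hn⟩ := (mem_blockFilter_add_one 𝕜).1 H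
      have hx' : x ∈ deriveFold ξ (fun _ : Fin (n + 1) => ε) L := by
        rw [deriveFold_const]
        refine deriveIter_anti ε L ?_ hx
        rw [Ordinal.opow_add, Ordinal.opow_one]
        exact mul_le_mul_right (Ordinal.natCast_lt_omega0 _).le _
      have := frequently_iter_of_mem_deriveFold ih L (fun _ : Fin (n + 1) => ε) (fun _ => hε) x hx' V hV
      refine this (((eventually_avgFilter 𝕜).1 hn).mono ?_)
      rintro w hw ⟨y, hy, hyV, hyw⟩
      refine hw ⟨y, hy, hyV, ?_⟩
      have hn' : (0 : ℝ) < (n + 1 : ℕ) := by positivity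
      rw [map_smul, smul_eq_mul, ← RCLike.ofReal_natCast, ← RCLike.ofReal_inv,
        RCLike.re_ofReal_mul, map_sum, map_sum, lt_inv_mul_iff₀ hn']
      calc ((n + 1 : ℕ) : ℝ) * (ε / 5) = ∑ _i : Fin (n + 1), ε / 5 := by simp
        _ < _ := Finset.sum_lt_sum_of_nonempty Finset.univ_nonempty fun i _ => hyw i
  | limit ξ hξ ih =>
      intro ε hε L x hx V hV H
      obtain ⟨ζ, hζ, h⟩ := (mem_blockFilter_limit 𝕜 hξ).1 H
      exact ih ζ hζ ε hε L x (deriveIter_anti ε L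
        (Ordinal.opow_le_opow_right Ordinal.omega0_pos hζ.le) hx) V hV h

/-- A weak-star cluster point `y₀` of the functionals lies in the derived set: `y₀ z` tends to `0`
while `‖y z‖ ≥ b`, so functionals in `K` arbitrarily close to `y₀` weak-star are at distance more
than `b'` from it. -/
theorem derive_nonempty_of_frequently {K : Set (StrongDual 𝕜 X)} (hK : IsWeakStarClosed K) {R : ℝ}
    (hR : ∀ y ∈ K, ‖y‖ ≤ R) {b b' : ℝ} (hb : b' < b)
    (h : ∃ᶠ z in nullFilter 𝕜 X, ∃ y ∈ K, b ≤ ‖y z‖) : (derive b' K).Nonempty := by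
  let S : Set (X × WeakDual 𝕜 X) := {p | WeakDual.toStrongDual p.2 ∈ K ∧ b ≤ ‖p.2 p.1‖}
  have hne : (comap Prod.fst (nullFilter 𝕜 X) ⊓ 𝓟 S).NeBot := by
    rw [← frequently_mem_iff_neBot, frequently_comap]
    refine h.mono ?_
    rintro z ⟨y, hy, hyz⟩
    exact ⟨(z, StrongDual.toWeakDual y), rfl, hy, hyz⟩
  let G := Ultrafilter.of (comap Prod.fst (nullFilter 𝕜 X) ⊓ 𝓟 S)
  have hG := Ultrafilter.of_le (comap Prod.fst (nullFilter 𝕜 X) ⊓ 𝓟 S)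
  have hGS : ∀ᶠ p in (G : Filter (X × WeakDual 𝕜 X)), p ∈ S :=
    hG (mem_inf_of_right (mem_principal_self S))
  have hGx : Tendsto Prod.fst (G : Filter (X × WeakDual 𝕜 X)) (nullFilter 𝕜 X) :=
    tendsto_iff_comap.2 (hG.trans inf_le_left)
  obtain ⟨y₀, hy₀, hy₀G⟩ := (hK.isCompact hR).ultrafilter_le_nhds (G.map Prod.snd)
    (le_principal_iff.2 (hGS.mono fun p hp => hp.1))
  refine ⟨WeakDual.toStrongDual y₀, hy₀, fun hb' V hV => ?_⟩
  have h1 : ∀ᶠ p in (G : Filter (X × WeakDual 𝕜 X)), p.2 ∈ V := hy₀G hV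
  have h2 : ∀ᶠ p in (G : Filter (X × WeakDual 𝕜 X)), ‖y₀ p.1‖ < b - b' := by
    have := (tendsto_apply_nullFilter 𝕜 (WeakDual.toStrongDual y₀)).comp hGx
    simpa [dist_eq_norm] using Metric.tendsto_nhds.1 this (b - b') (by linarith)
  have h3 := hGx.eventually (eventually_norm_le_nullFilter 𝕜)
  have h4 : y₀ ∈ V := mem_of_mem_nhds (x := y₀) hV
  obtain ⟨p, hp1, hp2, hp3, hp4⟩ := (h1.and (h2.and (h3.and hGS))).exists
  refine lt_of_lt_of_le ?_ (Metric.edist_le_ediam_of_mem (x := WeakDual.toStrongDual p.2)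
    (y := WeakDual.toStrongDual y₀) ⟨hp1, hp4.1⟩ ⟨h4, hy₀⟩)
  rw [edist_dist, ENNReal.ofReal_lt_ofReal_iff_of_nonneg hb'.le, dist_eq_norm]
  have h5 := (WeakDual.toStrongDual p.2 - WeakDual.toStrongDual y₀).le_of_opNorm_le_of_le le_rfl hp3
  have h6 := norm_sub_norm_le (p.2 p.1) (y₀ p.1)
  have h7 : ‖p.2 p.1 - y₀ p.1‖ ≤ ‖WeakDual.toStrongDual p.2 - WeakDual.toStrongDual y₀‖ * 1 := h5
  have := hp4.2
  linarith

/-- For fixed `z` the induction is applied to the weak-star closed set `K ∩ {y | b 0 ≤ ‖y z‖}`. The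
functional obtained survives the inner derivations of `K` and is still large at `z`, which feeds the
outermost one. Coordinates with `b' i = 0` are placeholders. -/
theorem deriveFold_nonempty_of_frequently_of {ξ : Ordinal.{u}} {R : ℝ}
    (h : ∀ K : Set (StrongDual 𝕜 X), IsWeakStarClosed K → (∀ y ∈ K, ‖y‖ ≤ R) → ∀ b b' : ℝ, 0 < b' →
      b' < b → (∃ᶠ z in blockFilter 𝕜 X ξ, ∃ y ∈ K, b ≤ ‖y z‖) → (deriveIter b' (ω ^ ξ) K).Nonempty) :
    ∀ {n : ℕ} (K : Set (StrongDual 𝕜 X)), IsWeakStarClosed K → (∀ y ∈ K, ‖y‖ ≤ R) →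
      ∀ b b' : Fin n → ℝ, (∀ i, b' i = 0 ∨ 0 < b' i ∧ b' i < b i) →
      (∃ᶠ w in iter (blockFilter 𝕜 X ξ) n, ∃ y ∈ K, ∀ i, b i ≤ ‖y (w i)‖) →
      (deriveFold ξ b' K).Nonempty
  | 0, K, _, _, b, b', _, hw => by
      obtain ⟨y, hy, -⟩ := frequently_iter_zero.1 hw
      rw [deriveFold_zero]
      exact ⟨y, hy⟩
  | n + 1, K, hK, hR, b, b', hb, hw => by
      have key : ∃ᶠ z in blockFilter 𝕜 X ξ,
          ∃ y ∈ deriveFold ξ (fun i => b' (Fin.succ i)) K, b 0 ≤ ‖y z‖ := by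
        refine (frequently_iter_succ.1 hw).mono fun z hz => ?_
        obtain ⟨y, hy⟩ := deriveFold_nonempty_of_frequently_of h
          (K ∩ {y | b 0 ≤ ‖y z‖}) (hK.inter (isWeakStarClosed_le_norm _ _)) (fun y hy => hR y hy.1)
          (fun i => b i.succ) (fun i => b' i.succ) (fun i => hb i.succ) (hz.mono fun w hw => by
            obtain ⟨y, hy, hyw⟩ := hw
            exact ⟨y, ⟨hy, by simpa using hyw 0⟩, fun i => by simpa using hyw i.succ⟩)
        exact ⟨y, deriveFold_mono ξ _ Set.inter_subset_left hy, (deriveFold_subset ξ _ _ hy).2⟩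
      rw [deriveFold_succ]
      rcases hb 0 with h0 | ⟨h0, h1⟩
      · rw [h0, deriveIter_zero_left]
        obtain ⟨z, y, hy, -⟩ := key.exists
        exact ⟨y, hy⟩
      · exact h _ (hK.deriveFold ξ _) (fun y hy => hR y (deriveFold_subset ξ _ _ hy)) _ _ h0 h1 key

/-- Coordinates below `c` contribute at most `c` each and the remaining ones at most `R` more, so a
large average forces many large coordinates. -/
theorem le_card_of_le_norm_avg {n : ℕ} {R b c : ℝ} (hc : 0 ≤ c) (w : Fin (n + 1) → 𝕜)
    (hw : ∀ i, ‖w i‖ ≤ R) (h : b ≤ ‖((n + 1 : ℕ) : 𝕜)⁻¹ • ∑ i, w i‖) :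
    (n + 1) * (b - c) ≤ R * (Finset.univ.filter fun i => c ≤ ‖w i‖).card := by
  have hn' : (0 : ℝ) < (n + 1 : ℕ) := by positivity
  rw [norm_smul, norm_inv, RCLike.norm_natCast, le_inv_mul_iff₀ hn'] at h
  have h1 : ∑ i, ‖w i‖ ≤ ∑ i : Fin (n + 1), (c + if c ≤ ‖w i‖ then R else 0) :=
    Finset.sum_le_sum fun i _ => by
      split_ifs with hi
      · linarith [hw i]
      · linarith
  rw [Finset.sum_add_distrib, ← Finset.sum_filter] at h1
  simp only [Finset.sum_const, Finset.card_univ, Fintype.card_fin, nsmul_eq_mul] at h1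
  have h2 := norm_sum_le Finset.univ w
  push_cast at h h1
  linarith

/-- At a successor, a functional large on a long average is large on `m` of its blocks, and this
gives `ω ^ ξ * m` derivations. As `m` is arbitrary, weak-star compactness reaches `ω ^ ξ * ω`. -/
theorem deriveIter_nonempty_of_frequently (ξ : Ordinal.{u}) {R : ℝ} (hR0 : 0 < R) :
    ∀ K : Set (StrongDual 𝕜 X), IsWeakStarClosed K → (∀ y ∈ K, ‖y‖ ≤ R) → ∀ b b' : ℝ, 0 < b' →
      b' < b → (∃ᶠ z in blockFilter 𝕜 X ξ, ∃ y ∈ K, b ≤ ‖y z‖) →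
        (deriveIter b' (ω ^ ξ) K).Nonempty := by
  induction ξ using Ordinal.limitRecOn with
  | zero =>
      intro K hK hR b b' _ hb h
      rw [blockFilter_zero] at h
      rw [Ordinal.opow_zero, ← zero_add (1 : Ordinal.{u}), deriveIter_add_one, deriveIter_zero]
      exact derive_nonempty_of_frequently hK hR hb h
  | add_one ξ ih =>
      intro K hK hR b b' hb' hb h
      classical
      have key : ∀ m : ℕ, (deriveIter b' (ω ^ ξ * m) K).Nonempty := by
        intro m
        -- The gap `b - c` pays for the small coordinates, and `b' < c` is the strict inequality
        -- that the induction hypothesis requires.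
        obtain ⟨c, hc', hc⟩ := exists_between hb
        obtain ⟨n, hn⟩ := exists_nat_gt (R * m / (b - c))
        have hw : ∃ᶠ w in iter (blockFilter 𝕜 X ξ) (n + 1), ∃ y ∈ K,
            b ≤ ‖y (((n + 1 : ℕ) : 𝕜)⁻¹ • ∑ i, w i)‖ := by
          rw [← frequently_avgFilter 𝕜 (p := fun z => ∃ y ∈ K, b ≤ ‖y z‖)]
          refine h.filter_mono ?_
          rw [blockFilter_add_one]
          exact iInf_le _ n
        have hball := eventually_iter_forall ((eventually_norm_le_nullFilter 𝕜).filter_mono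
          (blockFilter_le_nullFilter 𝕜 (X := X) ξ)) (n + 1)
        have hI : ∃ᶠ w in iter (blockFilter 𝕜 X ξ) (n + 1), ∃ I : Finset (Fin (n + 1)),
            m ≤ I.card ∧ ∃ y ∈ K, ∀ i, (if i ∈ I then c else 0) ≤ ‖y (w i)‖ := by
          refine (hw.and_eventually hball).mono ?_
          rintro w ⟨⟨y, hy, hyw⟩, hw1⟩
          refine ⟨Finset.univ.filter fun i => c ≤ ‖y (w i)‖, ?_, y, hy, fun i => ?_⟩
          · rw [map_smul, map_sum] at hyw
            have := le_card_of_le_norm_avg (R := R) (hb'.trans hc').le (fun i => y (w i))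
              (fun i => by simpa using y.le_of_opNorm_le_of_le (hR y hy) (hw1 i)) hyw
            have h1 : R * m < n * (b - c) := (div_lt_iff₀ (by linarith)).1 hn
            have h2 : R * (m : ℝ) ≤ R * (Finset.univ.filter fun i => c ≤ ‖y (w i)‖).card := by
              linarith
            exact_mod_cast (mul_le_mul_iff_right₀ hR0).1 h2
          · split_ifs with hi
            · simpa using hi
            · exact norm_nonneg _
        -- The set of large coordinates varies with `w` but has finitely many possible values.
        obtain ⟨I, hI⟩ := frequently_exists_of_finite hI
        obtain ⟨-, hm, -⟩ := hI.exists
        have := deriveFold_nonempty_of_frequently_of ih K hK hR (fun i => if i ∈ I then c else 0)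
          (fun i => if i ∈ I then b' else 0) (fun i => by
            by_cases hi : i ∈ I
            · simp [hi, hb', hc']
            · simp [hi]) (hI.mono fun w hw => hw.2)
        rw [deriveFold_ite] at this
        refine this.mono (deriveIter_anti b' K ?_)
        rw [Finset.filter_mem_eq_inter, Finset.univ_inter]
        exact mul_le_mul_right (by exact_mod_cast hm) _
      have hpos : (0 : Ordinal.{u}) < ω ^ ξ := Ordinal.opow_pos _ Ordinal.omega0_pos
      rw [Ordinal.opow_add, Ordinal.opow_one]
      refine deriveIter_limit_nonempty hK hR
        (Ordinal.isSuccLimit_mul_right hpos Ordinal.isSuccLimit_omega0) fun ζ hζ => ?_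
      obtain ⟨d, hd, hζd⟩ := (Ordinal.lt_mul_iff_of_isSuccLimit Ordinal.isSuccLimit_omega0).1 hζ
      obtain ⟨m, rfl⟩ := Ordinal.lt_omega0.1 hd
      exact (key m).mono (deriveIter_anti b' K hζd.le)
  | limit ξ hξ ih =>
      intro K hK hR b b' hb' hb h
      refine deriveIter_limit_nonempty hK hR
        (Ordinal.isSuccLimit_opow Ordinal.one_lt_omega0 hξ) fun η hη => ?_
      obtain ⟨ζ, hζ, hηζ⟩ := (Ordinal.lt_opow_of_isSuccLimit Ordinal.omega0_ne_zero hξ).1 hη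
      exact (ih ζ hζ K hK hR b b' hb' hb (h.filter_mono (blockFilter_anti 𝕜 X hζ.le))).mono
        (deriveIter_anti b' K hηζ.le)

theorem frequently_iter_of_deriveFold_nonempty (ξ : Ordinal.{u}) {K : Set (StrongDual 𝕜 X)} {n : ℕ}
    {ε : Fin n → ℝ} (hε : ∀ i, 0 < ε i) (h : (deriveFold ξ ε K).Nonempty) :
    ∃ᶠ w in iter (blockFilter 𝕜 X ξ) n, ∃ y ∈ K, ∀ i, ε i / 5 < RCLike.re (y (w i)) := by
  obtain ⟨x, hx⟩ := h
  refine (frequently_iter_of_mem_deriveFold (frequently_blockFilter_of_mem_deriveIter ξ) K ε hε x hx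
    Set.univ univ_mem).mono ?_
  rintro w ⟨y, hy, -, hyw⟩
  exact ⟨y, hy, hyw⟩

theorem deriveFold_nonempty_of_frequently (ξ : Ordinal.{u}) {K : Set (StrongDual 𝕜 X)}
    (hK : IsWeakStarClosed K) {R : ℝ} (hR : ∀ y ∈ K, ‖y‖ ≤ R) {n : ℕ} {b b' : Fin n → ℝ}
    (hb : ∀ i, b' i = 0 ∨ 0 < b' i ∧ b' i < b i)
    (h : ∃ᶠ w in iter (blockFilter 𝕜 X ξ) n, ∃ y ∈ K, ∀ i, b i ≤ ‖y (w i)‖) :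
    (deriveFold ξ b' K).Nonempty :=
  deriveFold_nonempty_of_frequently_of
    (deriveIter_nonempty_of_frequently ξ (R := max R 1) (by positivity)) K hK
    (fun y hy => (hR y hy).trans (le_max_left _ _)) b b' hb h

end Duality

/-! ### Upper estimates along block filters -/

section Estimate

variable {𝕜 : Type} [RCLike 𝕜] {W X Y Z : Type v} [NormedAddCommGroup W] [NormedSpace 𝕜 W]
  [NormedAddCommGroup X] [NormedSpace 𝕜 X] [NormedAddCommGroup Y] [NormedSpace 𝕜 Y]
  [NormedAddCommGroup Z] [NormedSpace 𝕜 Z]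

theorem support_adjointBall (A : X →L[𝕜] Y) (x : X) : support (adjointBall A) x = ‖A x‖ := by
  have h : ∀ r ∈ (fun f : StrongDual 𝕜 X => RCLike.re (f x)) '' adjointBall A, r ≤ ‖A x‖ := by
    rintro _ ⟨_, ⟨g, hg, rfl⟩, rfl⟩
    refine (RCLike.re_le_norm _).trans ?_
    simpa using g.le_of_opNorm_le (mem_closedBall_zero_iff.1 hg) (A x)
  obtain ⟨g, hg, hgx⟩ := exists_dual_vector'' 𝕜 (A x)
  have hmem : ‖A x‖ ∈ (fun f : StrongDual 𝕜 X => RCLike.re (f x)) '' adjointBall A :=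
    ⟨_, ⟨g, mem_closedBall_zero_iff.2 hg, rfl⟩, by simp [hgx]⟩
  exact le_antisymm (csSup_le ⟨_, hmem⟩ h) (le_csSup ⟨_, h⟩ hmem)

theorem norm_le_of_mem_adjointBall {A : X →L[𝕜] Y} {y : StrongDual 𝕜 X} (hy : y ∈ adjointBall A) :
    ‖y‖ ≤ ‖A‖ := by
  obtain ⟨g, hg, rfl⟩ := hy
  refine (g.opNorm_comp_le A).trans ?_
  exact mul_le_of_le_one_left (norm_nonneg _) (mem_closedBall_zero_iff.1 hg)

theorem isWeakStarClosed_adjointBall (A : X →L[𝕜] Y) : IsWeakStarClosed (adjointBall A) := by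
  let T : WeakDual 𝕜 Y → WeakDual 𝕜 X := fun g =>
    StrongDual.toWeakDual ((WeakDual.toStrongDual g).comp A)
  have hT : Continuous T :=
    WeakDual.continuous_of_continuous_eval fun x => continuous_weakDual_apply (A x)
  have e : (WeakDual.toStrongDual ⁻¹' adjointBall A : Set (WeakDual 𝕜 X)) =
      T '' (WeakDual.toStrongDual ⁻¹' Metric.closedBall 0 1) := by
    ext f
    constructor
    · rintro ⟨g, hg, h⟩
      exact ⟨StrongDual.toWeakDual g, hg, h⟩
    · rintro ⟨g, hg, rfl⟩
      exact ⟨WeakDual.toStrongDual g, hg, rfl⟩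
  rw [IsWeakStarClosed, e]
  exact ((WeakDual.isCompact_closedBall (0 : StrongDual 𝕜 Y) 1).image hT).isClosed

/-- The upper `p`-estimate with constant `c` along the iterated block filter. -/
def EventualBound (ξ : Ordinal.{u}) (p : ℝ≥0∞) (n : ℕ) (A : X →L[𝕜] Y) (c : ℝ) : Prop :=
  ∀ (a : Fin n → 𝕜) (ε : ℝ), 0 < ε → ∀ᶠ w in iter (blockFilter 𝕜 X ξ) n,
    ‖A (∑ i, a i • w i)‖ < c * ‖(WithLp.toLp p a : PiLp p fun _ : Fin n => 𝕜)‖ + ε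

theorem upperEstimate_adjointBall_iff (ξ : Ordinal.{u}) (p : ℝ≥0∞) {n : ℕ} (hn : n ≠ 0)
    (A : X →L[𝕜] Y) (c : ℝ) :
    UpperEstimate ξ p n (adjointBall A) c ↔ EventualBound ξ p n A c := by
  simp only [UpperEstimate, support_adjointBall]
  constructor
  · intro h a ε hε
    rw [eventually_iter_blockFilter_iff ξ hn]
    intro D _ _ _ x hx hw
    -- The trivial property shows that maximal branches exist; a real infimum over the empty set
    -- would be `0` and carry no information.
    obtain ⟨t, ht, -⟩ := (eventually_iter_blockFilter_iff ξ hn fun _ => True).1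
      (.of_forall fun _ => trivial) D x hx hw
    have : Nonempty (maxNodes (decorate (Gamma ξ n) D)) := ⟨⟨t, ht⟩⟩
    obtain ⟨⟨t, ht⟩, h⟩ := exists_lt_of_ciInf_lt ((h D a x hx hw).trans_lt (lt_add_of_pos_right _ hε))
    exact ⟨t, ht, h⟩
  · intro h D _ _ _ a x hx hw
    refine le_of_forall_pos_le_add fun ε hε => ?_
    obtain ⟨t, ht, h⟩ := (eventually_iter_blockFilter_iff ξ hn _).1 (h a ε hε) D x hx hw
    refine (ciInf_le ⟨0, ?_⟩ (⟨t, ht⟩ : maxNodes (decorate (Gamma ξ n) D))).trans h.le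
    rintro _ ⟨s, rfl⟩
    exact norm_nonneg _

theorem EventualBound.mono {ξ : Ordinal.{u}} {p : ℝ≥0∞} [Fact (1 ≤ p)] {n : ℕ} {A : X →L[𝕜] Y}
    {c d : ℝ} (h : EventualBound ξ p n A c) (hcd : c ≤ d) : EventualBound ξ p n A d :=
  fun a ε hε => (h a ε hε).mono fun _ hw => hw.trans_le (by gcongr)

/-- For fixed coefficients `a`, enlarging the constant `c` slightly costs an arbitrarily small
multiple of `‖a‖`, which the slack `ε` in `EventualBound` absorbs. -/
theorem alpha_adjointBall_le_iff {ξ : Ordinal.{u}} {p : ℝ≥0∞} [Fact (1 ≤ p)] {A : X →L[𝕜] Y}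
    {c : ℝ≥0} :
    alpha ξ p (adjointBall A) ≤ c ↔ ∀ n ≠ 0, EventualBound ξ p n A c := by
  simp only [alpha, iSup_le_iff, Nat.one_le_iff_ne_zero]
  refine forall₂_congr fun n hn => ?_
  constructor
  · intro h a ε hε
    set N := ‖(WithLp.toLp p a : PiLp p fun _ : Fin n => 𝕜)‖ with hN
    have hN0 : 0 ≤ N := norm_nonneg _
    have hδ : 0 < ε / (2 * (N + 1)) := by positivity
    have h1 : alphaN ξ p n (adjointBall A) < ENNReal.ofReal (c + ε / (2 * (N + 1))) := by
      refine h.trans_lt ?_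
      rw [← ENNReal.ofReal_coe_nnreal, ENNReal.ofReal_lt_ofReal_iff_of_nonneg c.coe_nonneg]
      linarith
    simp only [alphaN, iInf_lt_iff] at h1
    obtain ⟨α, ⟨hα, hU⟩, h1⟩ := h1
    rw [ENNReal.ofReal_lt_ofReal_iff_of_nonneg hα.le] at h1
    have h2 := ((upperEstimate_adjointBall_iff ξ p hn A α).1 hU).mono h1.le
    refine (h2 a (ε / 2) (by positivity)).mono fun w hw => hw.trans_le ?_
    rw [← hN]
    have : ε / (2 * (N + 1)) * N ≤ ε / 2 := by
      rw [div_mul_eq_mul_div, div_le_div_iff₀ (by positivity) (by positivity)]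
      nlinarith
    linarith
  · intro h
    refine ENNReal.le_of_forall_pos_le_add fun δ hδ _ => ?_
    have hpos : (0 : ℝ) < c + δ := add_pos_of_nonneg_of_pos c.coe_nonneg hδ
    refine (iInf₂_le ((c : ℝ) + δ) ⟨hpos, (upperEstimate_adjointBall_iff ξ p hn A _).2
      (h.mono (by simp))⟩).trans ?_
    rw [ENNReal.ofReal_add c.coe_nonneg δ.coe_nonneg, ENNReal.ofReal_coe_nnreal, ENNReal.ofReal_coe_nnreal]

variable {ξ : Ordinal.{u}} {p : ℝ≥0∞} [Fact (1 ≤ p)]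

theorem alpha_add_le (A B : X →L[𝕜] Y) :
    alpha ξ p (adjointBall (A + B)) ≤ alpha ξ p (adjointBall A) + alpha ξ p (adjointBall B) := by
  rcases eq_or_ne (alpha ξ p (adjointBall A)) ∞ with hA | hA
  · simp [hA]
  rcases eq_or_ne (alpha ξ p (adjointBall B)) ∞ with hB | hB
  · simp [hB]
  lift alpha ξ p (adjointBall A) to ℝ≥0 using hA with c hc
  lift alpha ξ p (adjointBall B) to ℝ≥0 using hB with d hd
  have hA := alpha_adjointBall_le_iff.1 hc.ge
  have hB := alpha_adjointBall_le_iff.1 hd.ge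
  rw [← ENNReal.coe_add, alpha_adjointBall_le_iff]
  intro n hn a ε hε
  filter_upwards [hA n hn a (ε / 2) (by positivity), hB n hn a (ε / 2) (by positivity)] with w h1 h2
  rw [add_apply, NNReal.coe_add, add_mul]
  linarith [norm_add_le (A (∑ i, a i • w i)) (B (∑ i, a i • w i))]

theorem alpha_comp_le (C : W →L[𝕜] X) (B : X →L[𝕜] Y) (A : Y →L[𝕜] Z)
    (hB : alpha ξ p (adjointBall B) ≠ ∞) :
    alpha ξ p (adjointBall (A.comp (B.comp C))) ≤
      ‖A‖ₑ * alpha ξ p (adjointBall B) * ‖C‖ₑ := by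
  lift alpha ξ p (adjointBall B) to ℝ≥0 using hB with c hc
  have hB := alpha_adjointBall_le_iff.1 hc.ge
  rw [enorm_eq_nnnorm, enorm_eq_nnnorm, ← ENNReal.coe_mul, ← ENNReal.coe_mul,
    alpha_adjointBall_le_iff]
  intro n hn a ε hε
  rcases eq_or_ne C 0 with rfl | hC
  · simp [hε]
  have hC' : 0 < ‖C‖ := norm_pos_iff.2 hC
  -- Block filters are transported by contractions only, so `C` is normalised first.
  set T : W →L[𝕜] X := ((‖C‖⁻¹ : ℝ) : 𝕜) • C with hT
  have hT1 : ‖T‖ ≤ 1 := by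
    rw [hT, norm_smul, RCLike.norm_ofReal, abs_of_pos (inv_pos.2 hC'), inv_mul_cancel₀ hC'.ne']
  have hCT : ∀ z, C z = (‖C‖ : 𝕜) • T z := fun z => by
    rw [hT, smul_apply, smul_smul, ← RCLike.ofReal_mul, mul_inv_cancel₀ hC'.ne',
      RCLike.ofReal_one, one_smul]
  have hδ : 0 < ε / (‖A‖ * ‖C‖ + 1) := by positivity
  filter_upwards [(tendsto_iter (tendsto_blockFilter 𝕜 hT1 ξ) n).eventually (hB n hn a _ hδ)] with w hw
  have e : C (∑ i, a i • w i) = (‖C‖ : 𝕜) • ∑ i, a i • T (w i) := by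
    rw [hCT, map_sum]
    simp
  rw [ContinuousLinearMap.comp_apply, ContinuousLinearMap.comp_apply, e, map_smul]
  refine (A.le_opNorm _).trans_lt ?_
  rw [norm_smul, RCLike.norm_ofReal, abs_norm]
  have h1 : ‖A‖ * (‖C‖ * ‖B (∑ i, a i • T (w i))‖) ≤ ‖A‖ * (‖C‖ * (c *
      ‖(WithLp.toLp p a : PiLp p fun _ : Fin n => 𝕜)‖ + ε / (‖A‖ * ‖C‖ + 1))) := by gcongr
  have h2 : ‖A‖ * ‖C‖ * (ε / (‖A‖ * ‖C‖ + 1)) < ε := by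
    rw [mul_div_assoc', div_lt_iff₀ (by positivity)]
    linarith
  push_cast
  linarith

theorem alpha_smul_le (c : 𝕜) (A : X →L[𝕜] Y) (hA : alpha ξ p (adjointBall A) ≠ ∞) :
    alpha ξ p (adjointBall (c • A)) ≤ ‖c‖ₑ * alpha ξ p (adjointBall A) := by
  lift alpha ξ p (adjointBall A) to ℝ≥0 using hA with d hd
  have hA := alpha_adjointBall_le_iff.1 hd.ge
  rw [enorm_eq_nnnorm, ← ENNReal.coe_mul, alpha_adjointBall_le_iff]
  intro n hn a ε hε
  have hδ : 0 < ε / (‖c‖ + 1) := by positivity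
  filter_upwards [hA n hn a _ hδ] with w hw
  rw [smul_apply, norm_smul]
  have h1 : ‖c‖ * ‖A (∑ i, a i • w i)‖ ≤ ‖c‖ * (d *
      ‖(WithLp.toLp p a : PiLp p fun _ : Fin n => 𝕜)‖ + ε / (‖c‖ + 1)) := by gcongr
  have h2 : ‖c‖ * (ε / (‖c‖ + 1)) < ε := by
    rw [mul_div_assoc', div_lt_iff₀ (by positivity)]
    linarith
  push_cast
  linarith

/-- Blocks are weakly null, so `f` is eventually small on each of the finitely many blocks while the
coefficients stay fixed. -/
theorem alpha_smulRight (f : StrongDual 𝕜 X) (y : Y) :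
    alpha ξ p (adjointBall (ContinuousLinearMap.smulRight f y)) = 0 := by
  rw [← nonpos_iff_eq_zero, ← ENNReal.coe_zero, alpha_adjointBall_le_iff]
  intro n hn a ε hε
  set S := (∑ i, ‖a i‖) * ‖y‖ with hS
  have hS0 : 0 ≤ S := by positivity
  have hδ : 0 < ε / (S + 1) := by positivity
  have hf : ∀ᶠ z in blockFilter 𝕜 X ξ, ‖f z‖ < ε / (S + 1) :=
    ((by simpa using Metric.tendsto_nhds.1 (tendsto_apply_nullFilter 𝕜 f) _ hδ :
      ∀ᶠ z in nullFilter 𝕜 X, ‖f z‖ < ε / (S + 1))).filter_mono (blockFilter_le_nullFilter 𝕜 ξ)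
  filter_upwards [eventually_iter_forall hf n] with w hw
  have h1 : ‖f (∑ i, a i • w i)‖ ≤ (∑ i, ‖a i‖) * (ε / (S + 1)) := by
    rw [map_sum, Finset.sum_mul]
    refine norm_sum_le_of_le _ fun i _ => ?_
    rw [map_smul, norm_smul]
    exact mul_le_mul_of_nonneg_left (hw i).le (norm_nonneg _)
  rw [ContinuousLinearMap.smulRight_apply, norm_smul, NNReal.coe_zero, zero_mul, zero_add]
  calc ‖f (∑ i, a i • w i)‖ * ‖y‖ ≤ (∑ i, ‖a i‖) * (ε / (S + 1)) * ‖y‖ := by gcongr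
    _ = S * ε / (S + 1) := by rw [hS]; ring
    _ < ε := by rw [div_lt_iff₀ (by positivity)]; linarith

theorem alpha_zero : alpha ξ p (adjointBall (0 : X →L[𝕜] Y)) = 0 := by
  simpa using alpha_smulRight (ξ := ξ) (p := p) (0 : StrongDual 𝕜 X) (0 : Y)

theorem alpha_smul (c : 𝕜) (A : X →L[𝕜] Y) (hA : alpha ξ p (adjointBall A) ≠ ∞) :
    alpha ξ p (adjointBall (c • A)) = ‖c‖ₑ * alpha ξ p (adjointBall A) := by
  refine le_antisymm (alpha_smul_le c A hA) ?_
  rcases eq_or_ne c 0 with rfl | hc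
  · simp
  have h := alpha_smul_le c A hA
  have h1 := alpha_smul_le c⁻¹ (c • A)
    (h.trans_lt (ENNReal.mul_lt_top enorm_lt_top hA.lt_top)).ne
  rw [inv_smul_smul₀ hc] at h1
  calc ‖c‖ₑ * alpha ξ p (adjointBall A) ≤ ‖c‖ₑ * (‖c⁻¹‖ₑ * alpha ξ p (adjointBall (c • A))) := by
        gcongr
    _ = alpha ξ p (adjointBall (c • A)) := by
        rw [← mul_assoc, ← enorm_mul, mul_inv_cancel₀ hc, enorm_one, one_mul]

/-- Lower semicontinuity in the operator norm: blocks lie in the unit ball, so for fixed `a` the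
vector `∑ aᵢ wᵢ` has norm at most `∑ ‖aᵢ‖`, and a small change of the operator changes its image
little. -/
theorem alpha_le_of_forall_near {A : X →L[𝕜] Y} {c : ℝ≥0∞}
    (h : ∀ δ : ℝ, 0 < δ → ∃ B : X →L[𝕜] Y, ‖B - A‖ < δ ∧ alpha ξ p (adjointBall B) ≤ c) :
    alpha ξ p (adjointBall A) ≤ c := by
  rcases eq_or_ne c ∞ with rfl | hc
  · exact le_top
  lift c to ℝ≥0 using hc
  rw [alpha_adjointBall_le_iff]
  intro n hn a ε hε
  set S := ∑ i, ‖a i‖ with hS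
  have hS0 : 0 ≤ S := Finset.sum_nonneg fun i _ => norm_nonneg _
  obtain ⟨B, hBA, hB⟩ := h (ε / (2 * (S + 1))) (by positivity)
  filter_upwards [alpha_adjointBall_le_iff.1 hB n hn a (ε / 2) (by positivity),
    eventually_iter_forall ((eventually_norm_le_nullFilter 𝕜).filter_mono
      (blockFilter_le_nullFilter 𝕜 (X := X) ξ)) n] with w h1 h2
  have h3 : ‖∑ i, a i • w i‖ ≤ S := norm_sum_le_of_le _ fun i _ => by
    rw [norm_smul]
    exact mul_le_of_le_one_right (norm_nonneg _) (h2 i)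
  have h4 : ‖(B - A) (∑ i, a i • w i)‖ ≤ ε / (2 * (S + 1)) * S :=
    (B - A).le_of_opNorm_le_of_le hBA.le h3
  have h5 : ε / (2 * (S + 1)) * S ≤ ε / 2 := by
    rw [div_mul_eq_mul_div, div_le_div_iff₀ (by positivity) (by positivity)]
    nlinarith
  have h6 := norm_sub_norm_le (A (∑ i, a i • w i)) (B (∑ i, a i • w i))
  rw [sub_apply, norm_sub_rev] at h4
  linarith

end Estimate

/-! ### Conjugate exponents -/

section Exponent

theorem conj_cases {p : ℝ≥0∞} {q : ℝ} (hp : 1 < p) (hq : 1 ≤ q)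
    (hpq : p⁻¹ + (ENNReal.ofReal q)⁻¹ = 1) :
    p = ∞ ∧ q = 1 ∨ p ≠ ∞ ∧ p.toReal.HolderConjugate q := by
  have hq0 : 0 < q := by linarith
  rw [← ENNReal.ofReal_inv_of_pos hq0] at hpq
  rcases eq_or_ne p ∞ with rfl | h
  · left
    rw [ENNReal.inv_top, zero_add, ENNReal.ofReal_eq_one] at hpq
    exact ⟨rfl, inv_eq_one.1 hpq⟩
  · right
    refine ⟨h, Real.holderConjugate_iff.2 ⟨?_, ?_⟩⟩
    · rwa [← ENNReal.toReal_one, ENNReal.toReal_lt_toReal ENNReal.one_ne_top h]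
    · have hp0 : p⁻¹ ≠ ∞ := ENNReal.inv_ne_top.2 (zero_lt_one.trans hp).ne'
      have := congrArg ENNReal.toReal hpq
      rwa [ENNReal.toReal_add hp0 ENNReal.ofReal_ne_top, ENNReal.toReal_inv,
        ENNReal.toReal_ofReal (inv_nonneg.2 hq0.le), ENNReal.toReal_one] at this

variable {𝕜 : Type} [RCLike 𝕜]

theorem sum_norm_mul_le {p : ℝ≥0∞} {q : ℝ} (hp : 1 < p) (hq : 1 ≤ q)
    (hpq : p⁻¹ + (ENNReal.ofReal q)⁻¹ = 1) {n : ℕ} (a : Fin n → 𝕜) {b : Fin n → ℝ}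
    (hb : ∀ i, 0 ≤ b i) :
    ∑ i, ‖a i‖ * b i ≤
      ‖(WithLp.toLp p a : PiLp p fun _ : Fin n => 𝕜)‖ * (∑ i, b i ^ q) ^ (1 / q) := by
  rcases conj_cases hp hq hpq with ⟨rfl, rfl⟩ | ⟨hp', h⟩
  · simp only [Real.rpow_one, div_one, Finset.mul_sum]
    exact Finset.sum_le_sum fun i _ => mul_le_mul_of_nonneg_right
      (PiLp.norm_apply_le (WithLp.toLp ∞ a : PiLp ∞ fun _ : Fin n => 𝕜) i) (hb i)
  · rw [PiLp.norm_eq_sum h.pos]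
    exact Real.inner_le_Lp_mul_Lq_of_nonneg Finset.univ h (fun i _ => norm_nonneg _) fun i _ => hb i

/-- Converse of Hölder's inequality. The test coefficients realise the case of equality: all `1` if
`p = ∞`, and `ε i ^ (q - 1)` otherwise. -/
theorem sum_rpow_le_of_forall {p : ℝ≥0∞} {q : ℝ} (hp : 1 < p) (hq : 1 ≤ q)
    (hpq : p⁻¹ + (ENNReal.ofReal q)⁻¹ = 1) {n : ℕ} {ε : Fin n → ℝ} (hε : ∀ i, 0 < ε i) {M : ℝ}
    (hM : 0 ≤ M) (h : ∀ a : Fin n → ℝ, (∀ i, 0 ≤ a i) → ∑ i, a i * ε i ≤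
      M * ‖(WithLp.toLp p fun i => (a i : 𝕜) : PiLp p fun _ : Fin n => 𝕜)‖) :
    ∑ i, ε i ^ q ≤ M ^ q := by
  rcases conj_cases hp hq hpq with ⟨rfl, rfl⟩ | ⟨hp', hc⟩
  · simp only [Real.rpow_one]
    have h1 := h (fun _ => 1) fun _ => zero_le_one
    simp only [one_mul] at h1
    refine h1.trans (mul_le_of_le_one_right hM ?_)
    rw [PiLp.norm_eq_ciSup]
    exact Real.iSup_le (fun i => by simp) zero_le_one
  · have hS0 : 0 ≤ ∑ i, ε i ^ q := Finset.sum_nonneg fun i _ => Real.rpow_nonneg (hε i).le _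
    have h1 := h (fun i => ε i ^ (q - 1)) fun i => Real.rpow_nonneg (hε i).le _
    have e1 : ∀ i, ε i ^ (q - 1) * ε i = ε i ^ q := fun i => by
      rw [← Real.rpow_add_one (hε i).ne', sub_add_cancel]
    have e2 : ∀ i, (ε i ^ (q - 1)) ^ p.toReal = ε i ^ q := fun i => by
      rw [← Real.rpow_mul (hε i).le, sub_mul, one_mul, mul_comm q, hc.mul_eq_add, add_sub_cancel_left]
    rw [PiLp.norm_eq_sum hc.pos] at h1
    simp only [e1, RCLike.norm_ofReal, abs_of_nonneg (Real.rpow_nonneg (hε _).le _), e2] at h1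
    rcases hS0.eq_or_lt with hS | hS
    · rw [← hS]
      exact Real.rpow_nonneg hM q
    · have h2 : (∑ i, ε i ^ q) ^ (1 / q) ≤ M := by
        have e3 : (∑ i, ε i ^ q) =
            (∑ i, ε i ^ q) ^ (1 / q) * (∑ i, ε i ^ q) ^ (1 / p.toReal) := by
          rw [← Real.rpow_add hS, one_div, one_div, hc.symm.inv_add_inv_eq_one, Real.rpow_one]
        exact le_of_mul_le_mul_right (e3.symm.trans_le h1) (Real.rpow_pos_of_pos hS _)
      calc ∑ i, ε i ^ q = ((∑ i, ε i ^ q) ^ (1 / q)) ^ q := by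
            rw [← Real.rpow_mul hS0, one_div, inv_mul_cancel₀ hc.symm.ne_zero, Real.rpow_one]
        _ ≤ M ^ q := Real.rpow_le_rpow (Real.rpow_nonneg hS0 _) h2 hc.symm.nonneg

end Exponent

/-! ### Summable Szlenk index and upper estimates -/

section Equivalence

variable {𝕜 : Type} [RCLike 𝕜] {X Y : Type v} [NormedAddCommGroup X] [NormedSpace 𝕜 X]
  [NormedAddCommGroup Y] [NormedSpace 𝕜 Y]

/-- Zero parameters are discarded because the passage from derivations to blocks needs `ε i > 0`. -/
theorem foldr_filter_pos (ξ : Ordinal.{u}) (K : Set (StrongDual 𝕜 X)) {l : List ℝ}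
    (hl : ∀ ε ∈ l, 0 ≤ ε) :
    (l.filter (0 < ·)).foldr (fun ε L => deriveIter ε (ω ^ ξ) L) K =
      l.foldr (fun ε L => deriveIter ε (ω ^ ξ) L) K := by
  induction l with
  | nil => rfl
  | cons a l ih =>
      have ih := ih fun ε hε => hl ε (by simp [hε])
      rcases (hl a (by simp)).eq_or_lt with rfl | ha
      · rw [List.foldr_cons, deriveIter_zero_left, ← ih]
        simp
      · rw [List.foldr_cons, ← ih, List.filter_cons_of_pos (by simpa using ha), List.foldr_cons]

theorem sum_filter_pos {q : ℝ} (hq : 1 ≤ q) {l : List ℝ} (hl : ∀ ε ∈ l, 0 ≤ ε) :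
    ((l.filter (0 < ·)).map (· ^ q)).sum = (l.map (· ^ q)).sum := by
  induction l with
  | nil => rfl
  | cons a l ih =>
      have ih := ih fun ε hε => hl ε (by simp [hε])
      rcases (hl a (by simp)).eq_or_lt with rfl | ha
      · rw [List.map_cons, List.sum_cons, ← ih, Real.zero_rpow (by linarith)]
        simp
      · rw [List.map_cons, List.sum_cons, ← ih, List.filter_cons_of_pos (by simpa using ha),
          List.map_cons, List.sum_cons]

variable {ξ : Ordinal.{u}} {p : ℝ≥0∞} {q : ℝ}

/-- One functional exceeds `ε i / 5` on every block, so testing it on `∑ aᵢ wᵢ` with `aᵢ ≥ 0` gives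
`∑ aᵢ εᵢ ≤ 5 c ‖a‖_p`. Converse Hölder concludes, with `M = 5 c`. -/
theorem hasSummableSzlenkIndex_of_eventualBound (hp : 1 < p) (hq : 1 ≤ q)
    (hpq : p⁻¹ + (ENNReal.ofReal q)⁻¹ = 1) {A : X →L[𝕜] Y} {c : ℝ} (hc : 0 ≤ c)
    (h : ∀ n ≠ 0, EventualBound ξ p n A c) : HasSummableSzlenkIndex ξ q (adjointBall A) := by
  refine ⟨5 * c, by positivity, fun l hl hne => ?_⟩
  rw [← foldr_filter_pos ξ _ hl] at hne
  rw [← sum_filter_pos hq hl]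
  have hpos : ∀ ε ∈ l.filter (0 < ·), 0 < ε := fun ε hε => by simpa using (List.mem_filter.1 hε).2
  generalize l.filter (0 < ·) = l at hne hpos
  obtain ⟨n, ε, rfl⟩ : ∃ n, ∃ ε : Fin n → ℝ, l = List.ofFn ε := ⟨_, l.get, (List.ofFn_get l).symm⟩
  have hε : ∀ i, 0 < ε i := fun i => hpos _ (by simp)
  rcases eq_or_ne n 0 with rfl | hn
  · simpa using Real.rpow_nonneg (by positivity : 0 ≤ 5 * c) q
  rw [List.map_ofFn, List.sum_ofFn]
  refine sum_rpow_le_of_forall (𝕜 := 𝕜) hp hq hpq hε (by positivity) fun a ha => ?_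
  refine le_of_forall_pos_le_add fun δ hδ => ?_
  have hf := frequently_iter_of_deriveFold_nonempty ξ hε hne
  obtain ⟨w, ⟨_, ⟨g, hg, rfl⟩, hgw⟩, hw⟩ :=
    (hf.and_eventually (h n hn (fun i => (a i : 𝕜)) (δ / 5) (by positivity))).exists
  have h1 : RCLike.re (g (A (∑ i, (a i : 𝕜) • w i))) ≤ ‖A (∑ i, (a i : 𝕜) • w i)‖ := by
    refine (RCLike.re_le_norm _).trans ?_
    simpa using g.le_of_opNorm_le (mem_closedBall_zero_iff.1 hg) (A (∑ i, (a i : 𝕜) • w i))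
  have h2 : RCLike.re (g (A (∑ i, (a i : 𝕜) • w i))) = ∑ i, a i * RCLike.re (g (A (w i))) := by
    simp [map_sum]
  have h3 : ∑ i, a i * (ε i / 5) ≤ ∑ i, a i * RCLike.re (g (A (w i))) :=
    Finset.sum_le_sum fun i _ => mul_le_mul_of_nonneg_left (hgw i).le (ha i)
  have h4 : ∑ i, a i * ε i = 5 * ∑ i, a i * (ε i / 5) := by
    rw [Finset.mul_sum]
    exact Finset.sum_congr rfl fun i _ => by ring
  linarith

/-- If the bound fails frequently, the moduli of a norming functional on the blocks, rounded down to
a grid, can be taken constant. Half of these values parametrise a nonempty iterated derivation, so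
the summability bound and Hölder contradict the failure. -/
theorem eventualBound_of_hasSummableSzlenkIndex (hp : 1 < p) (hq : 1 ≤ q)
    (hpq : p⁻¹ + (ENNReal.ofReal q)⁻¹ = 1) {A : X →L[𝕜] Y} {M : ℝ} (hM : 0 ≤ M)
    (h : ∀ l : List ℝ, (∀ ε ∈ l, 0 ≤ ε) →
      (l.foldr (fun ε L => deriveIter ε (ω ^ ξ) L) (adjointBall A)).Nonempty →
      (l.map (fun ε => ε ^ q)).sum ≤ M ^ q) (n : ℕ) :
    EventualBound ξ p n A (2 * M) := by
  intro a ε hε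
  by_contra H
  rw [Filter.not_eventually] at H
  set S := ∑ i, ‖a i‖ with hS
  have hS0 : 0 ≤ S := Finset.sum_nonneg fun i _ => norm_nonneg _
  -- The mesh makes the total rounding error `S * δ` at most `ε / 2`.
  set δ := ε / (2 * (S + 1)) with hδ
  have hδ0 : 0 < δ := by positivity
  have hball := eventually_iter_forall ((eventually_norm_le_nullFilter 𝕜).filter_mono
    (blockFilter_le_nullFilter 𝕜 (X := X) ξ)) n
  have H1 : ∃ᶠ w in iter (blockFilter 𝕜 X ξ) n, ∃ k : Fin n → Fin (⌊‖A‖ / δ⌋₊ + 1),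
      ∃ y ∈ adjointBall A, (∀ i, δ * (k i : ℕ) ≤ ‖y (w i)‖) ∧
        2 * M * ‖(WithLp.toLp p a : PiLp p fun _ : Fin n => 𝕜)‖ + ε ≤
          ∑ i, ‖a i‖ * (δ * (k i : ℕ) + δ) := by
    refine (H.and_eventually hball).mono ?_
    rintro w ⟨hw, hw1⟩
    rw [not_lt] at hw
    obtain ⟨g, hg, hgw⟩ := exists_dual_vector'' 𝕜 (A (∑ i, a i • w i))
    have hy : g.comp A ∈ adjointBall A := ⟨g, mem_closedBall_zero_iff.2 hg, rfl⟩
    have hyw : ∀ i, ‖g (A (w i))‖ ≤ ‖A‖ := fun i => by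
      simpa using (g.comp A).le_of_opNorm_le_of_le (norm_le_of_mem_adjointBall hy) (hw1 i)
    refine ⟨fun i => ⟨⌊‖g (A (w i))‖ / δ⌋₊, Nat.lt_succ_of_le (Nat.floor_le_floor (by
      have := hyw i
      gcongr))⟩, g.comp A, hy, fun i => ?_, hw.trans ?_⟩
    · rw [← le_div_iff₀' hδ0]
      exact Nat.floor_le (by positivity)
    · calc ‖A (∑ i, a i • w i)‖ = ‖g (A (∑ i, a i • w i))‖ := by
            rw [hgw, RCLike.norm_ofReal, abs_norm]
        _ ≤ ∑ i, ‖a i‖ * (δ * (⌊‖g (A (w i))‖ / δ⌋₊ : ℕ) + δ) := by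
            rw [map_sum, map_sum]
            refine norm_sum_le_of_le _ fun i _ => ?_
            rw [map_smul, map_smul, norm_smul]
            refine mul_le_mul_of_nonneg_left ?_ (norm_nonneg _)
            have := (div_lt_iff₀' hδ0).1 (Nat.lt_floor_add_one (‖g (A (w i))‖ / δ))
            linarith
  obtain ⟨k, hk⟩ := frequently_exists_of_finite H1
  obtain ⟨-, -, -, -, hsum⟩ := hk.exists
  have hb0 : ∀ i, 0 ≤ δ * (k i : ℕ) / 2 := fun i => by positivity
  have hne := deriveFold_nonempty_of_frequently ξ (isWeakStarClosed_adjointBall A)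
    (fun y hy => norm_le_of_mem_adjointBall hy) (b := fun i => δ * (k i : ℕ))
    -- Derivation parameters must be strictly below the values attained; halving secures this and
    -- causes the factor `2` in the bound.
    (b' := fun i => δ * (k i : ℕ) / 2) (fun i => by
      rcases (hb0 i).eq_or_lt with h0 | h0
      · exact Or.inl h0.symm
      · exact Or.inr ⟨h0, by linarith⟩)
    (hk.mono fun w hw => by
      obtain ⟨y, hy, hyw, -⟩ := hw
      exact ⟨y, hy, hyw⟩)
  have hM' := h _ (fun ε hε => by
    obtain ⟨i, rfl⟩ := (List.mem_ofFn' _ _).1 hε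
    exact hb0 i) hne
  rw [List.map_ofFn, List.sum_ofFn] at hM'
  have hq0 : 0 < q := by linarith
  have h1 : (∑ i, (δ * (k i : ℕ) / 2) ^ q) ^ (1 / q) ≤ M := by
    calc (∑ i, (δ * (k i : ℕ) / 2) ^ q) ^ (1 / q) ≤ (M ^ q) ^ (1 / q) :=
          Real.rpow_le_rpow (Finset.sum_nonneg fun i _ => Real.rpow_nonneg (hb0 i) _) hM'
            (by positivity)
      _ = M := by rw [← Real.rpow_mul hM, mul_one_div_cancel hq0.ne', Real.rpow_one]
  have : Fact (1 ≤ p) := ⟨hp.le⟩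
  have h2 := (sum_norm_mul_le hp hq hpq a hb0).trans (mul_le_mul_of_nonneg_left h1 (norm_nonneg _))
  have h3 : ∑ i, ‖a i‖ * (δ * (k i : ℕ) + δ) = 2 * ∑ i, ‖a i‖ * (δ * (k i : ℕ) / 2) + S * δ := by
    rw [hS, Finset.mul_sum, Finset.sum_mul, ← Finset.sum_add_distrib]
    exact Finset.sum_congr rfl fun i _ => by ring
  have h4 : S * δ ≤ ε / 2 := by
    rw [hδ, mul_div_assoc', div_le_div_iff₀ (by positivity) (by positivity)]
    nlinarith
  rw [h3] at hsum
  linarith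

theorem hasSummableSzlenkIndex_iff (hp : 1 < p) (hq : 1 ≤ q)
    (hpq : p⁻¹ + (ENNReal.ofReal q)⁻¹ = 1) {A : X →L[𝕜] Y} :
    HasSummableSzlenkIndex ξ q (adjointBall A) ↔ alpha ξ p (adjointBall A) ≠ ∞ := by
  have : Fact (1 ≤ p) := ⟨hp.le⟩
  constructor
  · rintro ⟨M, hM, h⟩
    have h1 : alpha ξ p (adjointBall A) ≤ ENNReal.ofNNReal ⟨2 * M, by positivity⟩ :=
      alpha_adjointBall_le_iff.2 fun n _ =>
        eventualBound_of_hasSummableSzlenkIndex hp hq hpq hM h n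
    exact (h1.trans_lt ENNReal.coe_lt_top).ne
  · intro h
    lift alpha ξ p (adjointBall A) to ℝ≥0 using h with c hc
    exact hasSummableSzlenkIndex_of_eventualBound hp hq hpq c.coe_nonneg
      (alpha_adjointBall_le_iff.1 hc.ge)

end Equivalence

/-! ### The Banach ideal -/

section Ideal

variable {𝕜 : Type} [RCLike 𝕜] {ξ : Ordinal.{u}} {p : ℝ≥0∞} {q : ℝ}

theorem isOperatorIdeal_summableSzlenkClass (hp : 1 < p) (hq : 1 ≤ q)
    (hpq : p⁻¹ + (ENNReal.ofReal q)⁻¹ = 1) :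
    IsOperatorIdeal.{v} 𝕜 (summableSzlenkClass.{u, v} 𝕜 ξ q) := by
  have : Fact (1 ≤ p) := ⟨hp.le⟩
  refine ⟨?_, ?_, ?_⟩
  · intro W X Y Z _ _ _ _ _ _ _ _ _ _ _ _ C B A hB
    have hB := (hasSummableSzlenkIndex_iff hp hq hpq).1 hB
    exact (hasSummableSzlenkIndex_iff hp hq hpq).2 ((alpha_comp_le C B A hB).trans_lt
      (ENNReal.mul_lt_top (ENNReal.mul_lt_top enorm_lt_top hB.lt_top) enorm_lt_top)).ne
  · refine (hasSummableSzlenkIndex_iff hp hq hpq).2 ?_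
    -- The identity of the scalar field is a rank one operator, so its `α` vanishes.
    have e : ContinuousLinearMap.id 𝕜 (ULift.{v} 𝕜) =
        ContinuousLinearMap.smulRight
          ((ContinuousLinearEquiv.ulift : ULift.{v} 𝕜 ≃L[𝕜] 𝕜) : ULift.{v} 𝕜 →L[𝕜] 𝕜)
          (ULift.up 1) := by
      ext z
      exact (mul_one z.down).symm
    rw [e, alpha_smulRight]
    exact ENNReal.zero_ne_top
  · intro X Y _ _ _ _ _ _
    refine ⟨⟨⟨⟨{A | alpha ξ p (adjointBall A) ≠ ∞}, ?_⟩, ?_⟩, ?_⟩, ?_⟩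
    · exact fun hA hB => ((alpha_add_le _ _).trans_lt (ENNReal.add_lt_top.2 ⟨hA.lt_top, hB.lt_top⟩)).ne
    · simp [alpha_zero]
    · exact fun c A hA => ((alpha_smul_le c A hA).trans_lt
        (ENNReal.mul_lt_top enorm_lt_top hA.lt_top)).ne
    · ext A
      exact (hasSummableSzlenkIndex_iff hp hq hpq).symm

theorem isIdealNorm_szlenkNorm (hp : 1 < p) (hq : 1 ≤ q)
    (hpq : p⁻¹ + (ENNReal.ofReal q)⁻¹ = 1) :
    IsIdealNorm.{v} 𝕜 (summableSzlenkClass.{u, v} 𝕜 ξ q) (szlenkNorm.{u, v} 𝕜 ξ p) := by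
  have : Fact (1 ≤ p) := ⟨hp.le⟩
  refine ⟨?_, ?_, ?_, ?_, ?_, ?_⟩
  · intro X Y _ _ _ _ _ _ A hA
    exact ENNReal.add_lt_top.2
      ⟨enorm_lt_top, ((hasSummableSzlenkIndex_iff hp hq hpq).1 hA).lt_top⟩
  · intro X Y _ _ _ _ _ _ A _
    constructor
    · intro h
      exact nnnorm_eq_zero.1 (ENNReal.coe_eq_zero.1 (add_eq_zero.1 h).1)
    · rintro rfl
      rw [szlenkNorm, alpha_zero, add_zero, enorm_eq_nnnorm, nnnorm_zero, ENNReal.coe_zero]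
  · intro X Y _ _ _ _ _ _ c A hA
    rw [szlenkNorm, szlenkNorm, alpha_smul c A ((hasSummableSzlenkIndex_iff hp hq hpq).1 hA),
      enorm_smul, mul_add]
  · intro X Y _ _ _ _ _ _ A _ B _
    refine (add_le_add (enorm_add_le A B) (alpha_add_le A B)).trans_eq ?_
    rw [szlenkNorm, szlenkNorm]
    ring
  · intro W X Y Z _ _ _ _ _ _ _ _ _ _ _ _ C B A hB
    have h1 : ‖A.comp (B.comp C)‖ₑ ≤ ‖A‖ₑ * ‖B‖ₑ * ‖C‖ₑ := by
      simp only [enorm_eq_nnnorm, ← ENNReal.coe_mul, ENNReal.coe_le_coe]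
      calc ‖A.comp (B.comp C)‖₊ ≤ ‖A‖₊ * ‖B.comp C‖₊ := A.opNNNorm_comp_le _
        _ ≤ ‖A‖₊ * (‖B‖₊ * ‖C‖₊) := by gcongr; exact B.opNNNorm_comp_le C
        _ = _ := (mul_assoc _ _ _).symm
    refine (add_le_add h1
      (alpha_comp_le C B A ((hasSummableSzlenkIndex_iff hp hq hpq).1 hB))).trans_eq ?_
    rw [szlenkNorm]
    ring
  · intro X Y _ _ _ _ _ _ f y
    rw [szlenkNorm, alpha_smulRight, add_zero]
    simp only [enorm_eq_nnnorm, ← ENNReal.coe_mul, ENNReal.coe_inj]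
    exact NNReal.eq (ContinuousLinearMap.norm_smulRight_apply f y)

/-- The operator norm is dominated, so a limit `B` exists in operator norm. For large `k` the
operators `A k - A l` have small `α` and approximate `A k - B`, which therefore has small `α` by
lower semicontinuity; `B` lies in the class because `A N` and `A N - B` do. -/
theorem szlenkNorm_complete (hp : 1 < p) (hq : 1 ≤ q) (hpq : p⁻¹ + (ENNReal.ofReal q)⁻¹ = 1)
    (X Y : Type v) [NormedAddCommGroup X] [NormedSpace 𝕜 X] [CompleteSpace X]
    [NormedAddCommGroup Y] [NormedSpace 𝕜 Y] [CompleteSpace Y] (A : ℕ → X →L[𝕜] Y)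
    (hA : ∀ k, A k ∈ summableSzlenkClass.{u, v} 𝕜 ξ q X Y)
    (hC : ∀ ε : ℝ≥0∞, 0 < ε → ∃ N, ∀ k ≥ N, ∀ l ≥ N, szlenkNorm 𝕜 ξ p X Y (A k - A l) < ε) :
    ∃ B ∈ summableSzlenkClass.{u, v} 𝕜 ξ q X Y,
      Tendsto (fun k => szlenkNorm 𝕜 ξ p X Y (A k - B)) atTop (𝓝 0) := by
  have : Fact (1 ≤ p) := ⟨hp.le⟩
  have hcauchy : CauchySeq A := EMetric.cauchySeq_iff.2 fun ε hε => by
    obtain ⟨N, hN⟩ := hC ε hε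
    refine ⟨N, fun k hk l hl => ?_⟩
    rw [edist_eq_enorm_sub]
    exact le_self_add.trans_lt (hN k hk l hl)
  obtain ⟨B, hB⟩ := cauchySeq_tendsto_of_complete hcauchy
  have hα : ∀ ε : ℝ≥0∞, 0 < ε → ∃ N, ∀ k ≥ N, alpha ξ p (adjointBall (A k - B)) ≤ ε := by
    intro ε hε
    obtain ⟨N, hN⟩ := hC ε hε
    refine ⟨N, fun k hk => alpha_le_of_forall_near fun δ hδ => ?_⟩
    obtain ⟨L, hL⟩ := Metric.tendsto_atTop.1 hB δ hδ
    refine ⟨A k - A (max L N), ?_, (le_add_self.trans_lt (hN k hk _ (le_max_right _ _))).le⟩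
    rw [sub_sub_sub_cancel_left, norm_sub_rev, ← dist_eq_norm]
    exact hL _ (le_max_left _ _)
  refine ⟨B, ?_, ?_⟩
  · obtain ⟨S, hS⟩ := (isOperatorIdeal_summableSzlenkClass.{u, v} (𝕜 := 𝕜) (ξ := ξ) hp hq hpq).isSubspace
      X Y
    obtain ⟨N, hN⟩ := hα 1 zero_lt_one
    have h1 : A N ∈ S := by
      rw [← SetLike.mem_coe, hS]
      exact hA N
    have h2 : A N - B ∈ S := by
      rw [← SetLike.mem_coe, hS]
      exact (hasSummableSzlenkIndex_iff hp hq hpq).2 ((hN N le_rfl).trans_lt ENNReal.one_lt_top).ne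
    rw [← hS]
    simpa using S.sub_mem h1 h2
  · have h1 : Tendsto (fun k => ‖A k - B‖ₑ) atTop (𝓝 0) := by
      simpa [edist_eq_enorm_sub] using tendsto_iff_edist_tendsto_0.1 hB
    have h2 : Tendsto (fun k => alpha ξ p (adjointBall (A k - B))) atTop (𝓝 0) :=
      ENNReal.tendsto_atTop_zero.2 hα
    simpa only [add_zero, szlenkNorm] using h1.add h2

end Ideal

end Szlenk

end

theorem mainTheorem4 {𝕜 : Type} [RCLike 𝕜] (ξ : Ordinal.{u}) (p : ℝ≥0∞) (q : ℝ)
    (hp : 1 < p) (hq : 1 ≤ q) (hpq : p⁻¹ + (ENNReal.ofReal q)⁻¹ = 1) :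
    Szlenk.IsBanachIdeal.{v} 𝕜 (Szlenk.summableSzlenkClass.{u, v} 𝕜 ξ q)
      (Szlenk.szlenkNorm.{u, v} 𝕜 ξ p) :=
  ⟨Szlenk.isOperatorIdeal_summableSzlenkClass hp hq hpq, Szlenk.isIdealNorm_szlenkNorm hp hq hpq,
    Szlenk.szlenkNorm_complete hp hq hpq⟩
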